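/- For $\rho>1$ let $\mathcal E_\rho=\{\tfrac12(w+w^{-1}) : |w|=\rho\}$ be the Bernstein ellipse, let $\mathcal A_\rho$ be the set of functions $u$ that are analytic on and within $\mathcal E_\rho$, and put $M=M(u,\rho)=\max_{z\in\mathcal E_\rho}|u(z)|$. For $\alpha>-1$ and $n\ge 1$ let $J_n^{\alpha,\alpha}$ be the Gegenbauer (Jacobi) polynomial of degree $n$, orthogonal on $(-1,1)$ with respect to the weight $\omega^{\alpha}(x)=(1-x^2)^{\alpha}$, let $x_1,\dots,x_n$ be its zeros, and let $\omega_1,\dots,\omega_n$ be the corresponding Gauss quadrature weights (the integrals against $\omega^\alpha$ of the Lagrange basis polynomials of the nodes). Write $$E_n^{GG}[u]=\int_{-1}^1u(x)\,\omega^{\alpha}(x)\,dx-\sum_{j=1}^n u(x_j)\,\omega_j$$ for the remainder of the Gegenbauer-Gauss quadrature, and $E_n^{LG}[u]$ for the Legendre-Gauss remainder (the case $\alpha=0$). (i) Let $\alpha>-1$, $\alpha\neq-\tfrac12$. There are constants $C_n$, depending only on $n$ and $\alpha$, with $C_n=1+O(n^{-1})$ as $n\to\infty$, such that for all $n\ge1$,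 all $\rho>1$ and all $u\in\mathcal A_\rho$, $$\big|E_n^{GG}[u]\big|\le \frac{C_n M\sqrt{\pi}}{\rho^{2n}}\bigg(\frac{\sqrt{\pi}}{2^{2\alpha}}+\frac{\Gamma(\alpha+1)}{\sqrt{\Gamma(2\alpha+2)}}\,\frac{2\sqrt2}{\rho^2-1}\bigg)\begin{cases}(1+\rho^{-2})^{\alpha+1/2}, & \alpha>-1/2,\\ (1-\rho^{-2})^{\alpha+1/2}, & \alpha<-1/2.\end{cases}$$ (ii) In the Legendre case there are constants $C_n$, depending only on $n$, with $C_n=1+O(n^{-1})$ as $n\to\infty$, such that for all $n\ge1$, all $\rho>1$ and all $u\in\mathcal A_\rho$, $$\big|E_n^{LG}[u]\big|\le \frac{C_n M\pi\sqrt{1+\rho^{-2}}}{\rho^{2n}}\Big(1+\frac{1}{2(\rho^2-1)}\Big).$$ -/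

import Mathlib

open Polynomial MeasureTheory Filter Asymptotics

noncomputable section

namespace GaussQuad

/-- The Jacobi weight `ω^{α,β}(x) = (1 - x)^α (1 + x)^β` on `(-1, 1)`. -/
def jacobiWeight (α β x : ℝ) : ℝ := (1 - x) ^ α * (1 + x) ^ β

/-- The Jacobi polynomial of degree `n` in Szegő's normalization (value `binom(n + α, n)` at `1`),
`J_n^{α,β}(x) = ∑_{s=0}^{n} binom(n+α, n-s) binom(n+β, s) ((x-1)/2)^s ((x+1)/2)^(n-s)`,
with generalized binomial coefficients. This is the Leibniz expansion of the Rodrigues formula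
`(1-x)^α (1+x)^β J_n^{α,β}(x) = (-1)^n / (2^n n!) (d/dx)^n [(1-x)^(α+n) (1+x)^(β+n)]`. -/
def jacobiPoly (n : ℕ) (α β : ℝ) : ℝ[X] :=
  ∑ s ∈ Finset.range (n + 1),
    C (Ring.choose ((n : ℝ) + α) (n - s) * Ring.choose ((n : ℝ) + β) s) *
      (C (1 / 2) * (X - 1)) ^ s * (C (1 / 2) * (X + 1)) ^ (n - s)

/-- The nodes of the `n`-point Jacobi-Gauss quadrature: the zeros of `J_n^{α,β}`. -/
def gaussNodes (n : ℕ) (α β : ℝ) : Finset ℝ := (jacobiPoly n α β).roots.toFinset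

/-- The (interpolatory) quadrature weight of the node `x`: the integral against the Jacobi weight
of the Lagrange basis polynomial of the node `x`. -/
def gaussWeight (n : ℕ) (α β x : ℝ) : ℝ :=
  ∫ t in (-1 : ℝ)..1, (Lagrange.basis (gaussNodes n α β) id x).eval t * jacobiWeight α β t

/-- The remainder of the `n`-point Jacobi-Gauss quadrature,
`E_n[u] = ∫_{-1}^1 u(x) ω^{α,β}(x) dx - ∑_j u(x_j) ω_j`. -/
def gaussRemainder (n : ℕ) (α β : ℝ) (u : ℂ → ℂ) : ℂ :=
  (∫ x in (-1 : ℝ)..1, u (x : ℂ) * (jacobiWeight α β x : ℂ)) -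
    ∑ x ∈ gaussNodes n α β, u (x : ℂ) * (gaussWeight n α β x : ℂ)

/-- The remainder `E_n^{GG}[u]` of the Gegenbauer-Gauss quadrature. -/
def gegenbauerGaussRemainder (n : ℕ) (α : ℝ) (u : ℂ → ℂ) : ℂ := gaussRemainder n α α u

/-- The remainder `E_n^{LG}[u]` of the Legendre-Gauss quadrature. -/
def legendreGaussRemainder (n : ℕ) (u : ℂ → ℂ) : ℂ := gaussRemainder n 0 0 u

/-- The Bernstein ellipse `ℰ_ρ` (a curve): the image of the circle `|w| = ρ` under
`w ↦ (w + w⁻¹) / 2`. -/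
def bernsteinEllipse (ρ : ℝ) : Set ℂ :=
  {z | ∃ θ ∈ Set.Icc (0 : ℝ) (2 * Real.pi),
    z = ((ρ : ℂ) * Complex.exp (θ * Complex.I) +
      ((ρ : ℂ) * Complex.exp (θ * Complex.I))⁻¹) / 2}

/-- The points on and within `ℰ_ρ`, the ellipse with centre `0` and semi-axes
`(ρ + ρ⁻¹) / 2` and `(ρ - ρ⁻¹) / 2`. -/
def bernsteinRegion (ρ : ℝ) : Set ℂ :=
  {z | (z.re / ((ρ + ρ⁻¹) / 2)) ^ 2 + (z.im / ((ρ - ρ⁻¹) / 2)) ^ 2 ≤ 1}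

/-- The class `𝒜_ρ` of functions analytic on and within `ℰ_ρ`. -/
def AnalyticOnEllipse (ρ : ℝ) (u : ℂ → ℂ) : Prop := AnalyticOnNhd ℂ u (bernsteinRegion ρ)

/-- `M = max_{z ∈ ℰ_ρ} |u(z)|`; the maximum is attained, see `isGreatest_maxOnEllipse`. -/
def maxOnEllipse (ρ : ℝ) (u : ℂ → ℂ) : ℝ := sSup ((fun z => ‖u z‖) '' bernsteinEllipse ρ)

theorem bernsteinEllipse_subset {ρ : ℝ} (hρ : 1 < ρ) :
    bernsteinEllipse ρ ⊆ bernsteinRegion ρ := by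
  rintro z ⟨θ, -, rfl⟩
  have h0 : 0 < ρ := by linarith
  have hinv : ρ⁻¹ < 1 := inv_lt_one_of_one_lt₀ hρ
  have e : ((ρ : ℂ) * Complex.exp (θ * Complex.I) +
      ((ρ : ℂ) * Complex.exp (θ * Complex.I))⁻¹) / 2 =
      (((ρ + ρ⁻¹) / 2 * Real.cos θ : ℝ) : ℂ) +
        (((ρ - ρ⁻¹) / 2 * Real.sin θ : ℝ) : ℂ) * Complex.I := by
    rw [mul_inv, ← Complex.exp_neg, ← neg_mul, ← Complex.ofReal_neg, Complex.exp_mul_I,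
      Complex.exp_mul_I]
    push_cast
    simp only [Complex.cos_neg, Complex.sin_neg]
    ring
  rw [e]
  have h1 : (ρ + ρ⁻¹) / 2 ≠ 0 := by positivity
  have h2 : (ρ - ρ⁻¹) / 2 ≠ 0 := by
    have : 0 < (ρ - ρ⁻¹) / 2 := by linarith
    exact this.ne'
  simp only [bernsteinRegion, Set.mem_setOf_eq, Complex.add_re, Complex.add_im,
    Complex.re_ofReal_mul, Complex.im_ofReal_mul, Complex.ofReal_re, Complex.ofReal_im,
    Complex.I_re, Complex.I_im, mul_zero, mul_one, add_zero, zero_add]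
  rw [mul_div_cancel_left₀ _ h1, mul_div_cancel_left₀ _ h2, Real.cos_sq_add_sin_sq]

theorem isGreatest_maxOnEllipse {ρ : ℝ} (hρ : 1 < ρ) {u : ℂ → ℂ} (hu : AnalyticOnEllipse ρ u) :
    IsGreatest ((fun z => ‖u z‖) '' bernsteinEllipse ρ) (maxOnEllipse ρ u) := by
  have h0 : (ρ : ℂ) ≠ 0 := by exact_mod_cast (by linarith : (0 : ℝ) < ρ).ne'
  have he : bernsteinEllipse ρ = (fun θ : ℝ => ((ρ : ℂ) * Complex.exp (θ * Complex.I) +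
      ((ρ : ℂ) * Complex.exp (θ * Complex.I))⁻¹) / 2) '' Set.Icc (0 : ℝ) (2 * Real.pi) := by
    ext z
    simp only [bernsteinEllipse, Set.mem_setOf_eq, Set.mem_image, eq_comm]
  have hc : IsCompact (bernsteinEllipse ρ) := by
    rw [he]
    refine isCompact_Icc.image ?_
    refine Continuous.div_const (Continuous.add (by fun_prop) (Continuous.inv₀ (by fun_prop) ?_)) _
    exact fun θ => mul_ne_zero h0 (Complex.exp_ne_zero _)
  have hk : IsCompact ((fun z => ‖u z‖) '' bernsteinEllipse ρ) :=
    hc.image_of_continuousOn ((hu.continuousOn.mono (bernsteinEllipse_subset hρ)).norm)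
  refine hk.isGreatest_sSup (Set.Nonempty.image _ ?_)
  rw [he]
  exact (Set.nonempty_Icc.2 (by positivity)).image _

end GaussQuad

end

/-! ### Gegenbauer polynomials: Chebyshev expansion, recurrence, differential equation -/

noncomputable section

namespace GaussQuad

/-! Put `λ = α + 1/2`, let `p_n` be the Gegenbauer polynomial and `E_n` the quadrature remainder. A
function analytic in the ellipse has a Chebyshev expansion, so everything rests on the numbers
`E_n[T_m]`. They vanish for `|m| < 2n` because Gauss quadrature is exact there, and for `m - 2n` odd
and positive.

The others come from a division of power series. Since `p_n` vanishes at the nodes, `E_n[p_n T_m]`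
is the moment `∫ p_n T_m ω`. Expanding `p_n T_{n+2l}` in Chebyshev polynomials and applying `E_n`
gives `G(y) ε(y) = t(y)`, where `ε(y) = ∑ E_n[T_{2n+2l}] y^l`, `G` has the Chebyshev coefficients of
`p_n`, and `t` has the moments `∫ p_n T_{n+2l} ω` (`tsum_gegenCoeff_mul_tsum_polyRem`). The moments
satisfy a two-term recurrence, a consequence of the differential equation (`chebMoment_recurrence`).
After normalization, `G(y)` tends to `(1 - y)^(-λ)` and `t(y)` to `∑ (-λ)_l / l! y^l`, with error
`O(1/n)` uniformly on `|y| ≤ r₀ < 1`; the common scale `E_n[T_{2n}]` is an explicit quotient of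
Gamma values, at most `π / 2^(2λ) (1 + O(1/n))`. Bounding `|1 - y|^λ` by `(1 ± |y|)^λ` and the
coefficients of the second series by a constant `A` yields `exists_norm_tsum_polyRem_le`.

Let `M` be the maximum of `|u|` on the ellipse. Integrating `u` over the ellipse against `ε(ρ⁻²
e^(-2iθ))` gives `|E_n[u]| ≤ 2 M ρ^(-2n) sup |ε|` (`norm_gaussRemainder_le_of_forall`), which
settles large `n` and `ρ` away from `1`. For `ρ` near `1`, and for the finitely many small `n`,
Bessel's inequality gives a bound growing only like `(1 - ρ⁻²)^(-1/2)`, which is weaker growth than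
the claimed `(ρ² - 1)⁻¹` (`exists_norm_gaussRemainder_le`). The two parts of the theorem differ only
in the choice of `A`. -/

/-- The coefficients `(lam)_k / k!` of the power series of `(1 - y) ^ (-lam)`. -/
def rising (lam : ℝ) (k : ℕ) : ℝ := (ascPochhammer ℝ k).eval lam / k.factorial

@[simp] theorem rising_zero (lam : ℝ) : rising lam 0 = 1 := by simp [rising]

theorem succ_mul_rising_succ (lam : ℝ) (k : ℕ) :
    ((k : ℝ) + 1) * rising lam (k + 1) = (lam + k) * rising lam k := by
  have h : (k.factorial : ℝ) ≠ 0 := by positivity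
  rw [rising, rising, ascPochhammer_succ_eval, Nat.factorial_succ]
  push_cast
  field_simp

theorem rising_succ (lam : ℝ) (k : ℕ) :
    rising lam (k + 1) = (lam + k) / (k + 1) * rising lam k := by
  have := succ_mul_rising_succ lam k
  field_simp
  linarith

/-- The Gegenbauer polynomial in its Chebyshev expansion. -/
def gegenPoly (lam : ℝ) (n : ℕ) : ℝ[X] :=
  ∑ p ∈ Finset.HasAntidiagonal.antidiagonal n,
    C (rising lam p.1 * rising lam p.2) * Chebyshev.T ℝ ((p.2 : ℤ) - p.1)

/-- The Gegenbauer differential operator. -/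
def gegenOp (lam : ℝ) (f : ℝ[X]) : ℝ[X] :=
  (1 - X ^ 2) * derivative (derivative f) - C (2 * lam + 1) * X * derivative f

theorem gegenOp_add (lam : ℝ) (f h : ℝ[X]) :
    gegenOp lam (f + h) = gegenOp lam f + gegenOp lam h := by
  simp only [gegenOp, derivative_add]; ring

theorem gegenOp_C_mul (lam c : ℝ) (f : ℝ[X]) :
    gegenOp lam (C c * f) = C c * gegenOp lam f := by
  simp only [gegenOp, derivative_C_mul]; ring

theorem gegenOp_sum {ι : Type*} (lam : ℝ) (s : Finset ι) (f : ι → ℝ[X]) :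
    gegenOp lam (∑ i ∈ s, f i) = ∑ i ∈ s, gegenOp lam (f i) := by
  simp only [gegenOp, derivative_sum, Finset.mul_sum, Finset.sum_sub_distrib]

/-- The polynomial `x U_{m-1}(x)`, that is `cot θ sin mθ` at `x = cos θ`. -/
def chebV (m : ℤ) : ℝ[X] := X * Chebyshev.U ℝ (m - 1)

/-- This is `U_m - U_{m-2} = 2 T_m` multiplied by `x`. It lets the functions `chebV` be eliminated
in favour of the `T_m`. -/
theorem chebV_add_one_sub (m : ℤ) :
    chebV (m + 1) - chebV (m - 1) = Chebyshev.T ℝ (m + 1) + Chebyshev.T ℝ (m - 1) := by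
  have h1 := Chebyshev.two_mul_T_eq_U_sub_U ℝ (m - 2)
  have h2 := Chebyshev.T_add_one ℝ m
  rw [show m - 2 + 2 = m by ring] at h1
  rw [chebV, chebV, show m + 1 - 1 = m by ring, show m - 1 - 1 = m - 2 by ring, h2, ← mul_sub,
    ← h1]
  ring

/-- At `x = cos θ` the operator is `d²/dθ² + 2 lam cot θ d/dθ`, here applied to `cos mθ`. -/
theorem gegenOp_T (lam : ℝ) (m : ℤ) :
    gegenOp lam (Chebyshev.T ℝ m) =
      -(m : ℝ[X]) ^ 2 * Chebyshev.T ℝ m - C (2 * lam) * m * chebV m := by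
  have h := Chebyshev.one_sub_X_sq_mul_derivative_derivative_T_eq_poly_in_T (R := ℝ) m
  simp only [Function.iterate_succ, Function.iterate_zero, Function.comp, id] at h
  rw [gegenOp, h, Chebyshev.T_derivative_eq_U, chebV]
  simp only [map_add, map_one, map_mul]
  ring

/-- The factor `p.2` kills the boundary term, and `(k + 1) c_{k+1} = (lam + k) c_k` then shifts the
second index. All the identities for `gegenPoly` are obtained by this shift and its mirror image. -/
theorem sum_antidiagonal_snd_mul_rising {M : Type*} [AddCommGroup M] [Module ℝ M] (lam : ℝ)
    (n : ℕ) (F : ℕ → ℕ → M) :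
    ∑ p ∈ Finset.HasAntidiagonal.antidiagonal (n + 1),
        (rising lam p.1 * (p.2 * rising lam p.2)) • F p.1 p.2 =
      ∑ p ∈ Finset.HasAntidiagonal.antidiagonal n,
        (rising lam p.1 * ((lam + p.2) * rising lam p.2)) • F p.1 (p.2 + 1) := by
  rw [Finset.Nat.sum_antidiagonal_succ']
  simp only [Nat.cast_zero, zero_mul, mul_zero, zero_smul, zero_add, Nat.cast_add,
    Nat.cast_one, succ_mul_rising_succ]

theorem sum_antidiagonal_fst_mul_rising {M : Type*} [AddCommGroup M] [Module ℝ M] (lam : ℝ)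
    (n : ℕ) (F : ℕ → ℕ → M) :
    ∑ p ∈ Finset.HasAntidiagonal.antidiagonal (n + 1),
        (p.1 * rising lam p.1 * rising lam p.2) • F p.1 p.2 =
      ∑ p ∈ Finset.HasAntidiagonal.antidiagonal n,
        ((lam + p.1) * rising lam p.1 * rising lam p.2) • F (p.1 + 1) p.2 := by
  rw [Finset.Nat.sum_antidiagonal_succ]
  simp only [Nat.cast_zero, zero_mul, zero_smul, zero_add, Nat.cast_add,
    Nat.cast_one, succ_mul_rising_succ]

theorem gegenPoly_eq_smul (lam : ℝ) (n : ℕ) : gegenPoly lam n =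
    ∑ p ∈ Finset.HasAntidiagonal.antidiagonal n,
      (rising lam p.1 * rising lam p.2) • Chebyshev.T ℝ ((p.2 : ℤ) - p.1) := by
  simp only [gegenPoly, smul_eq_C_mul]

theorem gegenPoly_zero (lam : ℝ) : gegenPoly lam 0 = 1 := by
  simp [gegenPoly]

theorem gegenPoly_one (lam : ℝ) : gegenPoly lam 1 = C (2 * lam) * X := by
  have h1 : rising lam 1 = lam := by simpa using rising_succ lam 0
  have : Finset.HasAntidiagonal.antidiagonal 1 = {((0 : ℕ), (1 : ℕ)), (1, 0)} := rfl
  simp [gegenPoly, this, h1, map_ofNat C 2]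
  ring

/-- The three-term recurrence. -/
theorem gegenPoly_recurrence (lam : ℝ) (n : ℕ) :
    ((n : ℝ) + 2) • gegenPoly lam (n + 2) + (n + 2 * lam) • gegenPoly lam n =
      (n + 1 + lam) • ((2 * X) * gegenPoly lam (n + 1)) := by
  have hX : (2 * X) * gegenPoly lam (n + 1) = ∑ p ∈ Finset.HasAntidiagonal.antidiagonal (n + 1),
      (rising lam p.1 * rising lam p.2) • (Chebyshev.T ℝ ((p.2 : ℤ) - p.1 + 1) +
        Chebyshev.T ℝ ((p.2 : ℤ) - p.1 - 1)) := by
    rw [gegenPoly_eq_smul, Finset.mul_sum]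
    refine Finset.sum_congr rfl fun p _ => ?_
    rw [Chebyshev.T_add_one, mul_smul_comm]
    congr 1
    ring
  -- On the antidiagonal `n + 2 = p.1 + p.2`, and each half is shifted down in its own index.
  have h2 : ((n : ℝ) + 2) • gegenPoly lam (n + 2) =
      ∑ p ∈ Finset.HasAntidiagonal.antidiagonal (n + 1),
        (((lam + p.1) * rising lam p.1 * rising lam p.2) • Chebyshev.T ℝ ((p.2 : ℤ) - p.1 - 1) +
        (rising lam p.1 * ((lam + p.2) * rising lam p.2)) •
          Chebyshev.T ℝ ((p.2 : ℤ) - p.1 + 1)) := by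
    have e1 := sum_antidiagonal_fst_mul_rising lam (n + 1)
      (fun i j => Chebyshev.T ℝ ((j : ℤ) - i))
    have e2 := sum_antidiagonal_snd_mul_rising lam (n + 1)
      (fun i j => Chebyshev.T ℝ ((j : ℤ) - i))
    rw [gegenPoly_eq_smul, Finset.sum_add_distrib, Finset.smul_sum]
    have e3 : ∀ p : ℕ × ℕ, ((p.2 : ℤ) - p.1 - 1) = ((p.2 : ℤ) - ((p.1 + 1 : ℕ) : ℤ)) := by
      intro p; push_cast; ring
    have e4 : ∀ p : ℕ × ℕ, ((p.2 : ℤ) - p.1 + 1) = (((p.2 + 1 : ℕ) : ℤ) - p.1) := by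
      intro p; push_cast; ring
    simp only [e3, e4]
    rw [← e1, ← e2, ← Finset.sum_add_distrib]
    refine Finset.sum_congr rfl fun p hp => ?_
    rw [← add_smul, smul_smul]
    congr 1
    have : (p.1 : ℝ) + p.2 = n + 2 := by
      have := Finset.HasAntidiagonal.mem_antidiagonal.1 hp
      exact_mod_cast this
    rw [← this]; ring
  -- Here `n + 2 lam = (lam + p.1) + (lam + p.2)`, and the shifts run upwards.
  have h3 : ((n : ℝ) + 2 * lam) • gegenPoly lam n =
      ∑ p ∈ Finset.HasAntidiagonal.antidiagonal (n + 1),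
        ((p.1 * rising lam p.1 * rising lam p.2) • Chebyshev.T ℝ ((p.2 : ℤ) - p.1 + 1) +
        (rising lam p.1 * (p.2 * rising lam p.2)) •
          Chebyshev.T ℝ ((p.2 : ℤ) - p.1 - 1)) := by
    rw [Finset.sum_add_distrib,
      sum_antidiagonal_fst_mul_rising lam n (fun i j => Chebyshev.T ℝ ((j : ℤ) - i + 1)),
      sum_antidiagonal_snd_mul_rising lam n (fun i j => Chebyshev.T ℝ ((j : ℤ) - i - 1)),
      ← Finset.sum_add_distrib, gegenPoly_eq_smul, Finset.smul_sum]
    refine Finset.sum_congr rfl fun p hp => ?_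
    have e3 : ((p.2 : ℤ) - ((p.1 + 1 : ℕ) : ℤ) + 1) = ((p.2 : ℤ) - p.1) := by push_cast; ring
    have e4 : (((p.2 + 1 : ℕ) : ℤ) - p.1 - 1) = ((p.2 : ℤ) - p.1) := by push_cast; ring
    rw [e3, e4, ← add_smul, smul_smul]
    congr 1
    have : (p.1 : ℝ) + p.2 = n := by
      have := Finset.HasAntidiagonal.mem_antidiagonal.1 hp
      exact_mod_cast this
    rw [← this]; ring
  rw [h2, h3, hX, Finset.smul_sum, ← Finset.sum_add_distrib]
  refine Finset.sum_congr rfl fun p hp => ?_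
  have : (p.1 : ℝ) + p.2 = n + 1 := by
    have := Finset.HasAntidiagonal.mem_antidiagonal.1 hp
    exact_mod_cast this
  rw [← this]
  simp only [smul_eq_C_mul, map_mul, map_add]
  ring

/-- Apart from the `chebV` terms, the operator multiplies the `(i, j)` term by `-(j - i)²`. The
`chebV` terms contribute a further `-(2 lam (i + j) + 4 i j)`, which completes the square to `-n (n
+ 2 lam)`. -/
theorem gegenPoly_ode (lam : ℝ) (n : ℕ) :
    gegenOp lam (gegenPoly lam n) = C (-((n : ℝ) * (n + 2 * lam))) * gegenPoly lam n := by
  rcases n with _ | n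
  · simp [gegenPoly_zero, gegenOp]
  -- Write `2 lam (j - i) = 2 j (lam + i) - 2 i (lam + j)` and shift each part down: both acquire
  -- the same coefficient, so only differences `chebV (m + 1) - chebV (m - 1)` remain. These are
  -- sums of two Chebyshev polynomials, and the shifts are undone.
  have hV : ∑ p ∈ Finset.HasAntidiagonal.antidiagonal (n + 1), (rising lam p.1 * rising lam p.2) •
      ((2 * lam * ((p.2 : ℝ) - p.1)) • chebV ((p.2 : ℤ) - p.1)) =
      ∑ p ∈ Finset.HasAntidiagonal.antidiagonal (n + 1), (rising lam p.1 * rising lam p.2) •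
      ((2 * lam * ((p.2 : ℝ) + p.1) + 4 * p.1 * p.2) • Chebyshev.T ℝ ((p.2 : ℤ) - p.1)) := by
    have l1 : ∑ p ∈ Finset.HasAntidiagonal.antidiagonal (n + 1), (rising lam p.1 * rising lam p.2) •
      ((2 * lam * ((p.2 : ℝ) - p.1)) • chebV ((p.2 : ℤ) - p.1)) =
      ∑ p ∈ Finset.HasAntidiagonal.antidiagonal (n + 1), (rising lam p.1 * (p.2 * rising lam p.2)) •
        ((2 * (lam + p.1)) • chebV ((p.2 : ℤ) - p.1)) -
      ∑ p ∈ Finset.HasAntidiagonal.antidiagonal (n + 1), (p.1 * rising lam p.1 * rising lam p.2) •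
        ((2 * (lam + p.2)) • chebV ((p.2 : ℤ) - p.1)) := by
      rw [← Finset.sum_sub_distrib]
      refine Finset.sum_congr rfl fun p hp => ?_
      simp only [smul_smul, ← sub_smul]
      congr 1; ring
    have l2 : ∑ p ∈ Finset.HasAntidiagonal.antidiagonal (n + 1), (rising lam p.1 * rising lam p.2) •
      ((2 * lam * ((p.2 : ℝ) + p.1) + 4 * p.1 * p.2) • Chebyshev.T ℝ ((p.2 : ℤ) - p.1)) =
      ∑ p ∈ Finset.HasAntidiagonal.antidiagonal (n + 1), (rising lam p.1 * (p.2 * rising lam p.2)) •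
        ((2 * (lam + p.1)) • Chebyshev.T ℝ ((p.2 : ℤ) - p.1)) +
      ∑ p ∈ Finset.HasAntidiagonal.antidiagonal (n + 1), (p.1 * rising lam p.1 * rising lam p.2) •
        ((2 * (lam + p.2)) • Chebyshev.T ℝ ((p.2 : ℤ) - p.1)) := by
      rw [← Finset.sum_add_distrib]
      refine Finset.sum_congr rfl fun p hp => ?_
      simp only [smul_smul, ← add_smul]
      congr 1; ring
    rw [l1, l2,
      sum_antidiagonal_snd_mul_rising lam n
        (fun i j => (2 * (lam + i)) • chebV ((j : ℤ) - i)),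
      sum_antidiagonal_fst_mul_rising lam n
        (fun i j => (2 * (lam + j)) • chebV ((j : ℤ) - i)),
      sum_antidiagonal_snd_mul_rising lam n
        (fun i j => (2 * (lam + i)) • Chebyshev.T ℝ ((j : ℤ) - i)),
      sum_antidiagonal_fst_mul_rising lam n
        (fun i j => (2 * (lam + j)) • Chebyshev.T ℝ ((j : ℤ) - i)),
      ← Finset.sum_sub_distrib, ← Finset.sum_add_distrib]
    refine Finset.sum_congr rfl fun p hp => ?_
    have e3 : ((p.2 : ℤ) - ((p.1 + 1 : ℕ) : ℤ)) = ((p.2 : ℤ) - p.1) - 1 := by push_cast; ring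
    have e4 : (((p.2 + 1 : ℕ) : ℤ) - p.1) = ((p.2 : ℤ) - p.1) + 1 := by push_cast; ring
    have e5 := chebV_add_one_sub ((p.2 : ℤ) - p.1)
    rw [e3, e4, ← sub_eq_zero]
    simp only [smul_eq_C_mul, map_mul, map_add, map_ofNat]
    linear_combination (2 * C (rising lam p.1) * C (rising lam p.2) * (C lam + C (p.1 : ℝ)) *
      (C lam + C (p.2 : ℝ))) * e5
  rw [gegenPoly, gegenOp_sum, Finset.mul_sum, ← sub_eq_zero, ← Finset.sum_sub_distrib]
  rw [← sub_eq_zero, ← Finset.sum_sub_distrib] at hV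
  rw [← neg_eq_zero, ← Finset.sum_neg_distrib, ← hV]
  refine Finset.sum_congr rfl fun p hp => ?_
  have : C ((n + 1 : ℕ) : ℝ) = C (p.1 : ℝ) + C (p.2 : ℝ) := by
    have := Finset.HasAntidiagonal.mem_antidiagonal.1 hp
    rw [← map_add]; congr 1; exact_mod_cast this.symm
  have hz : (((p.2 : ℤ) - p.1 : ℤ) : ℝ[X]) = C (p.2 : ℝ) - C (p.1 : ℝ) := by
    simp
  rw [gegenOp_C_mul, gegenOp_T, hz]
  simp only [smul_eq_C_mul, map_mul, map_add, map_sub, map_neg, map_ofNat, this]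
  ring

/-! ### Jacobi polynomials with equal parameters are multiples of Gegenbauer polynomials -/

theorem add_one_mul_choose_add_one (a : ℝ) (k : ℕ) :
    ((k : ℝ) + 1) * Ring.choose a (k + 1) = (a - k) * Ring.choose a k := by
  have h : (k.factorial : ℝ) ≠ 0 := by positivity
  rw [Ring.choose_eq_smul, Ring.choose_eq_smul, Nat.factorial_succ]
  simp only [← Polynomial.aeval_eq_smeval, ← Polynomial.eval_map_algebraMap,
    descPochhammer_map]
  rw [descPochhammer_succ_eval, smul_eq_mul, smul_eq_mul]
  push_cast
  field_simp

/-- The form `∑_{i+j=n} binom(ν, i) binom(ν, j) ((x-1)/2)^i ((x+1)/2)^j`. -/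
def binomForm (nu : ℝ) (n : ℕ) : ℝ[X] :=
  ∑ p ∈ Finset.HasAntidiagonal.antidiagonal n, (Ring.choose nu p.1 * Ring.choose nu p.2) •
    ((C (1 / 2) * (X - 1)) ^ p.1 * (C (1 / 2) * (X + 1)) ^ p.2)

theorem jacobiPoly_eq_binomForm (n : ℕ) (α : ℝ) : jacobiPoly n α α = binomForm (n + α) n := by
  rw [binomForm, Finset.Nat.sum_antidiagonal_eq_sum_range_succ_mk, jacobiPoly]
  refine Finset.sum_congr rfl fun s _ => ?_
  rw [smul_eq_C_mul, mul_comm (Ring.choose _ (n - s)), mul_assoc]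

theorem sum_antidiagonal_choose_succ_fst {M : Type*} [AddCommGroup M] [Module ℝ M] (nu : ℝ)
    (n : ℕ) (F : ℕ → ℕ → M) :
    ∑ p ∈ Finset.HasAntidiagonal.antidiagonal (n + 1),
        (p.1 * Ring.choose nu p.1 * Ring.choose nu p.2) • F p.1 p.2 =
      ∑ p ∈ Finset.HasAntidiagonal.antidiagonal n,
        ((nu - p.1) * Ring.choose nu p.1 * Ring.choose nu p.2) • F (p.1 + 1) p.2 := by
  rw [Finset.Nat.sum_antidiagonal_succ]
  simp only [Nat.cast_zero, zero_mul, zero_smul, zero_add, Nat.cast_add, Nat.cast_one,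
    add_one_mul_choose_add_one]

theorem sum_antidiagonal_choose_succ_snd {M : Type*} [AddCommGroup M] [Module ℝ M] (nu : ℝ)
    (n : ℕ) (F : ℕ → ℕ → M) :
    ∑ p ∈ Finset.HasAntidiagonal.antidiagonal (n + 1),
        (Ring.choose nu p.1 * (p.2 * Ring.choose nu p.2)) • F p.1 p.2 =
      ∑ p ∈ Finset.HasAntidiagonal.antidiagonal n,
        (Ring.choose nu p.1 * ((nu - p.2) * Ring.choose nu p.2)) • F p.1 (p.2 + 1) := by
  rw [Finset.Nat.sum_antidiagonal_succ']
  simp only [Nat.cast_zero, zero_mul, mul_zero, zero_smul, zero_add, Nat.cast_add,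
    Nat.cast_one, add_one_mul_choose_add_one]

theorem two_mul_derivative_binomForm (nu : ℝ) (n : ℕ) :
    C 2 * derivative (binomForm nu n) = ∑ p ∈ Finset.HasAntidiagonal.antidiagonal n,
      ((p.1 * Ring.choose nu p.1 * Ring.choose nu p.2) •
        ((C (1 / 2) * (X - 1)) ^ (p.1 - 1) * (C (1 / 2) * (X + 1)) ^ p.2) +
      (Ring.choose nu p.1 * (p.2 * Ring.choose nu p.2)) •
        ((C (1 / 2) * (X - 1)) ^ p.1 * (C (1 / 2) * (X + 1)) ^ (p.2 - 1)) : ℝ[X]) := by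
  rw [binomForm, derivative_sum, Finset.mul_sum]
  refine Finset.sum_congr rfl fun p _ => ?_
  have h2 : (C 2 * C (1 / 2) : ℝ[X]) = 1 := by rw [← C_mul]; norm_num
  rw [derivative_smul, derivative_mul, derivative_pow, derivative_pow, derivative_C_mul,
    derivative_C_mul]
  simp only [derivative_sub, derivative_add, derivative_X, derivative_one, smul_eq_C_mul, map_mul]
  linear_combination (C (Ring.choose nu p.1) * C (Ring.choose nu p.2) *
    (C (p.1 : ℝ) * (C (1 / 2) * (X - 1)) ^ (p.1 - 1) * (C (1 / 2) * (X + 1)) ^ p.2 +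
     C (p.2 : ℝ) * (C (1 / 2) * (X - 1)) ^ p.1 * (C (1 / 2) * (X + 1)) ^ (p.2 - 1))) * h2

/-- Differentiating lowers one exponent, and the shifted binomials contribute `(nu - i) + (nu - j) =
2 nu - n`. Keeping `nu` independent of the degree is what makes this a relation between two forms of
the same family. -/
theorem derivative_binomForm_succ (nu : ℝ) (n : ℕ) :
    C 2 * derivative (binomForm nu (n + 1)) = (2 * nu - n) • binomForm nu n := by
  rw [two_mul_derivative_binomForm, Finset.sum_add_distrib,
    sum_antidiagonal_choose_succ_fst nu n
      (fun i j => ((C (1 / 2) * (X - 1)) ^ (i - 1) * (C (1 / 2) * (X + 1)) ^ j : ℝ[X])),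
    sum_antidiagonal_choose_succ_snd nu n
      (fun i j => ((C (1 / 2) * (X - 1)) ^ i * (C (1 / 2) * (X + 1)) ^ (j - 1) : ℝ[X])),
    ← Finset.sum_add_distrib, binomForm, Finset.smul_sum]
  refine Finset.sum_congr rfl fun p hp => ?_
  have : (p.1 : ℝ) + p.2 = n := by
    have := Finset.HasAntidiagonal.mem_antidiagonal.1 hp
    exact_mod_cast this
  rw [Nat.add_sub_cancel, Nat.add_sub_cancel, ← add_smul, smul_smul, ← this]
  congr 1
  ring

/-- With `a = (x-1)/2` and `b = (x+1)/2`, the coefficient `nu - i` equals `j + (α + 1)`. The `j`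
part rebuilds `a b` times the derivative, and the `α + 1` part carries the factor `a + b = x`. -/
theorem binomForm_succ (n : ℕ) (α : ℝ) :
    ((n : ℝ) + 1) • binomForm (n + 1 + α) (n + 1) =
      (C (1 / 2) * (X - 1)) * (C (1 / 2) * (X + 1)) *
        (C 2 * derivative (binomForm (n + 1 + α) n)) +
      (α + 1) • (X * binomForm (n + 1 + α) n) := by
  set nu : ℝ := n + 1 + α with hnu
  have hab : (X : ℝ[X]) = C (1 / 2) * (X - 1) + C (1 / 2) * (X + 1) := by
    have h2 : (C 2 * C (1 / 2) : ℝ[X]) = 1 := by rw [← C_mul]; norm_num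
    rw [map_ofNat C 2] at h2
    linear_combination -X * h2
  have h1 : ((n : ℝ) + 1) • binomForm nu (n + 1) =
      ∑ p ∈ Finset.HasAntidiagonal.antidiagonal n,
        (((nu - p.1) * Ring.choose nu p.1 * Ring.choose nu p.2) •
          ((C (1 / 2) * (X - 1)) ^ (p.1 + 1) * (C (1 / 2) * (X + 1)) ^ p.2 : ℝ[X]) +
        (Ring.choose nu p.1 * ((nu - p.2) * Ring.choose nu p.2)) •
          ((C (1 / 2) * (X - 1)) ^ p.1 * (C (1 / 2) * (X + 1)) ^ (p.2 + 1) : ℝ[X])) := by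
    rw [Finset.sum_add_distrib, ← sum_antidiagonal_choose_succ_fst nu n
      (fun i j => ((C (1 / 2) * (X - 1)) ^ i * (C (1 / 2) * (X + 1)) ^ j : ℝ[X])),
      ← sum_antidiagonal_choose_succ_snd nu n
      (fun i j => ((C (1 / 2) * (X - 1)) ^ i * (C (1 / 2) * (X + 1)) ^ j : ℝ[X])),
      ← Finset.sum_add_distrib, binomForm, Finset.smul_sum]
    refine Finset.sum_congr rfl fun p hp => ?_
    have : (p.1 : ℝ) + p.2 = n + 1 := by
      have := Finset.HasAntidiagonal.mem_antidiagonal.1 hp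
      exact_mod_cast this
    rw [smul_smul, ← add_smul, ← this]
    congr 1
    ring
  rw [h1, two_mul_derivative_binomForm, binomForm, Finset.mul_sum, Finset.mul_sum,
    Finset.smul_sum, ← Finset.sum_add_distrib]
  refine Finset.sum_congr rfl fun p hp => ?_
  have hp' : C ((p.1 : ℝ)) + C (p.2 : ℝ) = C (n : ℝ) := by
    have := Finset.HasAntidiagonal.mem_antidiagonal.1 hp
    rw [← C_add]; congr 1
    exact_mod_cast this
  have hC : (C nu : ℝ[X]) = C (p.1 : ℝ) + C (p.2 : ℝ) + 1 + C α := by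
    rw [hp', hnu]; simp
  have e1 : ∀ (y : ℝ[X]) (k : ℕ), C (k : ℝ) * (y * y ^ (k - 1)) = C (k : ℝ) * y ^ k := by
    intro y k
    rcases k with _ | k
    · simp
    · rw [Nat.add_sub_cancel, pow_succ']
  have e2 := e1 (C (1 / 2) * (X - 1)) p.1
  have e3 := e1 (C (1 / 2) * (X + 1)) p.2
  rw [show ((α + 1) • (X * ((Ring.choose nu p.1 * Ring.choose nu p.2) •
      ((C (1 / 2) * (X - 1)) ^ p.1 * (C (1 / 2) * (X + 1)) ^ p.2))) : ℝ[X]) =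
    (α + 1) • ((C (1 / 2) * (X - 1) + C (1 / 2) * (X + 1)) *
      ((Ring.choose nu p.1 * Ring.choose nu p.2) •
      ((C (1 / 2) * (X - 1)) ^ p.1 * (C (1 / 2) * (X + 1)) ^ p.2))) by rw [← hab]]
  generalize (C (1 / 2) * (X - 1) : ℝ[X]) = a at *
  generalize (C (1 / 2) * (X + 1) : ℝ[X]) = b at *
  simp only [smul_eq_C_mul, map_mul, map_sub, map_add, map_one, hC]
  generalize C (Ring.choose nu p.1) = c1
  generalize C (Ring.choose nu p.2) = c2
  linear_combination -c1 * c2 * b * b ^ p.2 * e2 - c1 * c2 * a * a ^ p.1 * e3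

/-- The derivative of `J` is a multiple of an auxiliary form `F₀`, and `J` is a first-order
expression in `F₀`; eliminating `F₀` gives the equation. -/
theorem jacobiPoly_ode (n : ℕ) (α : ℝ) :
    gegenOp (α + 1 / 2) (jacobiPoly n α α) =
      C (-((n : ℝ) * (n + 2 * (α + 1 / 2)))) * jacobiPoly n α α := by
  rw [jacobiPoly_eq_binomForm]
  rcases n with _ | n
  · simp [binomForm, gegenOp]
  have h1 := derivative_binomForm_succ (n + 1 + α) n
  have h2 := binomForm_succ n α
  have h3 := congrArg derivative h1
  rw [derivative_C_mul, derivative_smul] at h3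
  push_cast
  have hh : (C 2 * C (1 / 2) : ℝ[X]) = 1 := by rw [← C_mul]; norm_num
  have hC : (C (2 * (α + 1 / 2) + 1) : ℝ[X]) = 2 * (C α + 1) := by
    rw [← map_ofNat C 2, ← C_1, ← C_add, ← C_mul]; congr 1; ring
  have hC' : (C (-(((n : ℝ) + 1) * (n + 1 + 2 * (α + 1 / 2)))) : ℝ[X]) =
      -((C (n : ℝ) + 1) * (C (n : ℝ) + 2 * C α + 2)) := by
    rw [← map_ofNat C 2, ← C_1, ← C_mul, ← C_add, ← C_add, ← C_add, ← C_mul, ← C_neg]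
    congr 1; ring
  have hC'' : (C (2 * (n + 1 + α) - n) : ℝ[X]) = C (n : ℝ) + 2 * C α + 2 := by
    rw [← map_ofNat C 2, ← C_mul, ← C_add, ← C_add]; congr 1; ring
  have hn : (C ((n : ℝ) + 1) : ℝ[X]) = C (n : ℝ) + 1 := by simp
  have ha : (C (α + 1) : ℝ[X]) = C α + 1 := by simp
  rw [gegenOp, hC, hC']
  simp only [smul_eq_C_mul, hC'', hn, ha] at h1 h2 h3
  rw [map_ofNat C 2] at *
  generalize derivative (derivative (binomForm (n + 1 + α) (n + 1))) = D2 at *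
  generalize derivative (binomForm (n + 1 + α) (n + 1)) = D1 at *
  generalize derivative (binomForm (n + 1 + α) n) = E1 at *
  generalize binomForm (n + 1 + α) (n + 1) = F1 at *
  generalize binomForm (n + 1 + α) n = F0 at *
  generalize (C (1 / 2) : ℝ[X]) = h at *
  generalize (C α : ℝ[X]) = a at *
  generalize (C (n : ℝ) : ℝ[X]) = m at *
  have h3' : D2 = h * ((m + 2 * a + 2) * E1) := by linear_combination h * h3 - D2 * hh
  have h1' : D1 = h * ((m + 2 * a + 2) * F0) := by linear_combination h * h1 - D1 * hh
  rw [h3', h1']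
  have e4 : (m + 1) * F1 = h * (X ^ 2 - 1) * E1 * (2 * h) + (a + 1) * (X * F0) := by
    linear_combination h2
  rw [hh, mul_one] at e4
  linear_combination (m + 2 * a + 2) * e4 - (a + 1) * X * (m + 2 * a + 2) * F0 * hh

theorem coeff_gegenOp (lam : ℝ) (f : ℝ[X]) (k : ℕ) :
    (gegenOp lam f).coeff k =
      ((k : ℝ) + 2) * (k + 1) * f.coeff (k + 2) - k * (k + 2 * lam) * f.coeff k := by
  rw [gegenOp, coeff_sub, sub_mul, coeff_sub, one_mul, mul_assoc, coeff_C_mul]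
  rcases k with _ | _ | k
  · simp [coeff_derivative]; ring
  · simp [coeff_derivative, coeff_X_pow_mul', coeff_X_mul]; ring
  · simp [coeff_derivative, coeff_X_pow_mul', coeff_X_mul]; ring

/-- The operator is triangular on monomials with diagonal entry `-d (d + 2 lam)`. -/
theorem degree_gegenOp_add_lt (lam : ℝ) {f : ℝ[X]} {d : ℕ} (hf : f.natDegree ≤ d) :
    (gegenOp lam f + C ((d : ℝ) * (d + 2 * lam)) * f).degree < d := by
  rw [degree_lt_iff_coeff_zero]
  intro m hm
  have h2 : f.coeff (m + 2) = 0 := coeff_eq_zero_of_natDegree_lt (by omega)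
  rw [coeff_add, coeff_gegenOp, coeff_C_mul, h2]
  rcases hm.eq_or_lt with rfl | h
  · ring
  · rw [coeff_eq_zero_of_natDegree_lt (by omega : f.natDegree < m)]; ring

/-- The leading coefficient forces `(n - d) (n + d + 2 lam) = 0` for the degree `d`, and the second
factor is positive when `n ≠ d`. -/
theorem natDegree_of_gegenOp_eq {lam : ℝ} (hl : -1 / 2 < lam) {f : ℝ[X]} (hf : f ≠ 0) {n : ℕ}
    (h : gegenOp lam f = C (-((n : ℝ) * (n + 2 * lam))) * f) : f.natDegree = n := by
  have h1 := congrArg (fun g => g.coeff f.natDegree) h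
  simp only [coeff_gegenOp, coeff_C_mul] at h1
  rw [coeff_eq_zero_of_natDegree_lt (by omega : f.natDegree < f.natDegree + 2)] at h1
  have hlc : f.coeff f.natDegree ≠ 0 := by simpa using hf
  by_contra hne
  have h2 : ((n : ℝ) - f.natDegree) * (n + f.natDegree + 2 * lam) = 0 := by
    apply mul_right_cancel₀ hlc
    linarith
  rcases mul_eq_zero.1 h2 with h3 | h3
  · exact hne (by exact_mod_cast (sub_eq_zero.1 h3).symm)
  · have : (1 : ℝ) ≤ n + f.natDegree := by
      have : 1 ≤ n + f.natDegree := by omega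
      exact_mod_cast this
    linarith

theorem natDegree_gegenPoly_le (lam : ℝ) (n : ℕ) : (gegenPoly lam n).natDegree ≤ n := by
  refine natDegree_sum_le_of_forall_le _ _ fun p hp => ?_
  refine (natDegree_C_mul_le _ _).trans ?_
  rw [Chebyshev.natDegree_T]
  have := Finset.HasAntidiagonal.mem_antidiagonal.1 hp
  omega

/-- The recurrence multiplies the leading coefficient by a nonzero factor, starting from `2 lam` in
degree one. At `lam = 0`, that is `α = -1/2`, this normalization degenerates to the zero polynomial
in positive degree. -/
theorem coeff_gegenPoly_ne_zero {lam : ℝ} (hl : -1 / 2 < lam) (h0 : lam ≠ 0) (n : ℕ) :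
    (gegenPoly lam n).coeff n ≠ 0 := by
  induction n using Nat.twoStepInduction with
  | zero => simp [gegenPoly_zero]
  | one => simpa [gegenPoly_one] using h0
  | more n _ ih =>
    have h1 := congrArg (fun g => g.coeff (n + 2)) (gegenPoly_recurrence lam n)
    simp only [coeff_add, coeff_smul, smul_eq_mul] at h1
    rw [coeff_eq_zero_of_natDegree_lt (p := gegenPoly lam n)
      (by have := natDegree_gegenPoly_le lam n; omega), mul_assoc, ← map_ofNat C 2, coeff_C_mul,
      coeff_X_mul] at h1
    intro h2
    rw [h2] at h1
    have : (0 : ℝ) ≤ n := by positivity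
    have h3 : ((n : ℝ) + 1 + lam) * (2 * (gegenPoly lam (n + 1)).coeff (n + 1)) ≠ 0 :=
      mul_ne_zero (by linarith) (mul_ne_zero two_ne_zero ih)
    exact h3 (by rw [← h1]; ring)

/-- At `x = 1` only the term `s = 0` survives, and `binom(n + α, n)` is positive. -/
theorem jacobiPoly_ne_zero {α : ℝ} (hα : -1 < α) (n : ℕ) : jacobiPoly n α α ≠ 0 := by
  intro h
  have h1 := congrArg (fun g => g.eval 1) h
  simp only [jacobiPoly, eval_finsetSum, eval_zero] at h1
  rw [Finset.sum_eq_single 0] at h1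
  · simp only [eval_mul, eval_C, Ring.choose_zero_right, pow_zero, mul_one, eval_pow, eval_add,
      eval_X, eval_one, Nat.sub_zero] at h1
    norm_num at h1
    rw [Ring.choose_eq_smul] at h1
    simp only [← Polynomial.aeval_eq_smeval, ← Polynomial.eval_map_algebraMap,
      descPochhammer_map, descPochhammer_eval_eq_prod_range] at h1
    have h2 : 0 < ∏ j ∈ Finset.range n, ((n : ℝ) + α - j) := by
      refine Finset.prod_pos fun j hj => ?_
      have : (j : ℝ) + 1 ≤ n := by exact_mod_cast Finset.mem_range.1 hj
      linarith
    have h3 : (n.factorial : ℝ) ≠ 0 := by positivity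
    simp [h2.ne', h3] at h1
  · intro s _ hs
    simp [hs]
  · simp

/-- Both polynomials solve the same equation, whose nonzero solutions all have degree `n`. The
combination cancelling the coefficient of `x^n` must therefore be zero. -/
theorem exists_jacobiPoly_eq {lam : ℝ} (hl : -1 / 2 < lam) (h0 : lam ≠ 0) (n : ℕ) :
    ∃ c : ℝ, c ≠ 0 ∧ jacobiPoly n (lam - 1 / 2) (lam - 1 / 2) = C c * gegenPoly lam n := by
  have hJ := jacobiPoly_ne_zero (by linarith : -1 < lam - 1 / 2) n
  have ho := jacobiPoly_ode n (lam - 1 / 2)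
  rw [sub_add_cancel] at ho
  set J := jacobiPoly n (lam - 1 / 2) (lam - 1 / 2)
  have hc := coeff_gegenPoly_ne_zero hl h0 n
  set c := J.coeff n / (gegenPoly lam n).coeff n
  have hz : J + C (-c) * gegenPoly lam n = 0 := by
    by_contra hne
    have hd : (J + C (-c) * gegenPoly lam n).natDegree = n := by
      refine natDegree_of_gegenOp_eq hl hne ?_
      rw [gegenOp_add, gegenOp_C_mul, ho, gegenPoly_ode]
      ring
    apply hne
    rw [← leadingCoeff_eq_zero, leadingCoeff, hd, coeff_add, coeff_C_mul]
    simp only [c]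
    field_simp
    ring
  have hE : J = C c * gegenPoly lam n := by
    rw [C_neg] at hz
    linear_combination hz
  refine ⟨c, ?_, hE⟩
  rintro hc0
  rw [hc0, C_0, zero_mul] at hE
  exact hJ hE

/-! ### The weighted integral and orthogonality -/

/-- The Gegenbauer weight with parameter `lam = α + 1/2`. -/
def gegenWeight (lam x : ℝ) : ℝ := jacobiWeight (lam - 1 / 2) (lam - 1 / 2) x

theorem intervalIntegrable_gegenWeight {lam : ℝ} (hl : -1 / 2 < lam) :
    IntervalIntegrable (gegenWeight lam) volume (-1) 1 := by
  have ha : -1 < lam - 1 / 2 := by linarith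
  have h0 : IntervalIntegrable (fun x : ℝ => x ^ (lam - 1 / 2)) volume 0 1 :=
    intervalIntegral.intervalIntegrable_rpow' ha
  have h1 : IntervalIntegrable (gegenWeight lam) volume (-1) 0 := by
    have h2 : IntervalIntegrable (fun x : ℝ => (1 + x) ^ (lam - 1 / 2)) volume (-1) 0 := by
      simpa using h0.comp_add_left 1
    refine h2.continuousOn_mul (g := fun x : ℝ => (1 - x) ^ (lam - 1 / 2)) ?_
    refine ContinuousOn.rpow_const (by fun_prop) fun x hx => Or.inl ?_
    rw [Set.uIcc_of_le (by norm_num)] at hx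
    have := hx.2
    linarith
  have h3 : IntervalIntegrable (gegenWeight lam) volume 0 1 := by
    have h2 : IntervalIntegrable (fun x : ℝ => (1 - x) ^ (lam - 1 / 2)) volume 0 1 := by
      simpa using (h0.comp_sub_left 1).symm
    refine h2.mul_continuousOn (g := fun x : ℝ => (1 + x) ^ (lam - 1 / 2)) ?_
    refine ContinuousOn.rpow_const (by fun_prop) fun x hx => Or.inl ?_
    rw [Set.uIcc_of_le (by norm_num)] at hx
    have := hx.1
    linarith
  exact h1.trans h3

theorem gegenWeight_nonneg (lam : ℝ) {x : ℝ} (hx : x ∈ Set.Icc (-1 : ℝ) 1) :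
    0 ≤ gegenWeight lam x := by
  have h1 := hx.1
  have h2 := hx.2
  exact mul_nonneg (Real.rpow_nonneg (by linarith) _) (Real.rpow_nonneg (by linarith) _)

theorem gegenWeight_pos (lam : ℝ) {x : ℝ} (hx : x ∈ Set.Ioo (-1 : ℝ) 1) :
    0 < gegenWeight lam x := by
  have h1 := hx.1
  have h2 := hx.2
  exact mul_pos (Real.rpow_pos_of_pos (by linarith) _) (Real.rpow_pos_of_pos (by linarith) _)

/-- The integral of a polynomial against the Gegenbauer weight. -/
def wInt (lam : ℝ) (f : ℝ[X]) : ℝ := ∫ x in (-1 : ℝ)..1, f.eval x * gegenWeight lam x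

theorem intervalIntegrable_eval_mul_gegenWeight {lam : ℝ} (hl : -1 / 2 < lam) (f : ℝ[X]) :
    IntervalIntegrable (fun x => f.eval x * gegenWeight lam x) volume (-1) 1 :=
  (intervalIntegrable_gegenWeight hl).continuousOn_mul f.continuous.continuousOn

theorem wInt_add {lam : ℝ} (hl : -1 / 2 < lam) (f h : ℝ[X]) :
    wInt lam (f + h) = wInt lam f + wInt lam h := by
  rw [wInt, wInt, wInt, ← intervalIntegral.integral_add
    (intervalIntegrable_eval_mul_gegenWeight hl f) (intervalIntegrable_eval_mul_gegenWeight hl h)]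
  simp only [eval_add, add_mul]

theorem wInt_C_mul (lam c : ℝ) (f : ℝ[X]) : wInt lam (C c * f) = c * wInt lam f := by
  rw [wInt, wInt, ← intervalIntegral.integral_const_mul]
  simp only [eval_mul, eval_C, mul_assoc]

theorem wInt_zero (lam : ℝ) : wInt lam 0 = 0 := by simp [wInt]

theorem wInt_sub {lam : ℝ} (hl : -1 / 2 < lam) (f h : ℝ[X]) :
    wInt lam (f - h) = wInt lam f - wInt lam h := by
  have : f - h = f + C (-1) * h := by simp [sub_eq_add_neg]
  rw [this, wInt_add hl, wInt_C_mul]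
  ring

theorem wInt_sum {lam : ℝ} (hl : -1 / 2 < lam) {ι : Type*} (s : Finset ι) (f : ι → ℝ[X]) :
    wInt lam (∑ i ∈ s, f i) = ∑ i ∈ s, wInt lam (f i) := by
  induction s using Finset.cons_induction with
  | empty => simp [wInt_zero]
  | cons a s ha ih => rw [Finset.sum_cons, Finset.sum_cons, wInt_add hl, ih]

theorem wInt_nonneg (lam : ℝ) {f : ℝ[X]} (hf : ∀ x ∈ Set.Icc (-1 : ℝ) 1, 0 ≤ f.eval x) :
    0 ≤ wInt lam f :=
  intervalIntegral.integral_nonneg (by norm_num) fun x hx =>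
    mul_nonneg (hf x hx) (gegenWeight_nonneg lam hx)

theorem wInt_pos {lam : ℝ} (hl : -1 / 2 < lam) {f : ℝ[X]} (hf0 : f ≠ 0)
    (hf : ∀ x ∈ Set.Ioo (-1 : ℝ) 1, 0 ≤ f.eval x) : 0 < wInt lam f := by
  have hsub : Set.Ioo (-1 : ℝ) 1 \ (f.roots.toFinset : Set ℝ) ⊆
      Function.support (fun x => f.eval x * gegenWeight lam x) ∩ Set.Ioc (-1) 1 := by
    rintro x ⟨hx, hr⟩
    refine ⟨mul_ne_zero ?_ (gegenWeight_pos lam hx).ne', Set.Ioo_subset_Ioc_self hx⟩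
    intro h
    apply hr
    simp [hf0, h]
  rw [wInt, intervalIntegral.integral_pos_iff_support_of_nonneg_ae' ?_
    (intervalIntegrable_eval_mul_gegenWeight hl f)]
  · refine ⟨by norm_num, lt_of_lt_of_le ?_ (measure_mono hsub)⟩
    rw [measure_sdiff_null (f.roots.toFinset.finite_toSet.measure_zero _), Real.volume_Ioo]
    norm_num
  · rw [Set.uIoc_of_le (by norm_num), EventuallyLE, ae_restrict_iff' measurableSet_Ioc]
    have : ∀ᵐ x : ℝ, x ≠ 1 := by simp [ae_iff]
    filter_upwards [this] with x hx1 hx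
    have hx' : x ∈ Set.Ioo (-1 : ℝ) 1 := ⟨hx.1, lt_of_le_of_ne hx.2 hx1⟩
    exact mul_nonneg (hf x hx') (gegenWeight_pos lam hx').le

theorem hasDerivAt_one_sub_rpow_mul (a : ℝ) {x : ℝ} (hx : x ∈ Set.Ioo (-1 : ℝ) 1) :
    HasDerivAt (fun x : ℝ => (1 - x) ^ (a + 1) * (1 + x) ^ (a + 1))
      (-(2 * (a + 1) * x) * jacobiWeight a a x) x := by
  have hx1 : 0 < 1 - x := by linarith [hx.2]
  have hx2 : 0 < 1 + x := by linarith [hx.1]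
  have h1 : HasDerivAt (fun x : ℝ => (1 - x) ^ (a + 1)) _ x :=
    (((hasDerivAt_id x).const_sub 1).rpow_const (p := a + 1) (Or.inl hx1.ne'))
  have h2 : HasDerivAt (fun x : ℝ => (1 + x) ^ (a + 1)) _ x :=
    (((hasDerivAt_id x).const_add 1).rpow_const (p := a + 1) (Or.inl hx2.ne'))
  refine (h1.mul h2).congr_deriv ?_
  simp only [id, add_sub_cancel_right, jacobiWeight]
  rw [Real.rpow_add_one hx1.ne', Real.rpow_add_one hx2.ne']
  ring

/-- Sturm–Liouville form: the difference of the integrands is the derivative of `(1 - x²)^(lam +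
1/2) (f' h - f h')`, which vanishes at `±1` because `lam + 1/2 > 0`. -/
theorem wInt_gegenOp_mul {lam : ℝ} (hl : -1 / 2 < lam) (f h : ℝ[X]) :
    wInt lam (gegenOp lam f * h) = wInt lam (f * gegenOp lam h) := by
  rw [← sub_eq_zero, ← wInt_sub hl, wInt]
  set a := lam - 1 / 2 with ha
  have key := intervalIntegral.integral_eq_sub_of_hasDerivAt_of_le (a := -1) (b := 1)
    (f := fun x : ℝ => ((1 - x) ^ (a + 1) * (1 + x) ^ (a + 1)) *
      (derivative f * h - f * derivative h).eval x)
    (f' := fun x => (gegenOp lam f * h - f * gegenOp lam h).eval x * gegenWeight lam x)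
    (by norm_num) ?_ ?_ (intervalIntegrable_eval_mul_gegenWeight hl _)
  · rw [key]
    have : a + 1 ≠ 0 := by rw [ha]; intro h; linarith
    simp [Real.zero_rpow this]
  · have h1 : Continuous fun x : ℝ => (1 - x) ^ (a + 1) :=
      Continuous.rpow_const (by fun_prop) fun x => Or.inr (by rw [ha]; linarith)
    have h2 : Continuous fun x : ℝ => (1 + x) ^ (a + 1) :=
      Continuous.rpow_const (by fun_prop) fun x => Or.inr (by rw [ha]; linarith)
    exact ((h1.mul h2).mul (Polynomial.continuous _)).continuousOn
  · intro x hx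
    have hx1 : 0 < 1 - x := by linarith [hx.2]
    have hx2 : 0 < 1 + x := by linarith [hx.1]
    refine ((hasDerivAt_one_sub_rpow_mul a hx).mul
      ((derivative f * h - f * derivative h).hasDerivAt x)).congr_deriv ?_
    simp only [gegenWeight, jacobiWeight, ← ha]
    rw [Real.rpow_add_one hx1.ne', Real.rpow_add_one hx2.ne']
    have hl' : lam = a + 1 / 2 := by rw [ha]; ring
    simp only [gegenOp, hl', derivative_sub, derivative_mul, eval_sub, eval_mul, eval_add, eval_C,
      eval_X, eval_pow, eval_one]
    ring

/-- Gegenbauer polynomials are orthogonal to polynomials of lower degree. -/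
theorem wInt_gegenPoly_mul_eq_zero {lam : ℝ} (hl : -1 / 2 < lam) (n : ℕ) {f : ℝ[X]}
    (hf : f.degree < n) : wInt lam (gegenPoly lam n * f) = 0 := by
  suffices H : ∀ d : ℕ, d ≤ n → ∀ f : ℝ[X], f.degree < d → wInt lam (gegenPoly lam n * f) = 0 from
    H n le_rfl f hf
  intro d
  induction d with
  | zero =>
    intro _ f hf
    rw [show f = 0 by simpa using hf, mul_zero, wInt_zero]
  | succ d ih =>
    intro hd f hf
    have hfd : f.natDegree ≤ d := by
      by_cases hz : f = 0
      · simp [hz]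
      · exact Nat.lt_succ_iff.1 ((natDegree_lt_iff_degree_lt hz).2 hf)
    -- Up to lower degree, `f` is an eigenvector with eigenvalue `-d (d + 2 lam)`. Moving the
    -- operator onto `p_n` leaves `(n - d) (n + d + 2 lam) ∫ p_n f ω = 0`, with a nonzero factor.
    have h1 := ih (by omega) _ (degree_gegenOp_add_lt lam hfd)
    rw [mul_add, wInt_add hl, ← wInt_gegenOp_mul hl, gegenPoly_ode,
      show C (-((n : ℝ) * (n + 2 * lam))) * gegenPoly lam n * f =
        C (-((n : ℝ) * (n + 2 * lam))) * (gegenPoly lam n * f) by ring,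
      show gegenPoly lam n * (C ((d : ℝ) * (d + 2 * lam)) * f) =
        C ((d : ℝ) * (d + 2 * lam)) * (gegenPoly lam n * f) by ring,
      wInt_C_mul, wInt_C_mul] at h1
    have hdn : (d : ℝ) + 1 ≤ n := by exact_mod_cast hd
    have hd0 : (0 : ℝ) ≤ d := by positivity
    have h2 : ((n : ℝ) - d) * (n + d + 2 * lam) ≠ 0 :=
      mul_ne_zero (by linarith) (by linarith)
    apply mul_left_cancel₀ h2
    linarith

/-! ### Zeros of Gegenbauer polynomials -/

/-- `S` collects the roots of odd multiplicity in the interval, so the product has only even ones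
there. The induction removes one root factor at a time and toggles its membership in `S`. -/
theorem exists_finset_sign_change (P : ℝ[X]) (hP : P ≠ 0) :
    ∃ S : Finset ℝ, (∀ s ∈ S, s ∈ Set.Ioo (-1 : ℝ) 1 ∧ P.IsRoot s) ∧
      ((∀ x ∈ Set.Ioo (-1 : ℝ) 1, 0 ≤ (P * ∏ s ∈ S, (X - C s)).eval x) ∨
       (∀ x ∈ Set.Ioo (-1 : ℝ) 1, (P * ∏ s ∈ S, (X - C s)).eval x ≤ 0)) := by
  induction hd : P.natDegree using Nat.strong_induction_on generalizing P with
  | _ d ih =>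
  by_cases hr : ∃ x ∈ Set.Ioo (-1 : ℝ) 1, P.IsRoot x
  · obtain ⟨x, hx, hxr⟩ := hr
    obtain ⟨Q, rfl⟩ := dvd_iff_isRoot.2 hxr
    have hQ : Q ≠ 0 := right_ne_zero_of_mul hP
    have hdeg : Q.natDegree < d := by
      rw [← hd, natDegree_mul (X_sub_C_ne_zero x) hQ, natDegree_X_sub_C]; omega
    obtain ⟨S, hS, hsign⟩ := ih _ hdeg Q hQ rfl
    by_cases hxS : x ∈ S
    · refine ⟨S.erase x, fun s hs => ⟨(hS s (Finset.mem_of_mem_erase hs)).1, ?_⟩, ?_⟩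
      · exact (hS s (Finset.mem_of_mem_erase hs)).2.dvd (dvd_mul_left _ _)
      · rwa [show (X - C x) * Q * ∏ s ∈ S.erase x, (X - C s) = Q * ∏ s ∈ S, (X - C s) by
          rw [← Finset.mul_prod_erase S (fun s => X - C s) hxS]; ring]
    · refine ⟨insert x S, fun s hs => ?_, ?_⟩
      · rcases Finset.mem_insert.1 hs with rfl | hs
        · exact ⟨hx, hxr⟩
        · exact ⟨(hS s hs).1, (hS s hs).2.dvd (dvd_mul_left _ _)⟩
      · rw [Finset.prod_insert hxS, show (X - C x) * Q * ((X - C x) * ∏ s ∈ S, (X - C s)) =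
          (X - C x) ^ 2 * (Q * ∏ s ∈ S, (X - C s)) by ring]
        rcases hsign with h | h
        · exact Or.inl fun y hy => by
            rw [eval_mul, eval_pow]; exact mul_nonneg (sq_nonneg _) (h y hy)
        · exact Or.inr fun y hy => by
            rw [eval_mul, eval_pow]
            exact mul_nonpos_of_nonneg_of_nonpos (sq_nonneg _) (h y hy)
  · refine ⟨∅, by simp, ?_⟩
    simp only [Finset.prod_empty, mul_one]
    by_contra! hcon
    obtain ⟨⟨x, hx, hx0⟩, y, hy, hy0⟩ := hcon
    have h0 : (0 : ℝ) ∈ (fun z => P.eval z) '' Set.Ioo (-1 : ℝ) 1 :=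
      isPreconnected_Ioo.intermediate_value hx hy P.continuous.continuousOn ⟨hx0.le, hy0.le⟩
    obtain ⟨z, hz, hz0⟩ := h0
    exact hr ⟨z, hz, hz0⟩

/-- The nodes of the Gegenbauer-Gauss quadrature. -/
def gegenNodes (lam : ℝ) (n : ℕ) : Finset ℝ := gaussNodes n (lam - 1 / 2) (lam - 1 / 2)

section Nodes

variable {lam : ℝ} (hl : -1 / 2 < lam) (h0 : lam ≠ 0) (n : ℕ)
include hl h0

theorem gegenPoly_ne_zero : gegenPoly lam n ≠ 0 := fun h =>
  coeff_gegenPoly_ne_zero hl h0 n (by simp [h])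

theorem natDegree_gegenPoly : (gegenPoly lam n).natDegree = n :=
  le_antisymm (natDegree_gegenPoly_le lam n)
    (le_natDegree_of_ne_zero (coeff_gegenPoly_ne_zero hl h0 n))

theorem gegenNodes_eq : gegenNodes lam n = (gegenPoly lam n).roots.toFinset := by
  obtain ⟨c, hc, h⟩ := exists_jacobiPoly_eq hl h0 n
  rw [gegenNodes, gaussNodes, h, roots_C_mul _ hc]

/-- With fewer than `n` sign changes, `p_n` times the product over them would have constant sign and
hence a nonzero integral, against orthogonality. -/
theorem gegenNodes_spec : (gegenNodes lam n).card = n ∧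
    ∀ x ∈ gegenNodes lam n, x ∈ Set.Ioo (-1 : ℝ) 1 ∧ (gegenPoly lam n).eval x = 0 := by
  have hp := gegenPoly_ne_zero hl h0 n
  obtain ⟨S, hS, hsign⟩ := exists_finset_sign_change _ hp
  rw [gegenNodes_eq hl h0]
  have hsub : S ⊆ (gegenPoly lam n).roots.toFinset := fun s hs => by
    rw [Multiset.mem_toFinset, mem_roots hp]
    exact (hS s hs).2
  have hcard : (gegenPoly lam n).roots.toFinset.card ≤ n :=
    (Multiset.toFinset_card_le _).trans
      ((card_roots' _).trans (natDegree_gegenPoly hl h0 n).le)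
  have hSn : n ≤ S.card := by
    by_contra! hlt
    have hq : (∏ s ∈ S, (X - C s) : ℝ[X]).degree < n := by
      rw [degree_prod_of_monic _ _ fun s _ => monic_X_sub_C s]
      simpa using hlt
    have horth := wInt_gegenPoly_mul_eq_zero hl n hq
    have hne : gegenPoly lam n * ∏ s ∈ S, (X - C s) ≠ 0 :=
      mul_ne_zero hp (Finset.prod_ne_zero_iff.2 fun s _ => X_sub_C_ne_zero s)
    rcases hsign with h | h
    · exact (wInt_pos hl hne h).ne' horth
    · have := wInt_pos hl (f := C (-1) * (gegenPoly lam n * ∏ s ∈ S, (X - C s)))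
        (mul_ne_zero (by simp) hne) fun x hx => by
          rw [eval_mul, eval_C]
          linarith [h x hx]
      rw [wInt_C_mul, horth] at this
      simp at this
  have heq := Finset.eq_of_subset_of_card_le hsub (hcard.trans hSn)
  rw [← heq] at hcard ⊢
  exact ⟨le_antisymm hcard hSn, hS⟩

end Nodes

/-! ### Gauss quadrature on polynomials -/

/-- The Gauss quadrature weights are the integrals of the Lagrange basis polynomials. -/
theorem gaussWeight_eq_wInt (lam : ℝ) (n : ℕ) (x : ℝ) :
    gaussWeight n (lam - 1 / 2) (lam - 1 / 2) x =
      wInt lam (Lagrange.basis (gegenNodes lam n) id x) := rfl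

/-- The quadrature remainder of a real polynomial. -/
def polyRem (lam : ℝ) (n : ℕ) (f : ℝ[X]) : ℝ :=
  wInt lam f - ∑ x ∈ gegenNodes lam n,
    f.eval x * gaussWeight n (lam - 1 / 2) (lam - 1 / 2) x

theorem polyRem_add {lam : ℝ} (hl : -1 / 2 < lam) (n : ℕ) (f h : ℝ[X]) :
    polyRem lam n (f + h) = polyRem lam n f + polyRem lam n h := by
  simp only [polyRem, wInt_add hl, eval_add, add_mul, Finset.sum_add_distrib]
  ring

theorem polyRem_C_mul (lam : ℝ) (n : ℕ) (c : ℝ) (f : ℝ[X]) :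
    polyRem lam n (C c * f) = c * polyRem lam n f := by
  simp only [polyRem, wInt_C_mul, eval_mul, eval_C, mul_sub, Finset.mul_sum, mul_assoc]

theorem polyRem_sum {lam : ℝ} (hl : -1 / 2 < lam) (n : ℕ) {ι : Type*} (s : Finset ι)
    (f : ι → ℝ[X]) : polyRem lam n (∑ i ∈ s, f i) = ∑ i ∈ s, polyRem lam n (f i) := by
  induction s using Finset.cons_induction with
  | empty => simp [polyRem, wInt_zero]
  | cons a s ha ih => rw [Finset.sum_cons, Finset.sum_cons, polyRem_add hl, ih]

section Gauss

variable {lam : ℝ} (hl : -1 / 2 < lam) (h0 : lam ≠ 0) (n : ℕ)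
include hl h0

theorem polyRem_gegenPoly_mul (f : ℝ[X]) :
    polyRem lam n (gegenPoly lam n * f) = wInt lam (gegenPoly lam n * f) := by
  rw [polyRem, Finset.sum_eq_zero, sub_zero]
  intro x hx
  rw [eval_mul, ((gegenNodes_spec hl h0 n).2 x hx).2, zero_mul, zero_mul]

theorem polyRem_eq_zero_of_degree_lt {f : ℝ[X]} (hf : f.degree < n) : polyRem lam n f = 0 := by
  have h := Lagrange.eq_interpolate (s := gegenNodes lam n) (v := id) (f := f)
    Function.injective_id.injOn (by rwa [(gegenNodes_spec hl h0 n).1])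
  rw [polyRem, sub_eq_zero]
  conv_lhs => rw [h]
  rw [Lagrange.interpolate_apply, wInt_sum hl]
  simp only [wInt_C_mul, id, gaussWeight_eq_wInt]

/-- Gauss quadrature is exact for polynomials of degree less than `2 n`. -/
theorem polyRem_eq_zero {f : ℝ[X]} (hf : f.natDegree < 2 * n) : polyRem lam n f = 0 := by
  have hp := gegenPoly_ne_zero hl h0 n
  have hd := natDegree_gegenPoly hl h0 n
  have hn : n ≠ 0 := by omega
  have hdeg : (gegenPoly lam n).degree = n := by rw [degree_eq_natDegree hp, hd]
  have h1 := EuclideanDomain.div_add_mod f (gegenPoly lam n)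
  have hq : (f / gegenPoly lam n).degree < n := by
    by_cases hz : f / gegenPoly lam n = 0
    · rw [hz, degree_zero]; exact WithBot.bot_lt_coe n
    · have hle : (gegenPoly lam n).degree ≤ f.degree := by
        by_contra! hlt
        exact hz ((Polynomial.div_eq_zero_iff hp).2 hlt)
      have hf0 : f ≠ 0 := by
        rintro rfl
        exact hz (EuclideanDomain.zero_div)
      have h2 := degree_add_div hp hle
      rw [hdeg, degree_eq_natDegree hz, degree_eq_natDegree hf0] at h2
      have h3 : n + (f / gegenPoly lam n).natDegree = f.natDegree := by exact_mod_cast h2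
      rw [degree_eq_natDegree hz]
      exact_mod_cast (by omega : (f / gegenPoly lam n).natDegree < n)
  have hr : (f % gegenPoly lam n).degree < n := hdeg ▸ EuclideanDomain.mod_lt f hp
  rw [← h1, polyRem_add hl, polyRem_gegenPoly_mul hl h0, wInt_gegenPoly_mul_eq_zero hl n hq,
    polyRem_eq_zero_of_degree_lt hl h0 n hr, add_zero]

/-- The square of a Lagrange basis polynomial has degree `2n - 2`, so the rule is exact on it, and
its quadrature sum is the single weight. -/
theorem gaussWeight_nonneg {x : ℝ} (hx : x ∈ gegenNodes lam n) :
    0 ≤ gaussWeight n (lam - 1 / 2) (lam - 1 / 2) x := by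
  set b := Lagrange.basis (gegenNodes lam n) id x with hb
  have hinj : Set.InjOn (id : ℝ → ℝ) (gegenNodes lam n) := Function.injective_id.injOn
  have hcard := (gegenNodes_spec hl h0 n).1
  have hpos : 0 < (gegenNodes lam n).card := Finset.card_pos.2 ⟨x, hx⟩
  have hbd : b.natDegree = n - 1 := by rw [hb, Lagrange.natDegree_basis hinj hx, hcard]
  have h2 : polyRem lam n (b ^ 2) = 0 := polyRem_eq_zero hl h0 n (by
    rw [natDegree_pow, hbd]; omega)
  have h3 : ∑ y ∈ gegenNodes lam n, (b ^ 2).eval y * gaussWeight n (lam - 1 / 2) (lam - 1 / 2) y =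
      gaussWeight n (lam - 1 / 2) (lam - 1 / 2) x := by
    rw [Finset.sum_eq_single x]
    · have : b.eval x = 1 := Lagrange.eval_basis_self (v := id) hinj hx
      rw [eval_pow, this, one_pow, one_mul]
    · intro y hy hne
      have : b.eval y = 0 := Lagrange.eval_basis_of_ne (v := id) hne.symm hy
      rw [eval_pow, this]; ring
    · exact fun h => absurd hx h
  rw [polyRem, h3, sub_eq_zero] at h2
  rw [← h2]
  exact wInt_nonneg lam fun y _ => by rw [eval_pow]; exact sq_nonneg _

theorem sum_gaussWeight (hn : 1 ≤ n) :
    ∑ x ∈ gegenNodes lam n, gaussWeight n (lam - 1 / 2) (lam - 1 / 2) x = wInt lam 1 := by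
  have h := polyRem_eq_zero hl h0 n (f := 1) (by rw [natDegree_one]; omega)
  rw [polyRem, sub_eq_zero] at h
  simpa using h.symm

/-- The integral and the quadrature sum are each bounded by the total mass, the weights being
nonnegative. -/
theorem abs_polyRem_le (hn : 1 ≤ n) {f : ℝ[X]} (hf : ∀ x ∈ Set.Icc (-1 : ℝ) 1, |f.eval x| ≤ 1) :
    |polyRem lam n f| ≤ 2 * wInt lam 1 := by
  have h1 : |wInt lam f| ≤ wInt lam 1 := by
    have h2 := wInt_nonneg lam (f := 1 - f) fun x hx => by
      rw [eval_sub, eval_one]; linarith [(abs_le.1 (hf x hx)).2]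
    have h3 := wInt_nonneg lam (f := 1 + f) fun x hx => by
      rw [eval_add, eval_one]; linarith [(abs_le.1 (hf x hx)).1]
    rw [wInt_sub hl] at h2
    rw [wInt_add hl] at h3
    exact abs_le.2 ⟨by linarith, by linarith⟩
  have h2 : |∑ x ∈ gegenNodes lam n, f.eval x * gaussWeight n (lam - 1 / 2) (lam - 1 / 2) x| ≤
      wInt lam 1 := by
    rw [← sum_gaussWeight hl h0 n hn]
    refine (Finset.abs_sum_le_sum_abs _ _).trans (Finset.sum_le_sum fun x hx => ?_)
    rw [abs_mul, abs_of_nonneg (gaussWeight_nonneg hl h0 n hx)]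
    exact mul_le_of_le_one_left (gaussWeight_nonneg hl h0 n hx)
      (hf x (Set.Ioo_subset_Icc_self ((gegenNodes_spec hl h0 n).2 x hx).1))
  rw [polyRem]
  refine (abs_sub _ _).trans ?_
  linarith

end Gauss

/-! ### Chebyshev moments of Gegenbauer polynomials -/

/-- The Chebyshev moments `∫ p_n T_m ω` of the Gegenbauer polynomial `p_n`. -/
def chebMoment (lam : ℝ) (n : ℕ) (m : ℤ) : ℝ :=
  wInt lam (gegenPoly lam n * Chebyshev.T ℝ m)

theorem two_mul_wInt_gegenPoly_mul_chebV {lam : ℝ} (hl : -1 / 2 < lam) (n : ℕ) (m : ℤ) :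
    2 * lam * m * wInt lam (gegenPoly lam n * chebV m) =
      (n * (n + 2 * lam) - m ^ 2) * chebMoment lam n m := by
  have h := wInt_gegenOp_mul hl (gegenPoly lam n) (Chebyshev.T ℝ m)
  have hm : (m : ℝ[X]) = C (m : ℝ) := by simp
  rw [gegenPoly_ode, gegenOp_T, hm,
    show C (-((n : ℝ) * (n + 2 * lam))) * gegenPoly lam n * Chebyshev.T ℝ m =
      C (-((n : ℝ) * (n + 2 * lam))) * (gegenPoly lam n * Chebyshev.T ℝ m) by ring,
    show gegenPoly lam n * (-C (m : ℝ) ^ 2 * Chebyshev.T ℝ m - C (2 * lam) * C (m : ℝ) * chebV m) =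
      C (-(m : ℝ) ^ 2) * (gegenPoly lam n * Chebyshev.T ℝ m) -
        C (2 * lam * m) * (gegenPoly lam n * chebV m) by
      simp only [C_neg, C_mul, C_pow]; ring,
    wInt_sub hl, wInt_C_mul, wInt_C_mul, wInt_C_mul] at h
  rw [chebMoment]
  linarith

theorem wInt_gegenPoly_mul_chebV_sub {lam : ℝ} (hl : -1 / 2 < lam) (n : ℕ) (m : ℤ) :
    wInt lam (gegenPoly lam n * chebV (m + 1)) - wInt lam (gegenPoly lam n * chebV (m - 1)) =
      chebMoment lam n (m + 1) + chebMoment lam n (m - 1) := by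
  rw [← wInt_sub hl, ← mul_sub, chebV_add_one_sub, mul_add, wInt_add hl, chebMoment, chebMoment]

/-- Self-adjointness expresses the `chebV` integrals at `m ± 1` through the moments there, and the
difference of these integrals is a sum of two moments. Eliminating them leaves two terms. -/
theorem chebMoment_recurrence {lam : ℝ} (hl : -1 / 2 < lam) (n : ℕ) (m : ℤ) :
    ((m : ℝ) - 1) * (n - (m + 1)) * (n + (m + 1) + 2 * lam) * chebMoment lam n (m + 1) =
      (m + 1) * (n + (m - 1)) * (n - (m - 1) + 2 * lam) * chebMoment lam n (m - 1) := by
  have h1 := two_mul_wInt_gegenPoly_mul_chebV hl n (m + 1)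
  have h2 := two_mul_wInt_gegenPoly_mul_chebV hl n (m - 1)
  have h3 := wInt_gegenPoly_mul_chebV_sub hl n m
  push_cast at h1 h2
  linear_combination (-((m : ℝ) - 1)) * h1 + (m + 1 : ℝ) * h2 +
    2 * lam * ((m : ℝ) + 1) * (m - 1) * h3

theorem chebMoment_eq_zero_of_natAbs_lt {lam : ℝ} (hl : -1 / 2 < lam) {n : ℕ} {m : ℤ}
    (hm : m.natAbs < n) : chebMoment lam n m = 0 := by
  refine wInt_gegenPoly_mul_eq_zero hl n ?_
  rw [Chebyshev.degree_T]
  exact_mod_cast hm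

/-- The factors are grouped so that the first two tend to `1` as `n → ∞`, while the third is the
ratio of consecutive values of `rising (-lam)`. -/
theorem chebMoment_add_two {lam : ℝ} (hl : -1 / 2 < lam) {n : ℕ} (hn : 1 ≤ n) (l : ℕ) :
    chebMoment lam n (n + 2 * (l + 1 : ℕ)) =
      ((n : ℝ) + 2 * l + 2) / (n + 2 * l) * ((n + l) / (n + l + 1 + lam)) *
        ((l - lam) / (l + 1)) * chebMoment lam n (n + 2 * l) := by
  have h := chebMoment_recurrence hl n (n + 2 * l + 1)
  have hn' : (1 : ℝ) ≤ n := by exact_mod_cast hn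
  have hl0 : (0 : ℝ) ≤ l := by positivity
  have e1 : ((n : ℤ) + 2 * l + 1 + 1) = (n : ℤ) + 2 * (l + 1 : ℕ) := by push_cast; ring
  have e2 : ((n : ℤ) + 2 * l + 1 - 1) = (n : ℤ) + 2 * l := by ring
  rw [e1, e2] at h
  push_cast at h ⊢
  have p1 : (n : ℝ) + 2 * l ≠ 0 := by positivity
  have p2 : (n : ℝ) + l + 1 + lam ≠ 0 := by
    have : 0 < (n : ℝ) + l + 1 + lam := by linarith
    exact this.ne'
  have p3 : (l : ℝ) + 1 ≠ 0 := by positivity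
  generalize chebMoment lam n ((n : ℤ) + 2 * ((l : ℤ) + 1)) = A at *
  generalize chebMoment lam n ((n : ℤ) + 2 * l) = B at *
  field_simp
  linear_combination (-1 / 4 : ℝ) * h

theorem chebMoment_odd {lam : ℝ} (hl : -1 / 2 < lam) {n : ℕ} (hn : 1 ≤ n) (l : ℕ) :
    chebMoment lam n (n + 2 * l + 1) = 0 := by
  have hn' : (1 : ℝ) ≤ n := by exact_mod_cast hn
  induction l with
  | zero =>
    -- For `n = 1` the recurrence at `m = n` degenerates through its factor `m - 1`, so the
    -- relations it came from are used directly.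
    rcases hn.eq_or_lt with rfl | hn2
    · have h1 := two_mul_wInt_gegenPoly_mul_chebV hl 1 2
      have h2 := wInt_gegenPoly_mul_chebV_sub hl 1 1
      have h3 : chebMoment lam 1 0 = 0 := chebMoment_eq_zero_of_natAbs_lt hl (by simp)
      have h4 : chebV 0 = 0 := by simp [chebV, Chebyshev.U_neg_one]
      norm_num [h3, h4, wInt_zero] at h1 h2 ⊢
      rw [h2] at h1
      have : (3 + 2 * lam) * chebMoment lam 1 2 = 0 := by linarith
      rcases mul_eq_zero.1 this with h | h
      · linarith
      · exact h
    · have h := chebMoment_recurrence hl n n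
      have h0 : chebMoment lam n ((n : ℤ) - 1) = 0 :=
        chebMoment_eq_zero_of_natAbs_lt hl (by omega)
      have hn2' : (2 : ℝ) ≤ n := by exact_mod_cast hn2
      rw [h0, mul_zero, Int.cast_natCast] at h
      have h5 : ((n : ℝ) - 1) * (n - (n + 1)) * (n + (n + 1) + 2 * lam) ≠ 0 := by
        refine mul_ne_zero (mul_ne_zero (by linarith) (by linarith)) (by linarith)
      simpa using (mul_eq_zero.1 h).resolve_left h5
  | succ l ih =>
    have h := chebMoment_recurrence hl n (n + 2 * l + 2)
    have hl0 : (0 : ℝ) ≤ l := by positivity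
    rw [show (n : ℤ) + 2 * l + 2 - 1 = n + 2 * l + 1 by ring, ih, mul_zero,
      show (n : ℤ) + 2 * l + 2 + 1 = n + 2 * (l + 1 : ℕ) + 1 by push_cast; ring] at h
    push_cast at h
    have h5 : ((n : ℝ) + 2 * l + 2 - 1) * (n - (n + 2 * l + 2 + 1)) *
        (n + (n + 2 * l + 2 + 1) + 2 * lam) ≠ 0 :=
      mul_ne_zero (mul_ne_zero (by linarith) (by linarith)) (by linarith)
    push_cast
    exact (mul_eq_zero.1 h).resolve_left h5

/-- In `2 T_m T_k = T_{m+k} + T_{m-k}` both halves give the same sum, since the coefficients are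
symmetric under swapping the indices. -/
theorem gegenPoly_mul_T (lam : ℝ) (n : ℕ) (m : ℤ) : gegenPoly lam n * Chebyshev.T ℝ m =
    ∑ p ∈ Finset.HasAntidiagonal.antidiagonal n,
      C (rising lam p.1 * rising lam p.2) * Chebyshev.T ℝ (m + ((p.2 : ℤ) - p.1)) := by
  have h1 : C 2 * (gegenPoly lam n * Chebyshev.T ℝ m) =
      ∑ p ∈ Finset.HasAntidiagonal.antidiagonal n,
        C (rising lam p.1 * rising lam p.2) * Chebyshev.T ℝ (m + ((p.2 : ℤ) - p.1)) +
      ∑ p ∈ Finset.HasAntidiagonal.antidiagonal n,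
        C (rising lam p.1 * rising lam p.2) * Chebyshev.T ℝ (m - ((p.2 : ℤ) - p.1)) := by
    rw [gegenPoly, Finset.sum_mul, Finset.mul_sum, ← Finset.sum_add_distrib]
    refine Finset.sum_congr rfl fun p _ => ?_
    have := Chebyshev.T_mul_T ℝ m ((p.2 : ℤ) - p.1)
    rw [map_ofNat C 2]
    linear_combination C (rising lam p.1 * rising lam p.2) * this
  have h2 : ∑ p ∈ Finset.HasAntidiagonal.antidiagonal n,
        C (rising lam p.1 * rising lam p.2) * Chebyshev.T ℝ (m - ((p.2 : ℤ) - p.1)) =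
      ∑ p ∈ Finset.HasAntidiagonal.antidiagonal n,
        C (rising lam p.1 * rising lam p.2) * Chebyshev.T ℝ (m + ((p.2 : ℤ) - p.1)) := by
    rw [← Finset.Nat.sum_antidiagonal_swap]
    refine Finset.sum_congr rfl fun p _ => ?_
    simp only [Prod.fst_swap, Prod.snd_swap]
    rw [mul_comm (rising lam p.2), show m - ((p.1 : ℤ) - p.2) = m + (p.2 - p.1) by ring]
  rw [h2, ← two_mul, map_ofNat C 2] at h1
  exact mul_left_cancel₀ two_ne_zero h1

/-! ### Remainders of Chebyshev polynomials -/

/-- The coefficients of `w⁻ⁿ p_n` as a polynomial in `w⁻²`. -/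
def gegenCoeff (lam : ℝ) (n i : ℕ) : ℝ := if i ≤ n then rising lam i * rising lam (n - i) else 0

section Remainder

variable {lam : ℝ} (hl : -1 / 2 < lam) (h0 : lam ≠ 0) {n : ℕ} (hn : 1 ≤ n)
include hl h0

/-- Two evaluations of the remainder of `p_n T_{n+q}`: it equals the integral because `p_n` vanishes
at the nodes, and it is linear in the Chebyshev expansion. -/
theorem sum_rising_mul_polyRem_T (q : ℕ) :
    ∑ i ∈ Finset.range (n + 1), rising lam i * rising lam (n - i) *
      polyRem lam n (Chebyshev.T ℝ (2 * n + q - 2 * i)) = chebMoment lam n (n + q) := by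
  rw [chebMoment, ← polyRem_gegenPoly_mul hl h0, gegenPoly_mul_T, polyRem_sum hl,
    Finset.Nat.sum_antidiagonal_eq_sum_range_succ_mk]
  refine Finset.sum_congr rfl fun i hi => ?_
  have : i ≤ n := Nat.lt_succ_iff.1 (Finset.mem_range.1 hi)
  rw [polyRem_C_mul]
  congr 3
  push_cast [this]
  ring

theorem polyRem_T_eq_zero_of_natAbs_lt {m : ℤ} (hm : m.natAbs < 2 * n) :
    polyRem lam n (Chebyshev.T ℝ m) = 0 :=
  polyRem_eq_zero hl h0 n (by rwa [Chebyshev.natDegree_T])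

theorem rising_ne_zero (k : ℕ) : rising lam k ≠ 0 := by
  induction k with
  | zero => simp
  | succ k ih =>
    rw [rising_succ]
    refine mul_ne_zero (div_ne_zero ?_ (by positivity)) ih
    rcases k with _ | k
    · simpa using h0
    · have : (0 : ℝ) ≤ k := by positivity
      push_cast
      intro h
      linarith

include hn

/-- The system is triangular with zero right-hand side: terms `0 < i ≤ q` vanish by induction, terms
`i > q` by exactness, and the coefficient at `i = 0` is nonzero. -/
theorem polyRem_T_odd (q : ℕ) : polyRem lam n (Chebyshev.T ℝ (2 * n + (2 * q + 1 : ℕ))) = 0 := by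
  induction q using Nat.strong_induction_on with
  | _ q ih =>
  have h := sum_rising_mul_polyRem_T hl h0 (n := n) (2 * q + 1)
  rw [show (n : ℤ) + (2 * q + 1 : ℕ) = n + 2 * q + 1 by push_cast; ring,
    chebMoment_odd hl hn, Finset.sum_eq_single 0] at h
  · simp only [rising_zero, Nat.sub_zero, one_mul, Nat.cast_zero, mul_zero, sub_zero] at h
    exact (mul_eq_zero.1 h).resolve_left (rising_ne_zero hl h0 n)
  · intro i hi hi0
    have hi' := Finset.mem_range.1 hi
    refine mul_eq_zero_of_right _ ?_
    by_cases hiq : i ≤ q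
    · have := ih (q - i) (by omega)
      rwa [show 2 * (n : ℤ) + (2 * (q - i) + 1 : ℕ) = 2 * n + (2 * q + 1 : ℕ) - 2 * i by
        push_cast [hiq]; ring] at this
    · exact polyRem_T_eq_zero_of_natAbs_lt hl h0 (by omega)
  · simp

omit hn in
/-- The power series identity determining the remainders of the Chebyshev polynomials. -/
theorem sum_gegenCoeff_mul_polyRem_T (l : ℕ) :
    ∑ p ∈ Finset.HasAntidiagonal.antidiagonal l, gegenCoeff lam n p.1 *
      polyRem lam n (Chebyshev.T ℝ (2 * n + 2 * p.2)) = chebMoment lam n (n + 2 * l) := by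
  have h := sum_rising_mul_polyRem_T hl h0 (n := n) (2 * l)
  push_cast at h
  rw [← h, Finset.Nat.sum_antidiagonal_eq_sum_range_succ_mk]
  -- Both sums are rewritten over a common range. Terms with `l < i ≤ n` may be dropped because
  -- their Chebyshev degree is below `2n`.
  have e1 : ∑ i ∈ Finset.range (l + 1), gegenCoeff lam n i *
      polyRem lam n (Chebyshev.T ℝ (2 * n + 2 * (l - i : ℕ))) =
      ∑ i ∈ Finset.range (n + l + 1), if i ≤ n ∧ i ≤ l then rising lam i * rising lam (n - i) *
      polyRem lam n (Chebyshev.T ℝ (2 * n + 2 * l - 2 * i)) else 0 := by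
    rw [← Finset.sum_subset (Finset.range_mono (by omega : l + 1 ≤ n + l + 1))]
    · refine Finset.sum_congr rfl fun i hi => ?_
      have hi' : i ≤ l := Nat.lt_succ_iff.1 (Finset.mem_range.1 hi)
      rw [gegenCoeff]
      by_cases hin : i ≤ n
      · rw [if_pos hin, if_pos ⟨hin, hi'⟩]
        congr 3
        push_cast [hi']
        ring
      · rw [if_neg hin, if_neg (by tauto), zero_mul]
    · intro i _ hi
      rw [Finset.mem_range] at hi
      exact if_neg (by omega)
  have e2 : ∑ i ∈ Finset.range (n + 1), rising lam i * rising lam (n - i) *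
      polyRem lam n (Chebyshev.T ℝ (2 * n + 2 * l - 2 * i)) =
      ∑ i ∈ Finset.range (n + l + 1), if i ≤ n ∧ i ≤ l then rising lam i * rising lam (n - i) *
      polyRem lam n (Chebyshev.T ℝ (2 * n + 2 * l - 2 * i)) else 0 := by
    rw [← Finset.sum_subset (Finset.range_mono (by omega : n + 1 ≤ n + l + 1))]
    · refine Finset.sum_congr rfl fun i hi => ?_
      have hi' : i ≤ n := Nat.lt_succ_iff.1 (Finset.mem_range.1 hi)
      by_cases hil : i ≤ l
      · rw [if_pos ⟨hi', hil⟩]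
      · rw [if_neg (by tauto), polyRem_T_eq_zero_of_natAbs_lt hl h0 (by omega), mul_zero]
    · intro i _ hi
      rw [Finset.mem_range] at hi
      exact if_neg (by omega)
  rw [e1, e2]

omit hn in
theorem rising_mul_polyRem_T_two_mul :
    rising lam n * polyRem lam n (Chebyshev.T ℝ (2 * n)) = chebMoment lam n n := by
  have h := sum_gegenCoeff_mul_polyRem_T hl h0 (n := n) 0
  simpa [gegenCoeff] using h

-- The three-term recurrence is integrated against `T_n`; orthogonality removes `p_{n+2} T_n` and
-- `p_{n+1} T_{n-1}`.
omit h0 in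
theorem chebMoment_self_succ :
    chebMoment lam (n + 1) ((n + 1 : ℕ) : ℤ) =
      (n + 2 * lam) / (n + 1 + lam) * chebMoment lam n n := by
  have hn' : (1 : ℝ) ≤ n := by exact_mod_cast hn
  have h := congrArg (fun f => wInt lam (f * Chebyshev.T ℝ n)) (gegenPoly_recurrence lam n)
  simp only [smul_eq_C_mul] at h
  rw [add_mul, wInt_add hl, mul_assoc, wInt_C_mul, mul_assoc, wInt_C_mul, mul_assoc, wInt_C_mul,
    show 2 * X * gegenPoly lam (n + 1) * Chebyshev.T ℝ n =
      gegenPoly lam (n + 1) * Chebyshev.T ℝ (n + 1) +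
      gegenPoly lam (n + 1) * Chebyshev.T ℝ (n - 1) by
      rw [Chebyshev.T_add_one]; ring, wInt_add hl] at h
  have z1 : wInt lam (gegenPoly lam (n + 2) * Chebyshev.T ℝ n) = 0 :=
    chebMoment_eq_zero_of_natAbs_lt hl (by omega)
  have z2 : wInt lam (gegenPoly lam (n + 1) * Chebyshev.T ℝ (n - 1)) = 0 :=
    chebMoment_eq_zero_of_natAbs_lt hl (by omega)
  rw [z1, z2] at h
  rw [chebMoment, chebMoment]
  have : (n : ℝ) + 1 + lam ≠ 0 := by intro; linarith
  push_cast
  field_simp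
  linarith

omit h0 hn in
theorem chebMoment_one : chebMoment lam 1 1 = lam / (1 + lam) * wInt lam 1 := by
  have h := congrArg (fun f => wInt lam f) (gegenPoly_recurrence lam 0)
  simp only [smul_eq_C_mul] at h
  rw [wInt_add hl, wInt_C_mul, wInt_C_mul, wInt_C_mul, gegenPoly_zero] at h
  have z1 : wInt lam (gegenPoly lam (0 + 2)) = 0 := by
    have := chebMoment_eq_zero_of_natAbs_lt hl (n := 0 + 2) (m := 0) (by simp)
    simpa [chebMoment] using this
  rw [z1, show 2 * X * gegenPoly lam (0 + 1) = C 2 * (gegenPoly lam 1 * Chebyshev.T ℝ 1) by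
    rw [Chebyshev.T_one, map_ofNat C 2]; ring, wInt_C_mul] at h
  rw [chebMoment]
  have : 1 + lam ≠ 0 := by intro; linarith
  simp only [Nat.cast_zero, zero_add] at h
  field_simp
  linarith

end Remainder

/-! ### Size of the remainder of `T_{2n}` -/

theorem wInt_one {lam : ℝ} (hl : -1 / 2 < lam) :
    wInt lam 1 = √Real.pi * Real.Gamma (lam + 1 / 2) / Real.Gamma (lam + 1) := by
  have hpos : 0 < lam + 1 / 2 := by linarith
  have h1 := ProbabilityTheory.beta_eq_betaIntegralReal (lam + 1 / 2) (lam + 1 / 2) hpos hpos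
  have h2 : Complex.betaIntegral ((lam + 1 / 2 : ℝ) : ℂ) ((lam + 1 / 2 : ℝ) : ℂ) =
      ((∫ x in (0 : ℝ)..1, x ^ (lam - 1 / 2) * (1 - x) ^ (lam - 1 / 2) : ℝ) : ℂ) := by
    rw [Complex.betaIntegral, ← intervalIntegral.integral_ofReal]
    refine intervalIntegral.integral_congr fun x hx => ?_
    rw [Set.uIcc_of_le zero_le_one] at hx
    have e : ((lam + 1 / 2 : ℝ) : ℂ) - 1 = ((lam - 1 / 2 : ℝ) : ℂ) := by push_cast; ring
    rw [e, Complex.ofReal_mul, Complex.ofReal_cpow hx.1, Complex.ofReal_cpow (by linarith [hx.2])]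
    push_cast
    rfl
  rw [h2, Complex.ofReal_re, ProbabilityTheory.beta] at h1
  -- The substitution `x ↦ 2x - 1` produces a Beta integral, which Legendre's duplication formula
  -- simplifies.
  have h3 : wInt lam 1 = 2 ^ (2 * lam) *
      ∫ x in (0 : ℝ)..1, x ^ (lam - 1 / 2) * (1 - x) ^ (lam - 1 / 2) := by
    have hs := intervalIntegral.integral_comp_mul_add (a := (0 : ℝ)) (b := 1)
      (fun x => gegenWeight lam x) (two_ne_zero' ℝ) (-1)
    have e : wInt lam 1 = ∫ x in (-1 : ℝ)..1, gegenWeight lam x := by simp [wInt]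
    rw [e, ← intervalIntegral.integral_const_mul]
    have hs' : ∫ x in (-1 : ℝ)..1, gegenWeight lam x =
        2 * ∫ x in (0 : ℝ)..1, gegenWeight lam (2 * x + -1) := by
      rw [hs]; norm_num; ring
    rw [hs', ← intervalIntegral.integral_const_mul]
    refine intervalIntegral.integral_congr fun x hx => ?_
    rw [Set.uIcc_of_le zero_le_one] at hx
    simp only [gegenWeight, jacobiWeight]
    rw [show 1 - (2 * x + -1) = 2 * (1 - x) by ring, show 1 + (2 * x + -1) = 2 * x by ring,
      Real.mul_rpow (by norm_num) (by linarith [hx.2]), Real.mul_rpow (by norm_num) hx.1]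
    have : (2 : ℝ) ^ (2 * lam) = 2 * (2 ^ (lam - 1 / 2) * 2 ^ (lam - 1 / 2)) := by
      rw [show 2 * lam = 1 + (lam - 1 / 2) + (lam - 1 / 2) by ring, Real.rpow_add two_pos,
        Real.rpow_add two_pos, Real.rpow_one]
      ring
    rw [this]
    ring
  have h4 := Real.Gamma_mul_Gamma_add_half (lam + 1 / 2)
  have e1 : lam + 1 / 2 + 1 / 2 = lam + 1 := by ring
  have e2 : 1 - 2 * (lam + 1 / 2) = -(2 * lam) := by ring
  have e3 : 2 * (lam + 1 / 2) = lam + 1 / 2 + (lam + 1 / 2) := by ring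
  rw [e1, e2, e3, Real.rpow_neg two_pos.le] at h4
  have g1 := Real.Gamma_pos_of_pos hpos
  have g2 := Real.Gamma_pos_of_pos (by linarith : 0 < lam + 1)
  have g3 := Real.Gamma_pos_of_pos (by linarith : 0 < lam + 1 / 2 + (lam + 1 / 2))
  have g4 : (0 : ℝ) < 2 ^ (2 * lam) := Real.rpow_pos_of_pos two_pos _
  rw [h3, ← h1]
  generalize Real.Gamma (lam + 1 / 2 + (lam + 1 / 2)) = G3 at *
  generalize Real.Gamma (lam + 1 / 2) = G1 at *
  generalize Real.Gamma (lam + 1) = G2 at *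
  generalize (2 : ℝ) ^ (2 * lam) = t at *
  field_simp at h4 ⊢
  linear_combination h4

/-- The remainder of `T_{2n}`. -/
theorem polyRem_T_two_mul_eq {lam : ℝ} (hl : -1 / 2 < lam) (h0 : lam ≠ 0) {n : ℕ} (hn : 1 ≤ n) :
    polyRem lam n (Chebyshev.T ℝ (2 * n)) = Real.pi / 2 ^ (2 * lam) *
      (Real.Gamma (n + 1) * Real.Gamma (n + 2 * lam) /
        (Real.Gamma (n + 1 + lam) * Real.Gamma (n + lam))) := by
  have hb (n : ℕ) := rising_mul_polyRem_T_two_mul hl h0 (n := n)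
  induction n, hn using Nat.le_induction with
  | base =>
    have h1 := hb 1
    have hr : rising lam 1 = lam := by simpa using rising_succ lam 0
    push_cast at h1 ⊢
    rw [hr, chebMoment_one hl, wInt_one hl] at h1
    have h4 := Real.Gamma_mul_Gamma_add_half (lam + 1 / 2)
    have e1 : lam + 1 / 2 + 1 / 2 = lam + 1 := by ring
    have e2 : 1 - 2 * (lam + 1 / 2) = -(2 * lam) := by ring
    have e3 : 2 * (lam + 1 / 2) = 1 + 2 * lam := by ring
    rw [e1, e2, e3, Real.rpow_neg two_pos.le] at h4
    have g2 := Real.Gamma_pos_of_pos (by linarith : 0 < lam + 1)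
    have g4 : (0 : ℝ) < 2 ^ (2 * lam) := Real.rpow_pos_of_pos two_pos _
    have e4 : Real.Gamma (1 + 1 + lam) = (1 + lam) * Real.Gamma (1 + lam) := by
      rw [show 1 + 1 + lam = (1 + lam) + 1 by ring, Real.Gamma_add_one (by intro; linarith)]
    have g5 : 1 + lam ≠ 0 := by intro; linarith
    rw [e4, add_comm 1 lam] at *
    rw [show (1 : ℝ) + 1 = 2 by norm_num, Real.Gamma_two]
    apply mul_left_cancel₀ h0
    rw [h1]
    have hpi : √Real.pi * √Real.pi = Real.pi := Real.mul_self_sqrt Real.pi_pos.le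
    generalize Real.Gamma (1 + 2 * lam) = G3 at *
    generalize Real.Gamma (lam + 1 / 2) = G1 at *
    generalize Real.Gamma (lam + 1) = G2 at *
    generalize (2 : ℝ) ^ (2 * lam) = t at *
    field_simp at h4 ⊢
    linear_combination √Real.pi * h4 + G3 * hpi
  | succ n hn ih =>
    have hn' : (1 : ℝ) ≤ n := by exact_mod_cast hn
    have h1 := hb (n + 1)
    rw [chebMoment_self_succ hl hn, ← hb n, ih, rising_succ] at h1
    have g1 : rising lam n ≠ 0 := rising_ne_zero hl h0 n
    have g2 : lam + n ≠ 0 := by intro; linarith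
    have e1 : Real.Gamma ((n : ℝ) + 1 + 1) = (n + 1) * Real.Gamma (n + 1) :=
      Real.Gamma_add_one (by intro; linarith)
    have e2 : Real.Gamma ((n : ℝ) + 1 + 2 * lam) = (n + 2 * lam) * Real.Gamma (n + 2 * lam) := by
      rw [← Real.Gamma_add_one (by intro; linarith)]; congr 1; ring
    have e3 : Real.Gamma ((n : ℝ) + 1 + 1 + lam) = (n + 1 + lam) * Real.Gamma (n + 1 + lam) := by
      rw [← Real.Gamma_add_one (by intro; linarith)]; congr 1; ring
    have e4 : Real.Gamma ((n : ℝ) + 1 + lam) = (n + lam) * Real.Gamma (n + lam) := by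
      rw [← Real.Gamma_add_one (by intro; linarith)]; congr 1; ring
    have g3 := Real.Gamma_pos_of_pos (by linarith : 0 < n + lam)
    have g4 : (0 : ℝ) < 2 ^ (2 * lam) := Real.rpow_pos_of_pos two_pos _
    have g5 : (n : ℝ) + 1 + lam ≠ 0 := by intro; linarith
    have g6 : (n : ℝ) + 1 ≠ 0 := by intro; linarith
    have g7 : (n : ℝ) + lam ≠ 0 := by intro; linarith
    push_cast
    push_cast at h1
    rw [e1, e2, e3]
    rw [e4] at h1 ⊢
    apply mul_left_cancel₀ (mul_ne_zero (div_ne_zero g2 g6) g1)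
    rw [h1]
    field_simp
    ring

/-- Log-convexity of Gamma: among pairs of arguments with a fixed sum, the outer pair has the larger
product. -/
theorem Gamma_mul_Gamma_le {u v x y : ℝ} (hu : 0 < u) (hx : u ≤ x) (hxv : x ≤ v)
    (h : x + y = u + v) : Real.Gamma x * Real.Gamma y ≤ Real.Gamma u * Real.Gamma v := by
  rcases hx.eq_or_lt with rfl | hux
  · rw [show y = v by linarith]
  rcases hxv.eq_or_lt with rfl | hxv'
  · rw [show y = u by linarith, mul_comm]
  have hv : 0 < v := by linarith
  have huv : 0 < v - u := by linarith
  set a := (v - x) / (v - u) with ha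
  set b := (x - u) / (v - u) with hb
  have ha0 : 0 < a := div_pos (by linarith) huv
  have hb0 : 0 < b := div_pos (by linarith) huv
  have hab : a + b = 1 := by rw [ha, hb]; field_simp; ring
  have hx' : x = a * u + b * v := by rw [ha, hb]; field_simp; ring
  have hy' : y = b * u + a * v := by
    have : y = u + v - x := by linarith
    rw [this, ha, hb]; field_simp; ring
  have h1 := Real.Gamma_mul_add_mul_le_rpow_Gamma_mul_rpow_Gamma hu hv ha0 hb0 hab
  have h2 := Real.Gamma_mul_add_mul_le_rpow_Gamma_mul_rpow_Gamma hu hv hb0 ha0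
    (by rw [add_comm]; exact hab)
  rw [← hx'] at h1
  rw [← hy'] at h2
  have gu := Real.Gamma_pos_of_pos hu
  have gv := Real.Gamma_pos_of_pos hv
  have hy0 : 0 < y := by linarith
  calc Real.Gamma x * Real.Gamma y
      ≤ (Real.Gamma u ^ a * Real.Gamma v ^ b) * (Real.Gamma u ^ b * Real.Gamma v ^ a) :=
        mul_le_mul h1 h2 (Real.Gamma_pos_of_pos hy0).le (by positivity)
    _ = (Real.Gamma u ^ a * Real.Gamma u ^ b) * (Real.Gamma v ^ b * Real.Gamma v ^ a) := by ring
    _ = Real.Gamma u * Real.Gamma v := by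
      rw [← Real.rpow_add gu, ← Real.rpow_add gv, hab, add_comm b a, hab, Real.rpow_one,
        Real.rpow_one]

theorem one_add_div_mul_le {K₁ K₂ : ℝ} (h1 : 0 ≤ K₁) (h2 : 0 ≤ K₂) {n : ℕ} (hn : 1 ≤ n) :
    (1 + K₁ / n) * (1 + K₂ / n) ≤ 1 + (K₁ + K₂ + K₁ * K₂) / n := by
  have hn' : (1 : ℝ) ≤ n := by exact_mod_cast hn
  have : K₁ * K₂ / (n * n) ≤ K₁ * K₂ / n :=
    div_le_div_of_nonneg_left (by positivity) (by positivity) (by nlinarith)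
  calc (1 + K₁ / n) * (1 + K₂ / n) = 1 + K₁ / n + K₂ / n + K₁ * K₂ / (n * n) := by
        field_simp; ring
    _ ≤ 1 + K₁ / n + K₂ / n + K₁ * K₂ / n := by linarith
    _ = _ := by field_simp; ring

/-- Moving one unit between the arguments costs the factor `(n + 2 lam - k - 1) / (n + 1 + k) ≤ 1 +
2 lam / n`. -/
theorem exists_Gamma_shift_le {lam : ℝ} (k : ℕ) (hk : (k : ℝ) ≤ lam) :
    ∃ K : ℝ, 0 ≤ K ∧ ∀ n : ℕ, 1 ≤ n → Real.Gamma (n + 1) * Real.Gamma (n + 2 * lam) ≤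
      (1 + K / n) * (Real.Gamma (n + 1 + k) * Real.Gamma (n + 2 * lam - k)) := by
  induction k with
  | zero => exact ⟨0, le_rfl, fun n _ => by simp⟩
  | succ k ih =>
    push_cast at hk
    obtain ⟨K, hK, h⟩ := ih (by linarith)
    have hk0 : (0 : ℝ) ≤ k := by positivity
    have hl0 : 0 ≤ 2 * lam := by linarith
    refine ⟨K + 2 * lam + K * (2 * lam), by positivity, fun n hn => (h n hn).trans ?_⟩
    have hn' : (1 : ℝ) ≤ n := by exact_mod_cast hn
    have e1 : Real.Gamma ((n : ℝ) + 1 + (k + 1 : ℕ)) = (n + 1 + k) * Real.Gamma (n + 1 + k) := by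
      rw [← Real.Gamma_add_one (by intro; linarith)]; congr 1; push_cast; ring
    have e2 : Real.Gamma ((n : ℝ) + 2 * lam - k) =
        (n + 2 * lam - (k + 1)) * Real.Gamma (n + 2 * lam - (k + 1 : ℕ)) := by
      rw [← Nat.cast_succ, ← Real.Gamma_add_one]
      · congr 1; push_cast; ring
      · push_cast; intro; linarith
    have g1 := Real.Gamma_pos_of_pos (by linarith : 0 < (n : ℝ) + 1 + k)
    have g2 : 0 < Real.Gamma (n + 2 * lam - (k + 1 : ℕ)) :=
      Real.Gamma_pos_of_pos (by push_cast; linarith)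
    have hr : (n : ℝ) + 2 * lam - (k + 1) ≤ (1 + 2 * lam / n) * (n + 1 + k) := by
      have : (1 + 2 * lam / n) * (n + 1 + k) = n + 1 + k + 2 * lam + 2 * lam / n * (1 + k) := by
        field_simp; ring
      rw [this]
      have : 0 ≤ 2 * lam / n * (1 + k) := by positivity
      linarith
    rw [e1, e2]
    calc (1 + K / n) * (Real.Gamma (n + 1 + k) *
          ((n + 2 * lam - (k + 1)) * Real.Gamma (n + 2 * lam - (k + 1 : ℕ))))
        ≤ (1 + K / n) * (Real.Gamma (n + 1 + k) *
          (((1 + 2 * lam / n) * (n + 1 + k)) * Real.Gamma (n + 2 * lam - (k + 1 : ℕ)))) := by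
          gcongr
      _ = ((1 + K / n) * (1 + 2 * lam / n)) * ((n + 1 + k) * Real.Gamma (n + 1 + k) *
          Real.Gamma (n + 2 * lam - (k + 1 : ℕ))) := by ring
      _ ≤ _ := by
        gcongr
        exact one_add_div_mul_le hK hl0 hn

/-- An integer shift brings both arguments into `[n + lam, n + 1 + lam]`, where log-convexity
applies. For `lam ≥ 0` the shift is by `⌊lam⌋`; for `lam < 0` one unit goes the other way. -/
theorem exists_Gamma_quotient_le {lam : ℝ} (hl : -1 / 2 < lam) :
    ∃ K : ℝ, 0 ≤ K ∧ ∀ n : ℕ, 1 ≤ n → Real.Gamma (n + 1) * Real.Gamma (n + 2 * lam) ≤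
      (1 + K / n) * (Real.Gamma (n + 1 + lam) * Real.Gamma (n + lam)) := by
  rcases le_or_gt 0 lam with h0 | h0
  · have hfl := Nat.floor_le h0
    have hfl' := Nat.lt_floor_add_one lam
    obtain ⟨K, hK, h⟩ := exists_Gamma_shift_le ⌊lam⌋₊ hfl
    refine ⟨K, hK, fun n hn => (h n hn).trans ?_⟩
    have hn' : (1 : ℝ) ≤ n := by exact_mod_cast hn
    refine mul_le_mul_of_nonneg_left ?_ (by positivity)
    rw [mul_comm (Real.Gamma (n + 1 + lam)), mul_comm (Real.Gamma (n + 1 + _))]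
    exact Gamma_mul_Gamma_le (by linarith) (by linarith) (by linarith) (by ring)
  -- The shift costs `n / (n + 2 lam) = 1 - 2 lam / (n + 2 lam)`, and `n + 2 lam ≥ (1 + 2 lam) n`.
  · refine ⟨-2 * lam / (1 + 2 * lam), div_nonneg (by linarith) (by linarith), fun n hn => ?_⟩
    have hn' : (1 : ℝ) ≤ n := by exact_mod_cast hn
    have e1 : Real.Gamma ((n : ℝ) + 1) = n * Real.Gamma n :=
      Real.Gamma_add_one (by intro; linarith)
    have e2 : Real.Gamma ((n : ℝ) + 2 * lam + 1) = (n + 2 * lam) * Real.Gamma (n + 2 * lam) :=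
      Real.Gamma_add_one (by intro; linarith)
    have h3 : Real.Gamma n * Real.Gamma (n + 2 * lam + 1) ≤
        Real.Gamma (n + lam) * Real.Gamma (n + 1 + lam) :=
      Gamma_mul_Gamma_le (by linarith) (by linarith) (by linarith) (by ring)
    have hp : 0 < (n : ℝ) + 2 * lam := by linarith
    have hp1 : 0 < 1 + 2 * lam := by linarith
    have hr : (n : ℝ) / (n + 2 * lam) ≤ 1 + -2 * lam / (1 + 2 * lam) / n := by
      rw [div_le_iff₀ hp, div_div, ← sub_nonneg]
      have : (1 + -2 * lam / ((1 + 2 * lam) * n)) * (n + 2 * lam) - n =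
          (4 * lam ^ 2 * (n - 1)) / ((1 + 2 * lam) * n) := by
        field_simp; ring
      rw [this]
      exact div_nonneg (mul_nonneg (by positivity) (by linarith)) (by positivity)
    have g1 := Real.Gamma_pos_of_pos (by linarith : 0 < (n : ℝ) + lam)
    have g2 := Real.Gamma_pos_of_pos (by linarith : 0 < (n : ℝ) + 1 + lam)
    calc Real.Gamma (n + 1) * Real.Gamma (n + 2 * lam)
        = n / (n + 2 * lam) * (Real.Gamma n * Real.Gamma (n + 2 * lam + 1)) := by
          rw [e1, e2]; field_simp
      _ ≤ n / (n + 2 * lam) * (Real.Gamma (n + lam) * Real.Gamma (n + 1 + lam)) := by gcongr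
      _ ≤ (1 + -2 * lam / (1 + 2 * lam) / n) *
          (Real.Gamma (n + lam) * Real.Gamma (n + 1 + lam)) := by gcongr
      _ = _ := by rw [mul_comm (Real.Gamma (n + lam))]

theorem exists_polyRem_T_two_mul_le {lam : ℝ} (hl : -1 / 2 < lam) (h0 : lam ≠ 0) :
    ∃ K : ℝ, 0 ≤ K ∧ ∀ n : ℕ, 1 ≤ n →
      0 < polyRem lam n (Chebyshev.T ℝ (2 * n)) ∧
      polyRem lam n (Chebyshev.T ℝ (2 * n)) ≤ Real.pi / 2 ^ (2 * lam) * (1 + K / n) := by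
  obtain ⟨K, hK, h⟩ := exists_Gamma_quotient_le hl
  refine ⟨K, hK, fun n hn => ?_⟩
  have hn' : (1 : ℝ) ≤ n := by exact_mod_cast hn
  have g1 := Real.Gamma_pos_of_pos (by linarith : 0 < (n : ℝ) + lam)
  have g2 := Real.Gamma_pos_of_pos (by linarith : 0 < (n : ℝ) + 1 + lam)
  have g3 := Real.Gamma_pos_of_pos (by linarith : 0 < (n : ℝ) + 1)
  have g4 := Real.Gamma_pos_of_pos (by linarith : 0 < (n : ℝ) + 2 * lam)
  have g5 : (0 : ℝ) < 2 ^ (2 * lam) := Real.rpow_pos_of_pos two_pos _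
  have := Real.pi_pos
  rw [polyRem_T_two_mul_eq hl h0 hn]
  refine ⟨by positivity, ?_⟩
  gcongr
  rw [div_le_iff₀ (by positivity)]
  exact h n hn

/-! ### Convergence of the normalized coefficients, with rate `1/n` -/

/-- The ratio of consecutive coefficients is at most `mu` from index `L` on, and at most `1 + |lam|`
before. Any `mu > 1` is affordable, since later sums are over powers of a fixed `r₀ < 1`. -/
theorem abs_rising_le {lam mu : ℝ} (hmu : 1 < mu) :
    ∃ C : ℝ, 0 ≤ C ∧ ∀ k, |rising lam k| ≤ C * mu ^ k := by
  obtain ⟨L, hL⟩ := exists_nat_ge (|lam| / (mu - 1))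
  set B := 1 + |lam| with hB
  have hB1 : 1 ≤ B := by rw [hB]; linarith [abs_nonneg lam]
  have key : ∀ k, |rising lam k| ≤ B ^ min k L * mu ^ k := by
    intro k
    induction k with
    | zero => simp
    | succ k ih =>
      have hk : (0 : ℝ) ≤ k := by positivity
      have hk1 : (0 : ℝ) < (k : ℝ) + 1 := by positivity
      have habs : |lam + k| ≤ |lam| + k := by
        simpa [abs_of_nonneg hk] using abs_add_le lam (k : ℝ)
      rw [rising_succ, abs_mul, abs_div, abs_of_pos hk1]
      by_cases hkL : L ≤ k
      · have h1 : |lam + k| / (k + 1) ≤ mu := by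
          rw [div_le_iff₀ hk1]
          have hLk : (L : ℝ) ≤ k := by exact_mod_cast hkL
          have : |lam| ≤ k * (mu - 1) := by
            rw [div_le_iff₀ (by linarith)] at hL
            nlinarith
          linarith
        rw [show min (k + 1) L = min k L by omega, pow_succ]
        calc _ ≤ mu * (B ^ min k L * mu ^ k) := by gcongr
          _ = _ := by ring
      · have h1 : |lam + k| / (k + 1) ≤ B := by
          rw [div_le_iff₀ hk1, hB]
          nlinarith [abs_nonneg lam]
        rw [show min (k + 1) L = min k L + 1 by omega, pow_succ B, pow_succ mu]
        calc _ ≤ B * (B ^ min k L * mu ^ k) := by gcongr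
          _ ≤ B * (B ^ min k L * (mu ^ k * mu)) := by
            gcongr
            exact le_mul_of_one_le_right (by positivity) hmu.le
          _ = _ := by ring
  refine ⟨B ^ L, by positivity, fun k => (key k).trans ?_⟩
  gcongr
  exact min_le_right _ _

theorem abs_add_nat_ge {lam : ℝ} (hl : -1 / 2 < lam) (h0 : lam ≠ 0) (m : ℕ) :
    (m : ℝ) + 1 ≤ max 4 |lam|⁻¹ * |lam + m| := by
  rcases m with _ | m
  · have h1 : |lam|⁻¹ * |lam| = 1 := inv_mul_cancel₀ (abs_ne_zero.2 h0)
    simp only [Nat.cast_zero, zero_add, add_zero]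
    calc (1 : ℝ) = |lam|⁻¹ * |lam| := h1.symm
      _ ≤ _ := by gcongr; exact le_max_right _ _
  · push_cast
    have hm : (0 : ℝ) ≤ m := by positivity
    calc (m : ℝ) + 1 + 1 ≤ 4 * |lam + (m + 1)| := by
          rw [abs_of_pos (by linarith)]; linarith
      _ ≤ _ := by gcongr; exact le_max_left _ _

/-- `|rising lam m| mu^m` grows with `m` once `m ≥ L`; the factor `B^(min m L)` repairs the first
`L` steps and costs only a constant. -/
theorem rising_quotient_le {lam mu : ℝ} (hl : -1 / 2 < lam) (h0 : lam ≠ 0) (hmu : 1 < mu) :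
    ∃ C : ℝ, 0 ≤ C ∧ ∀ n i, i ≤ n → |rising lam (n - i)| ≤ C * mu ^ i * |rising lam n| := by
  obtain ⟨L, hL⟩ := exists_nat_ge ((1 + mu) / (mu - 1))
  set B := max 4 |lam|⁻¹ with hB
  have hB1 : 1 ≤ B := le_trans (by norm_num) (le_max_left _ _)
  have hmono : Monotone fun m => |rising lam m| * mu ^ m * B ^ min m L := by
    refine monotone_nat_of_le_succ fun m => ?_
    have hm : (0 : ℝ) ≤ m := by positivity
    have h1 := abs_add_nat_ge hl h0 m
    have hm1 : (0 : ℝ) < (m : ℝ) + 1 := by positivity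
    rw [rising_succ, abs_mul, abs_div, abs_of_pos hm1]
    by_cases hmL : L ≤ m
    · rw [show min (m + 1) L = min m L by omega, pow_succ]
      have h2 : 1 ≤ |lam + m| / (m + 1) * mu := by
        rw [div_mul_eq_mul_div, le_div_iff₀ hm1]
        have hLk : (L : ℝ) ≤ m := by exact_mod_cast hmL
        have h3 : 1 + mu ≤ m * (mu - 1) := by
          rw [div_le_iff₀ (by linarith)] at hL
          nlinarith
        nlinarith [le_abs_self (lam + m)]
      calc _ = 1 * (|rising lam m| * mu ^ m * B ^ min m L) := by ring
        _ ≤ (|lam + m| / (m + 1) * mu) * (|rising lam m| * mu ^ m * B ^ min m L) := by gcongr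
        _ = _ := by ring
    · rw [show min (m + 1) L = min m L + 1 by omega, pow_succ B, pow_succ mu]
      have h2 : 1 ≤ |lam + m| / (m + 1) * B := by
        rw [div_mul_eq_mul_div, le_div_iff₀ hm1]
        linarith
      calc _ = 1 * 1 * (|rising lam m| * mu ^ m * B ^ min m L) := by ring
        _ ≤ (|lam + m| / (m + 1) * B) * mu * (|rising lam m| * mu ^ m * B ^ min m L) := by
          gcongr
        _ = _ := by ring
  refine ⟨B ^ L, by positivity, fun n i hi => ?_⟩
  have h1 := hmono (Nat.sub_le n i)
  simp only at h1
  have hmu0 : 0 < mu ^ (n - i) := by positivity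
  have h2 : |rising lam (n - i)| * mu ^ (n - i) ≤ |rising lam (n - i)| * mu ^ (n - i) *
      B ^ min (n - i) L := le_mul_of_one_le_right (by positivity) (one_le_pow₀ hB1)
  have h3 : |rising lam n| * mu ^ n * B ^ min n L ≤ |rising lam n| * mu ^ n * B ^ L := by
    gcongr
    exact min_le_right _ _
  have h4 : mu ^ n = mu ^ i * mu ^ (n - i) := by rw [← pow_add]; congr 1; omega
  rw [h4] at h1 h3
  refine le_of_mul_le_mul_right ?_ hmu0
  calc _ ≤ _ := h2.trans (h1.trans h3)
    _ = _ := by ring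

/-- Coefficientwise, `p_n` normalized by `rising lam n` approaches the series of `(1 - y)^(-lam)`.
Going from `i` to `i + 1`, with `m = n - i - 1`, multiplies `rising lam (n - i)` by `1 + (1 - lam) /
(lam + m)`, and `1 / |lam + m|` is at most a constant times `(i + 1) / n`. -/
theorem gegenCoeff_sub_le {lam mu : ℝ} (hl : -1 / 2 < lam) (h0 : lam ≠ 0) (hmu : 1 < mu) :
    ∃ K : ℝ, 0 ≤ K ∧ ∀ n i, 1 ≤ n → |gegenCoeff lam n i / rising lam n - rising lam i| ≤
      K * (((i : ℝ) + 1) ^ 2 * (mu * mu) ^ i) / n := by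
  obtain ⟨C₁, hC₁, h1⟩ := abs_rising_le (lam := lam) hmu
  obtain ⟨C₂, hC₂, h2⟩ := rising_quotient_le hl h0 hmu
  set B := max 4 |lam|⁻¹ with hB
  have hB1 : 1 ≤ B := le_trans (by norm_num) (le_max_left _ _)
  set D := C₂ * |1 - lam| * B with hD
  have hD0 : 0 ≤ D := by positivity
  have hρ : ∀ n i, 1 ≤ n → i ≤ n →
      |rising lam (n - i) / rising lam n - 1| ≤ D * (i : ℝ) ^ 2 * mu ^ i / n := by
    intro n i hn
    have hn' : (0 : ℝ) < n := by exact_mod_cast hn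
    have hg := rising_ne_zero hl h0 n
    induction i with
    | zero => intro _; simp [hg]
    | succ i ih =>
      intro hi
      have h3 := ih (by omega)
      obtain ⟨m, rfl⟩ : ∃ m, n = m + (i + 1) := ⟨n - (i + 1), by omega⟩
      rw [show m + (i + 1) - i = m + 1 by omega] at h3
      rw [show m + (i + 1) - (i + 1) = m by omega]
      have h4 := h2 (m + (i + 1)) i (by omega)
      rw [show m + (i + 1) - i = m + 1 by omega] at h4
      have h5 := abs_add_nat_ge hl h0 m
      have hm : (0 : ℝ) ≤ m := by positivity
      have hi0 : (0 : ℝ) ≤ i := by positivity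
      have hlm : 0 < |lam + m| := by
        rcases (abs_nonneg (lam + m)).eq_or_lt with h | h
        · rw [← h] at h5; linarith
        · exact h
      set N : ℝ := ((m + (i + 1) : ℕ) : ℝ) with hN
      have hNe : N = m + (i + 1) := by rw [hN]; push_cast; ring
      have e1 : rising lam m = (m + 1) / (lam + m) * rising lam (m + 1) := by
        rw [rising_succ]
        have := abs_pos.1 hlm
        field_simp
      have e2 : rising lam m / rising lam (m + (i + 1)) - 1 =
          (rising lam (m + 1) / rising lam (m + (i + 1)) - 1) +
          (1 - lam) / (lam + m) * (rising lam (m + 1) / rising lam (m + (i + 1))) := by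
        rw [e1]
        have := abs_pos.1 hlm
        field_simp
        ring
      have h6 : |rising lam (m + 1) / rising lam (m + (i + 1))| ≤ C₂ * mu ^ i := by
        rw [abs_div, div_le_iff₀ (abs_pos.2 hg)]
        exact h4
      have h7 : 1 / |lam + m| ≤ B * ((i + 1) / N) := by
        have hm1 : (0 : ℝ) < (m : ℝ) + 1 := by positivity
        have h8 : 1 / |lam + m| ≤ B / (m + 1) := by
          rw [div_le_div_iff₀ hlm hm1]; linarith
        have h9 : 1 / ((m : ℝ) + 1) ≤ (i + 1) / N := by
          rw [div_le_div_iff₀ hm1 hn', hNe]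
          nlinarith
        calc _ ≤ B * (1 / (m + 1)) := by rw [mul_one_div]; exact h8
          _ ≤ _ := by gcongr
      rw [e2]
      calc _ ≤ _ := abs_add_le _ _
        _ ≤ D * (i : ℝ) ^ 2 * mu ^ i / N +
            |1 - lam| * (B * ((i + 1) / N)) * (C₂ * mu ^ i) := by
          refine add_le_add h3 ?_
          rw [abs_mul, abs_div, div_eq_mul_one_div]
          gcongr
        _ = D * ((i : ℝ) ^ 2 + (i + 1)) * mu ^ i / N := by rw [hD]; ring
        _ ≤ D * ((i + 1 : ℕ) : ℝ) ^ 2 * mu ^ (i + 1) / N := by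
          have hp : mu ^ i ≤ mu ^ (i + 1) := pow_le_pow_right₀ hmu.le (by omega)
          have hq : (i : ℝ) ^ 2 + (i + 1) ≤ ((i + 1 : ℕ) : ℝ) ^ 2 := by push_cast; nlinarith
          gcongr
  refine ⟨C₁ * D + C₁, by positivity, fun n i hn => ?_⟩
  have hn' : (0 : ℝ) < n := by exact_mod_cast hn
  have hg := rising_ne_zero hl h0 n
  have hi0 : (0 : ℝ) ≤ i := by positivity
  have hmi : mu ^ i ≤ (mu * mu) ^ i := by
    rw [mul_pow]; exact le_mul_of_one_le_left (by positivity) (one_le_pow₀ hmu.le)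
  rw [gegenCoeff]
  split_ifs with hin
  · have e : rising lam i * rising lam (n - i) / rising lam n - rising lam i =
        rising lam i * (rising lam (n - i) / rising lam n - 1) := by ring
    rw [e, abs_mul]
    calc _ ≤ (C₁ * mu ^ i) * (D * (i : ℝ) ^ 2 * mu ^ i / n) :=
          mul_le_mul (h1 i) (hρ n i hn hin) (abs_nonneg _) (by positivity)
      _ = C₁ * D * ((i : ℝ) ^ 2 * (mu * mu) ^ i) / n := by rw [mul_pow]; ring
      _ ≤ (C₁ * D + C₁) * (((i : ℝ) + 1) ^ 2 * (mu * mu) ^ i) / n := by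
        gcongr <;> linarith
  · rw [zero_div, zero_sub, abs_neg]
    -- Past the degree the error is `rising lam i` itself, and the factor `1/n` is paid for by `i /
    -- n ≥ 1`.
    have hni : (n : ℝ) ≤ i := by exact_mod_cast (not_le.1 hin).le
    calc _ ≤ C₁ * mu ^ i := h1 i
      _ = C₁ * (n * mu ^ i) / n := by field_simp
      _ ≤ (C₁ * D + C₁) * (((i : ℝ) + 1) ^ 2 * (mu * mu) ^ i) / n := by
        have : 0 ≤ C₁ * D := by positivity
        gcongr
        · linarith
        · nlinarith

theorem chebMoment_eq_prod {lam : ℝ} (hl : -1 / 2 < lam) {n : ℕ} (hn : 1 ≤ n) (l : ℕ) :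
    chebMoment lam n (n + 2 * l) = chebMoment lam n n * rising (-lam) l *
      ∏ i ∈ Finset.range l,
        (((n : ℝ) + 2 * i + 2) / (n + 2 * i) * ((n + i) / (n + i + 1 + lam))) := by
  induction l with
  | zero => simp
  | succ l ih =>
    rw [chebMoment_add_two hl hn, ih, Finset.prod_range_succ, rising_succ]
    ring

theorem abs_prod_sub_one_le {c : ℕ → ℝ} {d mu : ℝ} (hmu : 1 ≤ mu) (hd : 1 + d ≤ mu)
    (hc : ∀ i, |c i - 1| ≤ d) (l : ℕ) :
    |∏ i ∈ Finset.range l, c i - 1| ≤ d * (l * mu ^ l) := by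
  induction l with
  | zero => simp
  | succ l ih =>
    have hd0 : 0 ≤ d := (abs_nonneg _).trans (hc 0)
    have hcl : |c l| ≤ mu := by
      have := abs_add_le (c l - 1) 1
      rw [sub_add_cancel, abs_one] at this
      linarith [hc l]
    have e : ∏ i ∈ Finset.range (l + 1), c i - 1 =
        (∏ i ∈ Finset.range l, c i - 1) * c l + (c l - 1) := by
      rw [Finset.prod_range_succ]; ring
    rw [e]
    calc _ ≤ _ := abs_add_le _ _
      _ ≤ (d * (l * mu ^ l)) * mu + d * 1 := by
        rw [abs_mul]
        have := hc l
        rw [mul_one]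
        gcongr
      _ ≤ (d * (l * mu ^ l)) * mu + d * mu ^ (l + 1) := by
        gcongr
        exact one_le_pow₀ hmu
      _ = _ := by push_cast; ring

/-- Each factor of the product formula lies within `(3 + lam) / n` of `1`, and `N` makes it at most
`mu`. One `mu ^ l` comes from the product, the other from `rising (-lam) l`. -/
theorem chebMoment_quotient_sub_le {lam mu : ℝ} (hl : -1 / 2 < lam) (hmu : 1 < mu) :
    ∃ K : ℝ, 0 ≤ K ∧ ∃ N : ℕ, ∀ n l : ℕ, 1 ≤ n → N ≤ n →
      |chebMoment lam n (n + 2 * l) - chebMoment lam n n * rising (-lam) l| ≤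
        |chebMoment lam n n| * (K * (((l : ℝ) + 1) ^ 2 * (mu * mu) ^ l) / n) := by
  obtain ⟨C, hC, h1⟩ := abs_rising_le (lam := -lam) hmu
  obtain ⟨N, hN⟩ := exists_nat_ge ((3 + lam) / (mu - 1))
  refine ⟨C * (3 + lam), mul_nonneg hC (by linarith), N, fun n l hn hNn => ?_⟩
  have hn' : (1 : ℝ) ≤ n := by exact_mod_cast hn
  have hl0 : (0 : ℝ) ≤ l := by positivity
  have hd : 1 + (3 + lam) / n ≤ mu := by
    have hN' : (N : ℝ) ≤ n := by exact_mod_cast hNn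
    rw [div_le_iff₀ (by linarith)] at hN
    have : (3 + lam) / n ≤ mu - 1 := by
      rw [div_le_iff₀ (by linarith)]
      nlinarith
    linarith
  have hc : ∀ i : ℕ, |((n : ℝ) + 2 * i + 2) / (n + 2 * i) * ((n + i) / (n + i + 1 + lam)) - 1| ≤
      (3 + lam) / n := by
    intro i
    have hi0 : (0 : ℝ) ≤ i := by positivity
    have p1 : 0 < (n : ℝ) + 2 * i := by linarith
    have p2 : 0 < (n : ℝ) + i + 1 + lam := by linarith
    have e : ((n : ℝ) + 2 * i + 2) / (n + 2 * i) * ((n + i) / (n + i + 1 + lam)) - 1 =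
        (2 * (n + i) - (1 + lam) * (n + 2 * i)) / ((n + 2 * i) * (n + i + 1 + lam)) := by
      field_simp
      ring
    rw [e, abs_div, abs_of_pos (mul_pos p1 p2), div_le_div_iff₀ (mul_pos p1 p2) (by linarith)]
    have h2 : |2 * ((n : ℝ) + i) - (1 + lam) * (n + 2 * i)| ≤ (3 + lam) * (n + 2 * i) := by
      rw [abs_le]
      constructor <;> nlinarith
    calc _ ≤ (3 + lam) * ((n : ℝ) + 2 * i) * n := by gcongr
      _ ≤ (3 + lam) * ((n : ℝ) + 2 * i) * (n + i + 1 + lam) := by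
        have : 0 ≤ 3 + lam := by linarith
        gcongr
        linarith
      _ = _ := by ring
  have h3 := abs_prod_sub_one_le hmu.le hd hc l
  rw [chebMoment_eq_prod hl hn]
  set P := ∏ i ∈ Finset.range l,
    (((n : ℝ) + 2 * i + 2) / (n + 2 * i) * ((n + i) / (n + i + 1 + lam)))
  have e : chebMoment lam n n * rising (-lam) l * P - chebMoment lam n n * rising (-lam) l =
      chebMoment lam n n * (rising (-lam) l * (P - 1)) := by ring
  have p0 : 0 ≤ (3 + lam) / (n : ℝ) := div_nonneg (by linarith) (by linarith)
  rw [e, abs_mul, abs_mul]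
  gcongr
  calc _ ≤ (C * mu ^ l) * ((3 + lam) / n * (l * mu ^ l)) :=
        mul_le_mul (h1 l) h3 (abs_nonneg _) (by positivity)
    _ = C * ((3 + lam) / n) * (l * (mu * mu) ^ l) := by rw [mul_pow]; ring
    _ ≤ C * ((3 + lam) / n) * (((l : ℝ) + 1) ^ 2 * (mu * mu) ^ l) := by
      gcongr
      nlinarith
    _ = _ := by ring

/-! ### The generating function of the Chebyshev remainders -/

theorem rising_eq_choose (lam : ℝ) (k : ℕ) :
    rising lam k = (-1) ^ k * Ring.choose (-lam) k := by
  induction k with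
  | zero => simp
  | succ k ih =>
    have h1 := succ_mul_rising_succ lam k
    have h2 := add_one_mul_choose_add_one (-lam) k
    have : ((k : ℝ) + 1) ≠ 0 := by positivity
    apply mul_left_cancel₀ this
    rw [h1, ih, pow_succ]
    linear_combination (-1 : ℝ) ^ k * h2

theorem hasSum_rising_mul_pow (lam : ℝ) {y : ℂ} (hy : ‖y‖ < 1) :
    HasSum (fun i => (rising lam i : ℂ) * y ^ i) ((1 - y) ^ (-(lam : ℂ))) := by
  have h := (Complex.one_add_cpow_hasFPowerSeriesOnBall_zero (a := -(lam : ℂ))).hasSum (y := -y)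
    (by simpa [← ENNReal.ofReal_one, Metric.eball_ofReal] using hy)
  have e : ∀ i, (binomialSeries ℂ (-(lam : ℂ)) i) (fun _ => -y) =
      (rising lam i : ℂ) * y ^ i := fun i => by
    rw [rising_eq_choose, binomialSeries_apply, ← Complex.ofReal_neg, ← Complex.ofReal_choose]
    simp only [List.ofFn_const, List.prod_replicate, smul_eq_mul]
    push_cast
    rw [neg_pow y]
    ring
  simp only [e] at h
  rwa [zero_add, ← sub_eq_add_neg] at h

/-- The factor `(1 ± r) ^ lam` of the error bound. -/
def ellipseFactor (lam r : ℝ) : ℝ := if 0 < lam then (1 + r) ^ lam else (1 - r) ^ lam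

theorem one_le_ellipseFactor (lam : ℝ) {r : ℝ} (hr : 0 ≤ r) (hr1 : r < 1) :
    1 ≤ ellipseFactor lam r := by
  rw [ellipseFactor]
  split_ifs with h
  · exact Real.one_le_rpow (by linarith) h.le
  · exact Real.one_le_rpow_of_pos_of_le_one_of_nonpos (by linarith) (by linarith) (not_lt.1 h)

theorem ellipseFactor_le (lam : ℝ) {r r₀ : ℝ} (hr : 0 ≤ r) (hr1 : r ≤ r₀) (h1 : r₀ < 1) :
    ellipseFactor lam r ≤ ellipseFactor lam r₀ := by
  rw [ellipseFactor, ellipseFactor]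
  split_ifs with h
  · exact Real.rpow_le_rpow (by linarith) (by linarith) h.le
  · exact Real.rpow_le_rpow_of_nonpos (by linarith) (by linarith) (not_lt.1 h)

/-- The modulus is `|1 - y|^(-lam)` with `1 - |y| ≤ |1 - y| ≤ 1 + |y|`; the sign of `lam` decides
which side matters. This is the origin of the case distinction in the theorem. -/
theorem inv_ellipseFactor_le (lam : ℝ) {y : ℂ} (hy : ‖y‖ < 1) :
    (ellipseFactor lam ‖y‖)⁻¹ ≤ ‖(1 - y) ^ (-(lam : ℂ))‖ := by
  have h1 : ‖1 - y‖ ≤ 1 + ‖y‖ := by simpa using norm_sub_le 1 y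
  have h2 : 1 - ‖y‖ ≤ ‖1 - y‖ := by simpa using norm_sub_norm_le 1 y
  have h3 : 0 < ‖1 - y‖ := by linarith
  rw [← Complex.ofReal_neg, Complex.norm_cpow_real, ellipseFactor]
  split_ifs with h
  · rw [Real.rpow_neg h3.le]
    gcongr
  · rw [← Real.rpow_neg (by linarith)]
    exact Real.rpow_le_rpow (by linarith) h2 (by linarith)

theorem abs_polyRem_T_le {lam : ℝ} (hl : -1 / 2 < lam) (h0 : lam ≠ 0) {n : ℕ} (hn : 1 ≤ n)
    (m : ℤ) : |polyRem lam n (Chebyshev.T ℝ m)| ≤ 2 * wInt lam 1 :=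
  abs_polyRem_le hl h0 n hn fun _ hx =>
    Chebyshev.abs_eval_T_real_le_one m (abs_le.2 ⟨hx.1, hx.2⟩)

theorem summable_norm_ofReal_mul_pow {c : ℕ → ℝ} {C : ℝ} (hc : ∀ i, |c i| ≤ C) {y : ℂ}
    (hy : ‖y‖ < 1) : Summable fun i => ‖(c i : ℂ) * y ^ i‖ := by
  refine Summable.of_nonneg_of_le (fun _ => norm_nonneg _) (fun i => ?_)
    ((summable_geometric_of_lt_one (norm_nonneg y) hy).mul_left C)
  rw [norm_mul, norm_pow, Complex.norm_real, Real.norm_eq_abs]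
  exact mul_le_mul_of_nonneg_right (hc i) (by positivity)

/-- The generating function of the remainders of the Chebyshev polynomials is the quotient of the
generating functions of the Chebyshev moments and the Chebyshev coefficients of `p_n`. -/
theorem tsum_gegenCoeff_mul_tsum_polyRem {lam : ℝ} (hl : -1 / 2 < lam) (h0 : lam ≠ 0) {n : ℕ}
    (hn : 1 ≤ n) {y : ℂ} (hy : ‖y‖ < 1) :
    (∑' i, (gegenCoeff lam n i : ℂ) * y ^ i) *
      (∑' l : ℕ, (polyRem lam n (Chebyshev.T ℝ (2 * n + 2 * l)) : ℂ) * y ^ l) =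
      ∑' l : ℕ, (chebMoment lam n (n + 2 * l) : ℂ) * y ^ l := by
  have s1 : Summable fun i => ‖(gegenCoeff lam n i : ℂ) * y ^ i‖ := by
    refine summable_of_ne_finset_zero (s := Finset.range (n + 1)) fun i hi => ?_
    rw [gegenCoeff, if_neg (by simpa using hi)]
    simp
  have s2 : Summable fun l : ℕ =>
      ‖(polyRem lam n (Chebyshev.T ℝ (2 * n + 2 * l)) : ℂ) * y ^ l‖ :=
    summable_norm_ofReal_mul_pow
      (c := fun l : ℕ => polyRem lam n (Chebyshev.T ℝ (2 * n + 2 * l)))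
      (fun l => abs_polyRem_T_le hl h0 hn _) hy
  rw [tsum_mul_tsum_eq_tsum_sum_antidiagonal_of_summable_norm s1 s2]
  refine tsum_congr fun l => ?_
  rw [← sum_gegenCoeff_mul_polyRem_T hl h0, Complex.ofReal_sum, Finset.sum_mul]
  refine Finset.sum_congr rfl fun p hp => ?_
  rw [← Finset.HasAntidiagonal.mem_antidiagonal.1 hp, pow_add]
  push_cast
  ring

-- In `G ε = t`, `G` and `t` are replaced by their limits with errors `O(1/n)` uniform on `|y| ≤
-- r₀`. The limit of `G` stays away from zero there, so dividing is safe for large `n`; the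
-- numerator is bounded by absolute values of coefficients.
set_option maxHeartbeats 1000000 in
theorem exists_norm_tsum_polyRem_le {lam : ℝ} (hl : -1 / 2 < lam) (h0 : lam ≠ 0) {r₀ : ℝ}
    (hr0 : 0 < r₀) (hr1 : r₀ < 1) {A : ℝ} (hA : ∀ l, |rising (-lam) (l + 1)| ≤ A) :
    ∃ K : ℝ, 0 ≤ K ∧ ∃ N : ℕ, ∀ n : ℕ, 1 ≤ n → N ≤ n → ∀ y : ℂ, ‖y‖ ≤ r₀ →
      ‖∑' l : ℕ, (polyRem lam n (Chebyshev.T ℝ (2 * n + 2 * l)) : ℂ) * y ^ l‖ ≤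
        polyRem lam n (Chebyshev.T ℝ (2 * n)) * (1 + K / n) *
          (1 + A * (‖y‖ / (1 - ‖y‖))) * ellipseFactor lam ‖y‖ := by
  have hA0 : 0 ≤ A := (abs_nonneg _).trans (hA 0)
  -- The coefficient errors grow like `(mu * mu)^i`, which must still be summable against `r₀^i`.
  obtain ⟨mu, hmu1, hmu⟩ : ∃ mu : ℝ, 1 < mu ∧ mu * mu * r₀ < 1 := by
    have h1 : 1 < r₀⁻¹ := (one_lt_inv₀ hr0).2 hr1
    obtain ⟨t, ht1, ht2⟩ := exists_between h1
    refine ⟨√t, by rw [Real.lt_sqrt zero_le_one]; simpa using ht1, ?_⟩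
    rw [Real.mul_self_sqrt (by linarith)]
    calc t * r₀ < r₀⁻¹ * r₀ := by gcongr
      _ = 1 := inv_mul_cancel₀ hr0.ne'
  have hS : Summable fun i : ℕ => ((i : ℝ) + 1) ^ 2 * (mu * mu) ^ i * r₀ ^ i := by
    have hnn : 0 ≤ mu * mu * r₀ := by positivity
    have h1 : ∀ k : ℕ, Summable fun i : ℕ => (i : ℝ) ^ k * (mu * mu * r₀) ^ i := fun k =>
      summable_pow_mul_geometric_of_norm_lt_one k
        (by rwa [Real.norm_eq_abs, abs_of_nonneg hnn])
    have := ((h1 2).add ((h1 1).mul_left 2)).add (h1 0)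
    refine this.congr fun i => ?_
    rw [mul_pow (mu * mu)]
    ring
  set S := ∑' i : ℕ, ((i : ℝ) + 1) ^ 2 * (mu * mu) ^ i * r₀ ^ i with hSdef
  have hS0 : 0 ≤ S := tsum_nonneg fun i => by positivity
  obtain ⟨K₁, hK₁, h1⟩ := gegenCoeff_sub_le hl h0 hmu1
  obtain ⟨K₂, hK₂, N₂, h2⟩ := chebMoment_quotient_sub_le hl hmu1
  set w := ellipseFactor lam r₀ with hw
  have hw1 : 1 ≤ w := one_le_ellipseFactor lam hr0.le hr1
  -- Keeps the relative error `x` of the denominator at most `1/2`, so that `1 / (1 - x) ≤ 1 + 2x`.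
  obtain ⟨N₁, hN₁⟩ := exists_nat_ge (2 * K₁ * S * w)
  set a := K₂ * S with ha
  set b := 2 * (K₁ * S * w) with hb
  have ha0 : 0 ≤ a := by positivity
  have hb0 : 0 ≤ b := by positivity
  refine ⟨a + b + a * b, by positivity, max N₁ N₂, fun n hn hNn y hy => ?_⟩
  have hn' : (0 : ℝ) < n := by exact_mod_cast hn
  have hy1 : ‖y‖ < 1 := by linarith
  have hy0 := norm_nonneg y
  set r := ‖y‖ with hr
  have hg := rising_ne_zero hl h0 n
  set E₀ := polyRem lam n (Chebyshev.T ℝ (2 * n)) with hE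
  have hE0 : 0 < E₀ := by
    obtain ⟨_, _, h⟩ := exists_polyRem_T_two_mul_le hl h0
    exact (h n hn).1
  have ht0 := rising_mul_polyRem_T_two_mul hl h0 (n := n)
  rw [← hE] at ht0
  have hnorm : ∀ (c : ℝ) (i : ℕ), ‖(c : ℂ) * y ^ i‖ = |c| * r ^ i := fun c i => by
    rw [norm_mul, norm_pow, Complex.norm_real, Real.norm_eq_abs]
  -- comparison of a power series with its limit
  have hcomp : ∀ (K : ℝ) (c : ℕ → ℝ), 0 ≤ K →
      (∀ i : ℕ, |c i| ≤ K * (((i : ℝ) + 1) ^ 2 * (mu * mu) ^ i) / n) →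
      (Summable fun i => ‖(c i : ℂ) * y ^ i‖) ∧ ∑' i, ‖(c i : ℂ) * y ^ i‖ ≤ K * S / n := by
    intro K c hK hc
    have hle : ∀ i, ‖(c i : ℂ) * y ^ i‖ ≤
        K / n * (((i : ℝ) + 1) ^ 2 * (mu * mu) ^ i * r₀ ^ i) := by
      intro i
      rw [hnorm]
      calc _ ≤ K * (((i : ℝ) + 1) ^ 2 * (mu * mu) ^ i) / n * r₀ ^ i := by
            have := hc i
            gcongr
        _ = _ := by ring
    have hs := Summable.of_nonneg_of_le (fun _ => norm_nonneg _) hle (hS.mul_left (K / n))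
    refine ⟨hs, (hs.tsum_le_tsum hle (hS.mul_left (K / n))).trans (le_of_eq ?_)⟩
    rw [tsum_mul_left]
    ring
  -- the denominator
  have hG : (ellipseFactor lam r)⁻¹ - K₁ * S / n ≤
      ‖∑' i, ((gegenCoeff lam n i / rising lam n : ℝ) : ℂ) * y ^ i‖ := by
    obtain ⟨s1, b1⟩ := hcomp K₁ _ hK₁ fun i => h1 n i hn
    have hsum := hasSum_rising_mul_pow lam hy1
    have e : ∑' i, ((gegenCoeff lam n i / rising lam n : ℝ) : ℂ) * y ^ i =
        (1 - y) ^ (-(lam : ℂ)) +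
          ∑' i, ((gegenCoeff lam n i / rising lam n - rising lam i : ℝ) : ℂ) * y ^ i := by
      rw [← hsum.tsum_eq, ← hsum.summable.tsum_add s1.of_norm]
      refine tsum_congr fun i => ?_
      push_cast
      ring
    rw [e]
    have h3 := norm_tsum_le_tsum_norm s1
    have h4 := inv_ellipseFactor_le lam hy1
    have h5 := norm_sub_norm_le ((1 - y) ^ (-(lam : ℂ)))
      (-∑' i, ((gegenCoeff lam n i / rising lam n - rising lam i : ℝ) : ℂ) * y ^ i)
    rw [norm_neg, sub_neg_eq_add] at h5
    linarith
  -- the numerator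
  have hnum : ‖∑' l : ℕ, (chebMoment lam n (n + 2 * l) : ℂ) * y ^ l‖ ≤
      |rising lam n| * E₀ * (1 + A * (r / (1 - r)) + a / n) := by
    have hc : ∀ l : ℕ, |chebMoment lam n (n + 2 * l) / chebMoment lam n n - rising (-lam) l| ≤
        K₂ * (((l : ℝ) + 1) ^ 2 * (mu * mu) ^ l) / n := by
      intro l
      have hpos : 0 < |chebMoment lam n n| := by
        rw [← ht0]; exact abs_pos.2 (mul_ne_zero hg hE0.ne')
      have e : chebMoment lam n (n + 2 * l) / chebMoment lam n n - rising (-lam) l =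
          (chebMoment lam n (n + 2 * l) - chebMoment lam n n * rising (-lam) l) /
            chebMoment lam n n := by
        have := abs_pos.1 hpos
        field_simp
      rw [e, abs_div, div_le_iff₀ hpos]
      have := h2 n l hn (le_trans (le_max_right _ _) hNn)
      linarith
    obtain ⟨s1, b1⟩ := hcomp K₂ _ hK₂ hc
    have s2 : Summable fun l => ‖(rising (-lam) l : ℂ) * y ^ l‖ := by
      refine summable_norm_ofReal_mul_pow (C := 1 + A) (fun i => ?_) hy1
      rcases i with _ | i
      · simpa using hA0
      · linarith [hA i]
    have b2 : ∑' l, ‖(rising (-lam) l : ℂ) * y ^ l‖ ≤ 1 + A * (r / (1 - r)) := by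
      rw [s2.tsum_eq_zero_add]
      have hgeo : HasSum (fun l : ℕ => A * r * r ^ l) (A * r * (1 - r)⁻¹) :=
        (hasSum_geometric_of_lt_one hy0 hy1).mul_left _
      have := ((summable_nat_add_iff 1).2 s2).tsum_le_tsum (fun l => by
        rw [hnorm, pow_succ]
        calc _ ≤ A * (r ^ l * r) := by
              have := hA l
              gcongr
          _ = A * r * r ^ l := by ring) hgeo.summable
      rw [hgeo.tsum_eq] at this
      simp only [rising_zero, Complex.ofReal_one, pow_zero, one_mul, norm_one]
      rw [div_eq_mul_inv, ← mul_assoc]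
      linarith
    have e : ∑' l : ℕ, (chebMoment lam n (n + 2 * l) : ℂ) * y ^ l =
        (chebMoment lam n n : ℂ) * (∑' l, (rising (-lam) l : ℂ) * y ^ l +
          ∑' l : ℕ, ((chebMoment lam n (n + 2 * l) / chebMoment lam n n -
            rising (-lam) l : ℝ) : ℂ) * y ^ l) := by
      rw [← s2.of_norm.tsum_add s1.of_norm, ← tsum_mul_left]
      refine tsum_congr fun l => ?_
      have hne : (chebMoment lam n n : ℂ) ≠ 0 := by
        rw [← ht0]; exact_mod_cast mul_ne_zero hg hE0.ne'
      push_cast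
      field_simp
      ring
    have habs : |chebMoment lam n n| = |rising lam n| * E₀ := by
      rw [← ht0, abs_mul, abs_of_pos hE0]
    rw [e, norm_mul, Complex.norm_real, Real.norm_eq_abs, habs]
    refine mul_le_mul_of_nonneg_left ?_ (by positivity)
    calc _ ≤ _ := norm_add_le _ _
      _ ≤ (1 + A * (r / (1 - r))) + K₂ * S / n :=
        add_le_add ((norm_tsum_le_tsum_norm s2).trans b2) ((norm_tsum_le_tsum_norm s1).trans b1)
  have hprod := tsum_gegenCoeff_mul_tsum_polyRem hl h0 hn hy1
  set ε := ∑' l : ℕ, (polyRem lam n (Chebyshev.T ℝ (2 * n + 2 * l)) : ℂ) * y ^ l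
  have hG' : ∑' i, (gegenCoeff lam n i : ℂ) * y ^ i =
      (rising lam n : ℂ) * ∑' i, ((gegenCoeff lam n i / rising lam n : ℝ) : ℂ) * y ^ i := by
    rw [← tsum_mul_left]
    refine tsum_congr fun i => ?_
    have : (rising lam n : ℂ) ≠ 0 := by exact_mod_cast hg
    push_cast
    field_simp
  set G := ∑' i, ((gegenCoeff lam n i / rising lam n : ℝ) : ℂ) * y ^ i
  rw [← hprod, hG', norm_mul, norm_mul, Complex.norm_real, Real.norm_eq_abs] at hnum
  set v := ellipseFactor lam r with hv
  have hv1 : 1 ≤ v := one_le_ellipseFactor lam hy0 hy1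
  have hvw : v ≤ w := ellipseFactor_le lam hy0 hy hr1
  have hsmall : K₁ * S / n * v ≤ 1 / 2 := by
    have hN' : (N₁ : ℝ) ≤ n := by exact_mod_cast le_trans (le_max_left _ _) hNn
    rw [div_mul_eq_mul_div, div_le_iff₀ hn']
    have : K₁ * S * v ≤ K₁ * S * w := by gcongr
    nlinarith
  have hsmall' : K₁ * S / n * v ≤ b / 2 / n := by
    rw [hb]
    have : K₁ * S / n * v ≤ K₁ * S / n * w := by gcongr
    calc _ ≤ _ := this
      _ = _ := by ring
  have hR0 : 0 ≤ A * (r / (1 - r)) := mul_nonneg hA0 (div_nonneg hy0 (by linarith))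
  have hε : ‖ε‖ * (1 - K₁ * S / n * v) ≤ E₀ * (1 + A * (r / (1 - r)) + a / n) * v := by
    have h3 : |rising lam n| * (‖G‖ * ‖ε‖) ≤
        |rising lam n| * (E₀ * (1 + A * (r / (1 - r)) + a / n)) := by linarith
    have h4 := le_of_mul_le_mul_left h3 (abs_pos.2 hg)
    have h5 : (1 - K₁ * S / n * v) ≤ ‖G‖ * v := by
      calc _ = (v⁻¹ - K₁ * S / n) * v := by field_simp
        _ ≤ _ := by gcongr
    calc _ ≤ ‖ε‖ * (‖G‖ * v) := by gcongr
      _ = (‖G‖ * ‖ε‖) * v := by ring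
      _ ≤ _ := by gcongr
  have h6 : 1 ≤ (1 - K₁ * S / n * v) * (1 + b / n) := by
    have hx0 : 0 ≤ K₁ * S / n * v := by positivity
    have hb2 : b / n = 2 * (b / 2 / n) := by ring
    rw [hb2]
    generalize K₁ * S / n * v = x at *
    generalize b / 2 / (n : ℝ) = z at *
    have h8 : 0 ≤ (1 / 2 - x) * z := mul_nonneg (by linarith) (by linarith)
    linarith
  have h7 : (1 + A * (r / (1 - r)) + a / n) ≤ (1 + A * (r / (1 - r))) * (1 + a / n) := by
    have h8 : 0 ≤ A * (r / (1 - r)) * (a / n) := mul_nonneg hR0 (div_nonneg ha0 hn'.le)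
    have h9 : (1 + A * (r / (1 - r))) * (1 + a / n) =
        (1 + A * (r / (1 - r)) + a / n) + A * (r / (1 - r)) * (a / n) := by ring
    linarith
  calc ‖ε‖ = ‖ε‖ * 1 := (mul_one _).symm
    _ ≤ ‖ε‖ * ((1 - K₁ * S / n * v) * (1 + b / n)) := by gcongr
    _ = ‖ε‖ * (1 - K₁ * S / n * v) * (1 + b / n) := by ring
    _ ≤ E₀ * (1 + A * (r / (1 - r)) + a / n) * v * (1 + b / n) := by gcongr
    _ ≤ E₀ * ((1 + A * (r / (1 - r))) * (1 + a / n)) * v * (1 + b / n) := by gcongr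
    _ = E₀ * ((1 + a / n) * (1 + b / n)) * (1 + A * (r / (1 - r))) * v := by ring
    _ ≤ _ := by
      gcongr
      exact one_add_div_mul_le ha0 hb0 hn

/-! ### Fourier and Chebyshev expansion on Bernstein ellipses -/

instance factZeroLtTwoPi : Fact (0 < 2 * Real.pi) := ⟨Real.two_pi_pos⟩

/-- The Joukowski map. -/
def joukowski (w : ℂ) : ℂ := (w + w⁻¹) / 2

theorem fourier_eq_zpow (k : ℤ) (x : AddCircle (2 * Real.pi)) :
    fourier k x = (fourier 1 x : ℂ) ^ k := by
  induction x using QuotientAddGroup.induction_on with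
  | H θ =>
    erw [fourier_coe_apply, fourier_coe_apply]
    rw [← Complex.exp_int_mul]
    congr 1
    push_cast
    ring

theorem norm_fourier_apply (k : ℤ) (x : AddCircle (2 * Real.pi)) : ‖(fourier k x : ℂ)‖ = 1 := by
  rw [fourier_apply, Circle.norm_coe]

theorem fourier_one_ne_zero (x : AddCircle (2 * Real.pi)) : (fourier 1 x : ℂ) ≠ 0 := by
  rw [← norm_ne_zero_iff, norm_fourier_apply]
  exact one_ne_zero

theorem fourier_coe_two_pi (k : ℤ) (θ : ℝ) :
    fourier k (θ : AddCircle (2 * Real.pi)) = Complex.exp (k * θ * Complex.I) := by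
  rw [fourier_coe_apply]
  congr 1
  have : (Real.pi : ℂ) ≠ 0 := by exact_mod_cast Real.pi_ne_zero
  push_cast
  field_simp

theorem bernsteinRegion_mono {s ρ : ℝ} (hs : 1 < s) (h : s ≤ ρ) :
    bernsteinRegion s ⊆ bernsteinRegion ρ := by
  intro z hz
  simp only [bernsteinRegion, Set.mem_ofPred_eq] at hz ⊢
  have hs0 : 0 < s := by linarith
  have h1 : s⁻¹ < 1 := inv_lt_one_of_one_lt₀ hs
  have h2 : ρ⁻¹ ≤ s⁻¹ := inv_anti₀ hs0 h
  have h3 : s + s⁻¹ ≤ ρ + ρ⁻¹ := by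
    have e : ρ + ρ⁻¹ - (s + s⁻¹) = (ρ - s) * (ρ * s - 1) / (ρ * s) := by
      have : ρ ≠ 0 := by linarith
      field_simp
      ring
    have : 0 ≤ (ρ - s) * (ρ * s - 1) / (ρ * s) :=
      div_nonneg (mul_nonneg (by linarith) (by nlinarith)) (by nlinarith)
    linarith
  have hs1 : 0 < s⁻¹ := by positivity
  refine le_trans (add_le_add ?_ ?_) hz
  · rw [div_pow z.re, div_pow z.re]
    exact div_le_div_of_nonneg_left (sq_nonneg z.re) (by positivity) (by gcongr)
  · rw [div_pow z.im, div_pow z.im]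
    have : 0 < (s - s⁻¹) / 2 := by linarith
    exact div_le_div_of_nonneg_left (sq_nonneg z.im) (by positivity) (by gcongr)

/-- The unit circle is mapped into `[-1, 1]`, and a larger circle onto the ellipse of its own
radius, which lies in the region of any larger parameter. -/
theorem joukowski_mem_bernsteinRegion {ρ : ℝ} (hρ : 1 < ρ) {w : ℂ} (h1 : 1 ≤ ‖w‖)
    (h2 : ‖w‖ ≤ ρ) : joukowski w ∈ bernsteinRegion ρ := by
  rcases h1.eq_or_lt with h | h
  · have e : joukowski w = (w.re : ℂ) := by
      rw [joukowski, Complex.inv_def, Complex.normSq_eq_norm_sq, ← h]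
      simp only [one_pow, inv_one, Complex.ofReal_one, mul_one, Complex.add_conj]
      push_cast
      ring
    have hre : |w.re| ≤ 1 := h ▸ Complex.abs_re_le_norm w
    have ha : 1 ≤ (ρ + ρ⁻¹) / 2 := by
      have e : ρ + ρ⁻¹ - 2 = (ρ - 1) ^ 2 / ρ := by
        have : ρ ≠ 0 := by linarith
        field_simp
        ring
      have : 0 ≤ (ρ - 1) ^ 2 / ρ := by positivity
      linarith
    rw [e]
    simp only [bernsteinRegion, Set.mem_ofPred_eq, Complex.ofReal_re, Complex.ofReal_im, zero_div]
    rw [zero_pow two_ne_zero, add_zero, sq_le_one_iff_abs_le_one, abs_div,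
      abs_of_pos (by linarith : 0 < (ρ + ρ⁻¹) / 2)]
    exact div_le_one_of_le₀ (by linarith) (by linarith)
  · refine bernsteinRegion_mono h h2 (bernsteinEllipse_subset h ?_)
    set t := toIcoMod Real.two_pi_pos 0 w.arg
    have ht := toIcoMod_mem_Ico Real.two_pi_pos 0 w.arg
    refine ⟨t, ⟨ht.1, by simpa using ht.2.le⟩, ?_⟩
    have hw : (‖w‖ : ℂ) * Complex.exp (t * Complex.I) = w := by
      have e : t = w.arg - toIcoDiv Real.two_pi_pos 0 w.arg • (2 * Real.pi) := rfl
      conv_rhs => rw [← Complex.norm_mul_exp_arg_mul_I w]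
      rw [e]
      congr 1
      rw [Complex.exp_eq_exp_iff_exists_int]
      refine ⟨-toIcoDiv Real.two_pi_pos 0 w.arg, ?_⟩
      push_cast [zsmul_eq_mul]
      ring
    rw [hw, joukowski]

/-- The restriction of `u` to the Bernstein ellipse with parameter `s`, parametrized by the
circle. -/
def onEllipse (u : ℂ → ℂ) (s : ℝ) (x : AddCircle (2 * Real.pi)) : ℂ :=
  u (joukowski (s * fourier 1 x))

section

variable {ρ : ℝ} (hρ : 1 < ρ) {u : ℂ → ℂ} (hu : AnalyticOnEllipse ρ u)
include hρ hu

theorem differentiableAt_comp_joukowski {w : ℂ} (h1 : 1 ≤ ‖w‖) (h2 : ‖w‖ ≤ ρ) :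
    DifferentiableAt ℂ (fun w => u (joukowski w)) w := by
  have hw : w ≠ 0 := by rw [← norm_pos_iff]; linarith
  have h3 : DifferentiableAt ℂ joukowski w := by
    unfold joukowski
    exact (differentiableAt_id.add (differentiableAt_inv hw)).div_const 2
  exact (hu _ (joukowski_mem_bernsteinRegion hρ h1 h2)).differentiableAt.comp w h3

theorem continuous_onEllipse {s : ℝ} (h1 : 1 ≤ s) (h2 : s ≤ ρ) : Continuous (onEllipse u s) := by
  rw [continuous_iff_continuousAt]
  intro x
  have hn : ‖(s : ℂ) * fourier 1 x‖ = s := by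
    rw [norm_mul, norm_fourier_apply, Complex.norm_real, Real.norm_eq_abs,
      abs_of_nonneg (by linarith), mul_one]
  have h3 := (differentiableAt_comp_joukowski hρ hu (w := s * fourier 1 x)
    (by rw [hn]; exact h1) (by rw [hn]; exact h2)).continuousAt
  have h4 : ContinuousAt (fun x : AddCircle (2 * Real.pi) => (s : ℂ) * fourier 1 x) x :=
    (continuous_const.mul (fourier 1).continuous).continuousAt
  exact ContinuousAt.comp (f := fun x : AddCircle (2 * Real.pi) => (s : ℂ) * fourier 1 x) h3 h4

theorem norm_onEllipse_le (x : AddCircle (2 * Real.pi)) :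
    ‖onEllipse u ρ x‖ ≤ maxOnEllipse ρ u := by
  obtain ⟨θ, hθ, rfl⟩ : ∃ θ ∈ Set.Ico (0 : ℝ) (0 + 2 * Real.pi),
      (θ : AddCircle (2 * Real.pi)) = x := by
    have : x ∈ (QuotientAddGroup.mk : ℝ → AddCircle (2 * Real.pi)) ''
        Set.Ico 0 (0 + 2 * Real.pi) := by
      rw [AddCircle.coe_image_Ico_eq]; trivial
    exact this
  rw [zero_add] at hθ
  refine (isGreatest_maxOnEllipse hρ hu).2 ⟨_, ⟨θ, ⟨hθ.1, hθ.2.le⟩, rfl⟩, ?_⟩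
  simp only [onEllipse, joukowski, fourier_coe_two_pi, Int.cast_one, one_mul]

omit hρ hu in
theorem fourierCoeff_onEllipse {s : ℝ} (hs : 0 < s) (k : ℤ) :
    fourierCoeff (onEllipse u s) k = (s : ℂ) ^ k * ((2 * Real.pi * Complex.I)⁻¹ *
      ∮ w in C(0, s), u (joukowski w) * w ^ (-k - 1)) := by
  have hs' : (s : ℂ) ≠ 0 := by exact_mod_cast hs.ne'
  have hpi : (Real.pi : ℂ) ≠ 0 := by exact_mod_cast Real.pi_ne_zero
  have e : ∮ w in C(0, s), u (joukowski w) * w ^ (-k - 1) =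
      Complex.I * (s : ℂ) ^ (-k) * ∫ θ in (0 : ℝ)..(0 + 2 * Real.pi),
        fourier (-k) (θ : AddCircle (2 * Real.pi)) • onEllipse u s θ := by
    rw [circleIntegral, zero_add, ← intervalIntegral.integral_const_mul]
    refine intervalIntegral.integral_congr fun θ _ => ?_
    have hE : Complex.exp (θ * Complex.I) ≠ 0 := Complex.exp_ne_zero _
    simp only [deriv_circleMap, circleMap, zero_add, smul_eq_mul, onEllipse, fourier_coe_two_pi,
      Int.cast_one, one_mul]
    have e1 : Complex.exp (((-k : ℤ) : ℂ) * θ * Complex.I) =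
        Complex.exp (θ * Complex.I) ^ (-k) := by
      rw [← Complex.exp_int_mul]; congr 1; ring
    rw [e1, mul_zpow, zpow_sub₀ hs', zpow_sub₀ hE, zpow_one, zpow_one]
    field_simp
  rw [fourierCoeff_eq_intervalIntegral _ k 0, e, zpow_neg, Complex.real_smul]
  have := zpow_ne_zero k hs'
  push_cast
  field_simp

/-- These are Laurent coefficients of `u ∘ joukowski`, and Cauchy's theorem on the annulus `1 ≤ |w|
≤ ρ` makes the contour integral independent of the radius. -/
theorem fourierCoeff_onEllipse_eq_mul (k : ℤ) :
    fourierCoeff (onEllipse u ρ) k = (ρ : ℂ) ^ k * fourierCoeff (onEllipse u 1) k := by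
  rw [fourierCoeff_onEllipse (by linarith), fourierCoeff_onEllipse one_pos]
  have hd : ∀ w : ℂ, 1 ≤ ‖w‖ → ‖w‖ ≤ ρ →
      DifferentiableAt ℂ (fun w => u (joukowski w) * w ^ (-k - 1)) w := fun w h1 h2 =>
    (differentiableAt_comp_joukowski hρ hu h1 h2).mul
      (differentiableAt_zpow.2 (Or.inl (by rw [← norm_pos_iff]; linarith)))
  rw [Complex.circleIntegral_eq_of_differentiable_on_annulus_off_countable one_pos hρ.le
    Set.countable_empty]
  · simp
  · intro w hw
    simp only [Set.mem_sdiff, Metric.mem_closedBall, Metric.mem_ball, dist_zero_right, not_lt] at hw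
    exact (hd w hw.2 hw.1).continuousAt.continuousWithinAt
  · intro w hw
    simp only [Set.mem_sdiff, Metric.mem_closedBall, Metric.mem_ball, dist_zero_right, not_le,
      Set.mem_empty_iff_false, not_false_eq_true, and_true] at hw
    exact hd w hw.2.le hw.1.le

omit hρ hu in
theorem fourierCoeff_onEllipse_one_neg (k : ℤ) :
    fourierCoeff (onEllipse u 1) (-k) = fourierCoeff (onEllipse u 1) k := by
  rw [fourierCoeff, fourierCoeff, ← integral_neg_eq_self]
  congr 1
  funext x
  have h1 : fourier (- -k) (-x) = (fourier (-k) x : ℂ) := by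
    rw [fourier_apply, fourier_apply]; simp
  have h2 : onEllipse u 1 (-x) = onEllipse u 1 x := by
    have : (fourier 1 (-x) : ℂ) = (fourier 1 x : ℂ)⁻¹ := by
      rw [← zpow_neg_one, ← fourier_eq_zpow, fourier_apply, fourier_apply]; simp
    rw [onEllipse, onEllipse, this, joukowski, joukowski]
    congr 2
    simp [add_comm]
  rw [h1, h2]

theorem norm_fourierCoeff_le (k : ℤ) :
    ‖fourierCoeff (onEllipse u ρ) k‖ ≤ maxOnEllipse ρ u := by
  rw [fourierCoeff]
  refine (norm_integral_le_of_norm_le_const (C := maxOnEllipse ρ u) ?_).trans (by simp)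
  refine Eventually.of_forall fun x => ?_
  rw [norm_smul, norm_fourier_apply, one_mul]
  exact norm_onEllipse_le hρ hu x

theorem maxOnEllipse_nonneg : 0 ≤ maxOnEllipse ρ u :=
  (norm_nonneg _).trans (norm_onEllipse_le hρ hu 0)

theorem summable_norm_fourierCoeff : Summable fun k => ‖fourierCoeff (onEllipse u 1) k‖ := by
  have hρ0 : 0 < ρ := by linarith
  have hb : ∀ k : ℕ, ‖fourierCoeff (onEllipse u 1) (k : ℤ)‖ ≤ maxOnEllipse ρ u * ρ⁻¹ ^ k := by
    intro k
    have h1 := norm_fourierCoeff_le hρ hu k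
    rw [fourierCoeff_onEllipse_eq_mul hρ hu, norm_mul, zpow_natCast, norm_pow, Complex.norm_real,
      Real.norm_eq_abs, abs_of_pos hρ0] at h1
    rw [inv_pow, ← div_eq_mul_inv, le_div_iff₀ (by positivity)]
    linarith
  have hs : Summable fun k : ℕ => ‖fourierCoeff (onEllipse u 1) (k : ℤ)‖ :=
    Summable.of_nonneg_of_le (fun _ => norm_nonneg _) hb
      ((summable_geometric_of_lt_one (by positivity) (inv_lt_one_of_one_lt₀ hρ)).mul_left _)
  refine Summable.of_nat_of_neg hs ?_
  simpa only [fourierCoeff_onEllipse_one_neg] using hs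

/-- The Chebyshev expansion of a function analytic in a Bernstein ellipse. -/
theorem hasSum_chebyshev {x : ℝ} (hx : x ∈ Set.Icc (-1 : ℝ) 1) :
    HasSum (fun k : ℤ => fourierCoeff (onEllipse u 1) k *
      (((Chebyshev.T ℝ k).eval x : ℝ) : ℂ)) (u x) := by
  have hcont := continuous_onEllipse hρ hu le_rfl hρ.le
  have hsum : Summable (fourierCoeff (onEllipse u 1)) := (summable_norm_fourierCoeff hρ hu).of_norm
  have key : ∀ θ : ℝ, HasSum (fun k : ℤ => fourierCoeff (onEllipse u 1) k *
      Complex.exp (k * θ * Complex.I)) (u (Real.cos θ)) := by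
    intro θ
    have h := has_pointwise_sum_fourier_series_of_summable (f := ⟨onEllipse u 1, hcont⟩) hsum
      (θ : AddCircle (2 * Real.pi))
    simp only [fourier_coe_two_pi, ContinuousMap.coe_mk, smul_eq_mul] at h
    have e : onEllipse u 1 (θ : AddCircle (2 * Real.pi)) = u (Real.cos θ) := by
      rw [onEllipse, fourier_coe_two_pi, joukowski, Complex.ofReal_cos, Complex.cos]
      congr 2
      rw [Complex.ofReal_one, one_mul, ← Complex.exp_neg]
      push_cast
      ring_nf
    rwa [e] at h
  -- Averaging the Fourier series at `θ` and `-θ` turns `e^(ikθ)` into `cos kθ = T_k(x)`.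
  have h1 := key (Real.arccos x)
  have h2 := key (-Real.arccos x)
  rw [Real.cos_neg] at h2
  have h3 := (h1.add h2).div_const 2
  rw [Real.cos_arccos hx.1 hx.2, add_self_div_two] at h3
  have e : ∀ k : ℤ, fourierCoeff (onEllipse u 1) k * (((Chebyshev.T ℝ k).eval x : ℝ) : ℂ) =
      (fourierCoeff (onEllipse u 1) k * Complex.exp (k * Real.arccos x * Complex.I) +
        fourierCoeff (onEllipse u 1) k *
          Complex.exp (k * (-Real.arccos x : ℝ) * Complex.I)) / 2 := by
    intro k
    conv_lhs => rw [← Real.cos_arccos hx.1 hx.2, Chebyshev.T_real_cos]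
    rw [Complex.ofReal_cos, Complex.cos]
    push_cast
    ring_nf
  simp only [e]
  exact h3

end

/-! ### The quadrature error as a series, and two bounds for it -/

section

variable {ρ : ℝ} (hρ : 1 < ρ) {u : ℂ → ℂ} (hu : AnalyticOnEllipse ρ u)
variable {lam : ℝ} (hl : -1 / 2 < lam) (h0 : lam ≠ 0)
include hρ hu hl h0

theorem hasSum_gaussRemainder (n : ℕ) :
    HasSum (fun k : ℤ => fourierCoeff (onEllipse u 1) k *
      (polyRem lam n (Chebyshev.T ℝ k) : ℂ))
      (gaussRemainder n (lam - 1 / 2) (lam - 1 / 2) u) := by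
  have hI : HasSum (fun k : ℤ => ∫ x in (-1 : ℝ)..1, (fourierCoeff (onEllipse u 1) k *
      (((Chebyshev.T ℝ k).eval x : ℝ) : ℂ)) * (gegenWeight lam x : ℂ))
      (∫ x in (-1 : ℝ)..1, u x * (gegenWeight lam x : ℂ)) := by
    have hmem : ∀ x ∈ Set.uIoc (-1 : ℝ) 1, x ∈ Set.Icc (-1 : ℝ) 1 := fun x hx => by
      rw [Set.uIoc_of_le (by norm_num)] at hx
      exact Set.Ioc_subset_Icc_self hx
    refine intervalIntegral.hasSum_integral_of_dominated_convergence
      (fun k x => ‖fourierCoeff (onEllipse u 1) k‖ * gegenWeight lam x) ?_ ?_ ?_ ?_ ?_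
    · intro k
      have h1 := (intervalIntegrable_eval_mul_gegenWeight hl
        (Chebyshev.T ℝ k)).def'.aestronglyMeasurable
      have h2 := (Complex.continuous_ofReal.comp_aestronglyMeasurable h1).const_mul
        (fourierCoeff (onEllipse u 1) k)
      refine h2.congr (Eventually.of_forall fun x => ?_)
      simp [mul_assoc]
    · intro k
      refine Eventually.of_forall fun x hx => ?_
      have hw := gegenWeight_nonneg lam (hmem x hx)
      rw [norm_mul, norm_mul, Complex.norm_real, Complex.norm_real, Real.norm_eq_abs,
        Real.norm_eq_abs, abs_of_nonneg hw]
      have h3 := Chebyshev.abs_eval_T_real_le_one k (abs_le.2 ⟨(hmem x hx).1, (hmem x hx).2⟩)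
      refine mul_le_mul_of_nonneg_right ?_ hw
      exact mul_le_of_le_one_right (norm_nonneg _) h3
    · exact Eventually.of_forall fun x _ => (summable_norm_fourierCoeff hρ hu).mul_right _
    · simp only [tsum_mul_right]
      exact (intervalIntegrable_gegenWeight hl).const_mul _
    · exact Eventually.of_forall fun x hx => (hasSum_chebyshev hρ hu (hmem x hx)).mul_right _
  have hQ : HasSum (fun k : ℤ => ∑ x ∈ gegenNodes lam n, (fourierCoeff (onEllipse u 1) k *
      (((Chebyshev.T ℝ k).eval x : ℝ) : ℂ)) *
        (gaussWeight n (lam - 1 / 2) (lam - 1 / 2) x : ℂ))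
      (∑ x ∈ gegenNodes lam n, u x * (gaussWeight n (lam - 1 / 2) (lam - 1 / 2) x : ℂ)) :=
    hasSum_sum fun x hx => (hasSum_chebyshev hρ hu
      (Set.Ioo_subset_Icc_self ((gegenNodes_spec hl h0 n).2 x hx).1)).mul_right _
  have h := hI.sub hQ
  have e : ∀ k : ℤ, fourierCoeff (onEllipse u 1) k * (polyRem lam n (Chebyshev.T ℝ k) : ℂ) =
      (∫ x in (-1 : ℝ)..1, (fourierCoeff (onEllipse u 1) k *
      (((Chebyshev.T ℝ k).eval x : ℝ) : ℂ)) * (gegenWeight lam x : ℂ)) -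
      ∑ x ∈ gegenNodes lam n, (fourierCoeff (onEllipse u 1) k *
      (((Chebyshev.T ℝ k).eval x : ℝ) : ℂ)) *
        (gaussWeight n (lam - 1 / 2) (lam - 1 / 2) x : ℂ) := by
    intro k
    simp only [mul_assoc]
    rw [intervalIntegral.integral_const_mul, ← Finset.mul_sum, ← mul_sub, polyRem, wInt]
    congr 1
    rw [Complex.ofReal_sub, ← intervalIntegral.integral_ofReal, Complex.ofReal_sum]
    simp only [Complex.ofReal_mul]
  simp only [e]
  exact h

/-- The indices `k` and `-k` contribute equally, whence the factor `2`; small and odd indices drop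
out. Passing to the coefficients on the ellipse makes the decay explicit and leaves factors bounded
by the maximum of `|u|`. -/
theorem hasSum_gaussRemainder_nat {n : ℕ} (hn : 1 ≤ n) :
    HasSum (fun l : ℕ => 2 * (ρ⁻¹ : ℂ) ^ (2 * n + 2 * l) *
      fourierCoeff (onEllipse u ρ) (2 * n + 2 * l) *
      (polyRem lam n (Chebyshev.T ℝ (2 * n + 2 * l)) : ℂ))
      (gaussRemainder n (lam - 1 / 2) (lam - 1 / 2) u) := by
  have h := (hasSum_gaussRemainder hρ hu hl h0 n).nat_add_neg
  have hz : ∀ m : ℤ, m.natAbs < 2 * n → polyRem lam n (Chebyshev.T ℝ m) = 0 := fun m hm =>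
    polyRem_T_eq_zero_of_natAbs_lt hl h0 hm
  rw [hz 0 (by simp; omega), Complex.ofReal_zero, mul_zero, add_zero] at h
  simp only [fourierCoeff_onEllipse_one_neg, Chebyshev.T_neg] at h
  have hinj : Function.Injective fun l : ℕ => 2 * n + 2 * l := fun a b hab => by
    simp only at hab; omega
  rw [← hinj.hasSum_iff] at h
  · have hρ0 : (ρ : ℂ) ≠ 0 := by exact_mod_cast (by linarith : ρ ≠ 0)
    have e : ∀ l : ℕ, 2 * (ρ⁻¹ : ℂ) ^ (2 * n + 2 * l) *
        fourierCoeff (onEllipse u ρ) (2 * n + 2 * l) *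
        (polyRem lam n (Chebyshev.T ℝ (2 * n + 2 * l)) : ℂ) =
        ((fun m : ℕ => fourierCoeff (onEllipse u 1) (m : ℤ) *
          (polyRem lam n (Chebyshev.T ℝ (m : ℤ)) : ℂ) +
          fourierCoeff (onEllipse u 1) (m : ℤ) * (polyRem lam n (Chebyshev.T ℝ (m : ℤ)) : ℂ)) ∘
          fun l => 2 * n + 2 * l) l := by
      intro l
      have hc : (2 * (n : ℤ) + 2 * l) = ((2 * n + 2 * l : ℕ) : ℤ) := by push_cast; ring
      rw [hc, fourierCoeff_onEllipse_eq_mul hρ hu, zpow_natCast, inv_pow]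
      have := pow_ne_zero (2 * n + 2 * l) hρ0
      simp only [Function.comp]
      field_simp
      ring
    simp only [e]
    exact h
  · intro m hm
    have hm0 : polyRem lam n (Chebyshev.T ℝ (m : ℤ)) = 0 := by
      by_cases hlt : m < 2 * n
      · exact hz _ (by simpa using hlt)
      · rcases Nat.even_or_odd' (m - 2 * n) with ⟨q, hq | hq⟩
        · exact absurd ⟨q, by simp only; omega⟩ hm
        · have := polyRem_T_odd hl h0 hn q
          rwa [show (2 * (n : ℤ) + (2 * q + 1 : ℕ)) = (m : ℤ) by omega] at this
    rw [hm0]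
    simp

omit hl h0 in
theorem hasSum_sq_norm_fourierCoeff_onEllipse :
    Summable (fun k => ‖fourierCoeff (onEllipse u ρ) k‖ ^ 2) ∧
      ∑' k, ‖fourierCoeff (onEllipse u ρ) k‖ ^ 2 ≤ maxOnEllipse ρ u ^ 2 := by
  have hcont := continuous_onEllipse hρ hu hρ.le le_rfl
  set F : C(AddCircle (2 * Real.pi), ℂ) := ⟨onEllipse u ρ, hcont⟩ with hF
  have h := hasSum_sq_fourierCoeff
    (ContinuousMap.toLp (E := ℂ) 2 AddCircle.haarAddCircle ℂ F)
  simp only [fourierCoeff_toLp] at h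
  refine ⟨h.summable, h.tsum_eq.trans_le ?_⟩
  have hae : (fun t => ‖(ContinuousMap.toLp (E := ℂ) 2 AddCircle.haarAddCircle ℂ F) t‖ ^ 2)
      =ᵐ[AddCircle.haarAddCircle] fun t => ‖F t‖ ^ 2 := by
    filter_upwards [ContinuousMap.coeFn_toLp (E := ℂ) (p := 2) (𝕜 := ℂ)
      AddCircle.haarAddCircle F] with t ht
    rw [ht]
  rw [integral_congr_ae hae]
  have hM := maxOnEllipse_nonneg hρ hu
  have hb : ∀ t, ‖F t‖ ^ 2 ≤ maxOnEllipse ρ u ^ 2 := fun t =>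
    pow_le_pow_left₀ (norm_nonneg _) (norm_onEllipse_le hρ hu t) 2
  calc _ ≤ ∫ _, maxOnEllipse ρ u ^ 2 ∂(AddCircle.haarAddCircle (T := 2 * Real.pi)) :=
        integral_mono (Continuous.integrable_of_hasCompactSupport (by fun_prop)
          (HasCompactSupport.of_compactSpace _)) (integrable_const _) hb
    _ = _ := by simp

/-- A bound for the quadrature error by Bessel's inequality. -/
theorem norm_gaussRemainder_le_bessel {n : ℕ} (hn : 1 ≤ n) :
    ‖gaussRemainder n (lam - 1 / 2) (lam - 1 / 2) u‖ ≤
      4 * wInt lam 1 * maxOnEllipse ρ u / ρ ^ (2 * n) / √(1 - (ρ⁻¹ ^ 2) ^ 2) := by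
  have hρ0 : 0 < ρ := by linarith
  have hM := maxOnEllipse_nonneg hρ hu
  have hm0 : 0 ≤ wInt lam 1 := wInt_nonneg lam fun x _ => by simp
  set r := ρ⁻¹ ^ 2 with hr
  have hr0 : 0 < r := by positivity
  have hr1 : r < 1 := pow_lt_one₀ (by positivity) (inv_lt_one_of_one_lt₀ hρ) two_ne_zero
  have hrr : 0 < 1 - r ^ 2 := by nlinarith
  set d := √(1 - r ^ 2) with hd
  have hd0 : 0 < d := Real.sqrt_pos.2 hrr
  have hd2 : d ^ 2 = 1 - r ^ 2 := Real.sq_sqrt hrr.le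
  have h := hasSum_gaussRemainder_nat hρ hu hl h0 hn
  set a : ℕ → ℝ := fun l => ‖fourierCoeff (onEllipse u ρ) (2 * n + 2 * l)‖ with ha
  obtain ⟨s1, b1⟩ := hasSum_sq_norm_fourierCoeff_onEllipse hρ hu
  have hinj : Function.Injective fun l : ℕ => (2 * n + 2 * l : ℤ) := fun x y hxy => by
    simp only at hxy; omega
  have s2 : Summable fun l => a l ^ 2 := s1.comp_injective hinj
  have b2 : ∑' l, a l ^ 2 ≤ maxOnEllipse ρ u ^ 2 :=
    (tsum_comp_le_tsum_of_inj s1 (fun _ => sq_nonneg _) hinj).trans b1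
  have s3 : Summable fun l : ℕ => (r ^ l) ^ 2 := by
    simp only [← pow_mul, mul_comm _ 2]
    simp only [pow_mul]
    exact summable_geometric_of_lt_one (by positivity) (by nlinarith)
  have b3 : ∑' l : ℕ, (r ^ l) ^ 2 = 1 / d ^ 2 := by
    simp only [← pow_mul, mul_comm _ 2]
    simp only [pow_mul]
    rw [tsum_geometric_of_lt_one (by positivity) (by nlinarith), hd2, one_div]
  have hCS : Summable (fun l => a l * r ^ l) ∧ ∑' l, a l * r ^ l ≤ maxOnEllipse ρ u / d := by
    have s4 : Summable fun l => a l * r ^ l := by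
      refine Summable.of_nonneg_of_le (fun l => by positivity) (fun l => ?_) (s2.add s3)
      nlinarith [sq_nonneg (a l - r ^ l), sq_nonneg (a l), sq_nonneg (r ^ l)]
    refine ⟨s4, ?_⟩
    rcases hM.eq_or_lt with hM0 | hM0
    · have : ∀ l, a l = 0 := fun l =>
        le_antisymm ((norm_fourierCoeff_le hρ hu _).trans hM0.symm.le) (norm_nonneg _)
      simp [this, ← hM0]
    · set M := maxOnEllipse ρ u
      -- Cauchy–Schwarz as Young's inequality, with the weight `M d` balancing `∑ a² ≤ M²` against
      -- `∑ r^(2l) = 1 / d²`.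
      have h5 : ∀ l, a l * r ^ l ≤ 1 / (2 * M * d) * a l ^ 2 + M * d / 2 * (r ^ l) ^ 2 := by
        intro l
        have e : 1 / (2 * M * d) * a l ^ 2 + M * d / 2 * (r ^ l) ^ 2 - a l * r ^ l =
            (a l - M * d * r ^ l) ^ 2 / (2 * M * d) := by
          field_simp
          ring
        have : 0 ≤ (a l - M * d * r ^ l) ^ 2 / (2 * M * d) := by positivity
        linarith
      have h6 := s4.tsum_le_tsum h5 ((s2.mul_left _).add (s3.mul_left _))
      rw [(s2.mul_left _).tsum_add (s3.mul_left _), tsum_mul_left, tsum_mul_left, b3] at h6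
      calc _ ≤ _ := h6
        _ ≤ 1 / (2 * M * d) * M ^ 2 + M * d / 2 * (1 / d ^ 2) := by gcongr
        _ = M / d := by field_simp; ring
  have h7 : ∀ l : ℕ, ‖2 * (ρ⁻¹ : ℂ) ^ (2 * n + 2 * l) *
      fourierCoeff (onEllipse u ρ) (2 * n + 2 * l) *
      (polyRem lam n (Chebyshev.T ℝ (2 * n + 2 * l)) : ℂ)‖ ≤
      4 * wInt lam 1 / ρ ^ (2 * n) * (a l * r ^ l) := by
    intro l
    have h8 := abs_polyRem_T_le hl h0 hn (2 * n + 2 * l)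
    rw [norm_mul, norm_mul, norm_mul, norm_pow, norm_inv, Complex.norm_real, Complex.norm_real,
      Real.norm_eq_abs, Real.norm_eq_abs, abs_of_pos hρ0, Complex.norm_ofNat]
    have e : ρ⁻¹ ^ (2 * n + 2 * l) = r ^ l / ρ ^ (2 * n) := by
      rw [pow_add, pow_mul ρ⁻¹ 2 l, ← hr, inv_pow, div_eq_mul_inv, mul_comm]
    rw [e]
    calc _ ≤ 2 * (r ^ l / ρ ^ (2 * n)) * a l * (2 * wInt lam 1) := by gcongr
      _ = _ := by ring
  have h9 : ‖gaussRemainder n (lam - 1 / 2) (lam - 1 / 2) u‖ ≤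
      ∑' l : ℕ, 4 * wInt lam 1 / ρ ^ (2 * n) * (a l * r ^ l) := by
    rw [← h.tsum_eq]
    exact tsum_of_norm_bounded (hCS.1.mul_left _).hasSum h7
  rw [tsum_mul_left] at h9
  calc _ ≤ _ := h9
    _ ≤ 4 * wInt lam 1 / ρ ^ (2 * n) * (maxOnEllipse ρ u / d) := by
      gcongr
      exact hCS.2
    _ = _ := by ring

/-- A bound for the quadrature error by the generating function of the remainders of the Chebyshev
polynomials. -/
theorem norm_gaussRemainder_le_of_forall {n : ℕ} (hn : 1 ≤ n) {B : ℝ}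
    (hB : ∀ y : ℂ, ‖y‖ = ρ⁻¹ ^ 2 →
      ‖∑' l : ℕ, (polyRem lam n (Chebyshev.T ℝ (2 * n + 2 * l)) : ℂ) * y ^ l‖ ≤ B) :
    ‖gaussRemainder n (lam - 1 / 2) (lam - 1 / 2) u‖ ≤
      2 * maxOnEllipse ρ u / ρ ^ (2 * n) * B := by
  have hρ0 : 0 < ρ := by linarith
  have hM := maxOnEllipse_nonneg hρ hu
  have hm0 : 0 ≤ wInt lam 1 := wInt_nonneg lam fun x _ => by simp
  set r := ρ⁻¹ ^ 2 with hr
  have hr0 : 0 < r := by positivity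
  have hr1 : r < 1 := pow_lt_one₀ (by positivity) (inv_lt_one_of_one_lt₀ hρ) two_ne_zero
  have hcont := continuous_onEllipse hρ hu hρ.le le_rfl
  -- The terms of the error series before integration over the circle. Summing under the integral
  -- produces the generating function at `ρ⁻² e^(-2iθ)`.
  set G : ℕ → AddCircle (2 * Real.pi) → ℂ := fun l x => 2 * (ρ⁻¹ : ℂ) ^ (2 * n + 2 * l) *
    (fourier (-(2 * n + 2 * l : ℤ)) x * onEllipse u ρ x) *
      (polyRem lam n (Chebyshev.T ℝ (2 * n + 2 * l)) : ℂ) with hG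
  have hGc : ∀ l, Continuous (G l) := fun l => by
    have := (fourier (T := 2 * Real.pi) (-(2 * n + 2 * l : ℤ))).continuous
    fun_prop
  have hGi : ∀ l, Integrable (G l) AddCircle.haarAddCircle := fun l =>
    (hGc l).integrable_of_hasCompactSupport (HasCompactSupport.of_compactSpace _)
  have hGb : ∀ l x, ‖G l x‖ ≤ 4 * wInt lam 1 * maxOnEllipse ρ u / ρ ^ (2 * n) * r ^ l := by
    intro l x
    have h8 := abs_polyRem_T_le hl h0 hn (2 * n + 2 * l)
    have h9 := norm_onEllipse_le hρ hu x
    rw [hG]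
    simp only
    rw [norm_mul, norm_mul, norm_mul, norm_mul, norm_pow, norm_inv, Complex.norm_real,
      Complex.norm_real, Real.norm_eq_abs, Real.norm_eq_abs, abs_of_pos hρ0, Complex.norm_ofNat,
      norm_fourier_apply, one_mul]
    have e : ρ⁻¹ ^ (2 * n + 2 * l) = r ^ l / ρ ^ (2 * n) := by
      rw [pow_add, pow_mul ρ⁻¹ 2 l, ← hr, inv_pow, div_eq_mul_inv, mul_comm]
    rw [e]
    calc _ ≤ 2 * (r ^ l / ρ ^ (2 * n)) * maxOnEllipse ρ u * (2 * wInt lam 1) := by gcongr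
      _ = _ := by ring
  have hgeo : Summable fun l : ℕ => 4 * wInt lam 1 * maxOnEllipse ρ u / ρ ^ (2 * n) * r ^ l :=
    (summable_geometric_of_lt_one hr0.le hr1).mul_left _
  have hint : HasSum (fun l => ∫ x, G l x ∂AddCircle.haarAddCircle)
      (∫ x, ∑' l, G l x ∂AddCircle.haarAddCircle) := by
    refine hasSum_integral_of_summable_integral_norm hGi ?_
    refine Summable.of_nonneg_of_le (fun l => integral_nonneg fun x => norm_nonneg _)
      (fun l => ?_) hgeo
    calc _ ≤ ∫ _, 4 * wInt lam 1 * maxOnEllipse ρ u / ρ ^ (2 * n) * r ^ l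
          ∂(AddCircle.haarAddCircle (T := 2 * Real.pi)) :=
          integral_mono (hGi l).norm (integrable_const _) (hGb l)
      _ = _ := by simp
  have hterm : ∀ l : ℕ, ∫ x, G l x ∂AddCircle.haarAddCircle =
      2 * (ρ⁻¹ : ℂ) ^ (2 * n + 2 * l) * fourierCoeff (onEllipse u ρ) (2 * n + 2 * l) *
      (polyRem lam n (Chebyshev.T ℝ (2 * n + 2 * l)) : ℂ) := by
    intro l
    rw [hG]
    simp only
    rw [integral_mul_const, integral_const_mul, fourierCoeff]
    simp only [smul_eq_mul]
  simp only [hterm] at hint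
  rw [(hasSum_gaussRemainder_nat hρ hu hl h0 hn).unique hint]
  refine (norm_integral_le_of_norm_le_const (C := 2 * maxOnEllipse ρ u / ρ ^ (2 * n) * B)
    (Eventually.of_forall fun x => ?_)).trans (by simp)
  set y : ℂ := (ρ⁻¹ : ℂ) ^ 2 * fourier (-2) x with hy
  have hyn : ‖y‖ = r := by
    rw [hy, norm_mul, norm_fourier_apply, mul_one, norm_pow, norm_inv, Complex.norm_real,
      Real.norm_eq_abs, abs_of_pos hρ0]
  have e : ∑' l, G l x = 2 * (ρ⁻¹ : ℂ) ^ (2 * n) * fourier (-(2 * n : ℤ)) x * onEllipse u ρ x *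
      ∑' l : ℕ, (polyRem lam n (Chebyshev.T ℝ (2 * n + 2 * l)) : ℂ) * y ^ l := by
    rw [← tsum_mul_left]
    refine tsum_congr fun l => ?_
    have hf : (fourier (-(2 * n + 2 * l : ℤ)) x : ℂ) =
        fourier (-(2 * n : ℤ)) x * (fourier (-2) x : ℂ) ^ l := by
      rw [fourier_eq_zpow (-(2 * n + 2 * l : ℤ)), fourier_eq_zpow (-(2 * n : ℤ)),
        fourier_eq_zpow (-2), ← zpow_natCast, ← zpow_mul, ← zpow_add₀ (fourier_one_ne_zero x)]
      congr 1
      ring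
    rw [hG, hy]
    simp only
    rw [hf, mul_pow, ← pow_mul, pow_add]
    ring
  rw [e, norm_mul, norm_mul, norm_mul, norm_mul, norm_fourier_apply, mul_one, norm_pow, norm_inv,
    Complex.norm_real, Real.norm_eq_abs, abs_of_pos hρ0, Complex.norm_ofNat]
  have h9 := norm_onEllipse_le hρ hu x
  have h10 := hB y hyn
  calc _ ≤ 2 * ρ⁻¹ ^ (2 * n) * maxOnEllipse ρ u * B := by gcongr
    _ = _ := by rw [inv_pow]; ring

end

/-! ### Uniform bounds for the coefficients of `(1 - y)^lam` -/

theorem abs_rising_neg_succ_le {lam : ℝ} (hl : -1 ≤ lam) {l : ℕ} (h : lam ≤ 2 * l + 1) :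
    |rising (-lam) (l + 1)| ≤ |rising (-lam) l| := by
  rw [rising_succ, abs_mul]
  refine mul_le_of_le_one_left (abs_nonneg _) ?_
  have h1 : (0 : ℝ) < l + 1 := by positivity
  rw [abs_div, abs_of_pos h1, div_le_one h1, abs_le]
  constructor <;> linarith

theorem abs_rising_neg_succ_le_abs {lam : ℝ} (hl : -1 ≤ lam) (h : lam ≤ 1) (l : ℕ) :
    |rising (-lam) (l + 1)| ≤ |lam| := by
  induction l with
  | zero => simp [rising_succ]
  | succ l ih =>
    refine (abs_rising_neg_succ_le hl (h.trans ?_)).trans ih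
    push_cast
    linarith [l.cast_nonneg (α := ℝ)]

theorem abs_rising_neg_mul_Gamma {lam : ℝ} (l : ℕ) (h : (l : ℝ) < lam + 1) :
    |rising (-lam) l| * (Real.Gamma (l + 1) * Real.Gamma (lam - l + 1)) =
      Real.Gamma (lam + 1) := by
  induction l with
  | zero => simp
  | succ l ih =>
    push_cast at h ⊢
    have h1 : (0 : ℝ) < l + 1 := by positivity
    have h2 : 0 < lam - l := by linarith
    rw [← ih (by linarith), rising_succ, abs_mul, abs_div, abs_of_pos h1,
      show -lam + l = -(lam - l) by ring, abs_neg, abs_of_pos h2,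
      Real.Gamma_add_one h1.ne', show lam - (l + 1) + 1 = lam - l by ring,
      Real.Gamma_add_one h2.ne']
    generalize Real.Gamma (lam - l) = G
    generalize Real.Gamma (l + 1) = G'
    field_simp

/-- Up to sign these are the binomials `binom(lam, l)`. For `l < lam + 1`, log-convexity of Gamma
bounds them by the central value at `l = lam / 2`; beyond that they no longer grow. -/
theorem abs_rising_neg_le {lam : ℝ} (hl : 0 ≤ lam) (l : ℕ) :
    |rising (-lam) l| ≤ Real.Gamma (lam + 1) / Real.Gamma (lam / 2 + 1) ^ 2 := by
  have key : ∀ k : ℕ, (k : ℝ) < lam + 1 →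
      |rising (-lam) k| ≤ Real.Gamma (lam + 1) / Real.Gamma (lam / 2 + 1) ^ 2 := by
    intro k hk
    have hg : 0 < Real.Gamma (lam / 2 + 1) := Real.Gamma_pos_of_pos (by linarith)
    rw [le_div_iff₀ (by positivity), ← abs_rising_neg_mul_Gamma k hk, sq]
    refine mul_le_mul_of_nonneg_left ?_ (abs_nonneg _)
    have h0 := k.cast_nonneg (α := ℝ)
    rcases le_total (k : ℝ) (lam / 2) with h | h
    · exact Gamma_mul_Gamma_le (by linarith) (by linarith) (by linarith) (by ring)
    · rw [mul_comm (Real.Gamma (k + 1))]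
      exact Gamma_mul_Gamma_le (by linarith) (by linarith) (by linarith) (by ring)
  induction l with
  | zero => exact key 0 (by push_cast; linarith)
  | succ l ih =>
    by_cases h : ((l + 1 : ℕ) : ℝ) < lam + 1
    · exact key _ h
    · push_cast at h
      exact (abs_rising_neg_succ_le (by linarith) (by linarith)).trans ih

theorem Gamma_add_half_sq_le {x : ℝ} (hx : 0 < x) :
    x * Real.Gamma (x + 1 / 2) ^ 2 ≤ Real.Gamma (x + 1) ^ 2 := by
  have h := Gamma_mul_Gamma_le (u := x) (v := x + 1) (x := x + 1 / 2) (y := x + 1 / 2) hx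
    (by linarith) (by linarith) (by ring)
  have e := Real.Gamma_add_one hx.ne'
  calc x * Real.Gamma (x + 1 / 2) ^ 2 = x * (Real.Gamma (x + 1 / 2) * Real.Gamma (x + 1 / 2)) := by
        ring
    _ ≤ x * (Real.Gamma x * Real.Gamma (x + 1)) := by gcongr
    _ = _ := by rw [← mul_assoc, ← e, sq]

theorem Gamma_two_mul_add_one (lam : ℝ) :
    Real.Gamma (lam + 1 / 2) * Real.Gamma (lam + 1) * 2 ^ (2 * lam) =
      Real.Gamma (2 * lam + 1) * √Real.pi := by
  have h4 := Real.Gamma_mul_Gamma_add_half (lam + 1 / 2)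
  have e1 : lam + 1 / 2 + 1 / 2 = lam + 1 := by ring
  have e2 : 1 - 2 * (lam + 1 / 2) = -(2 * lam) := by ring
  have e3 : 2 * (lam + 1 / 2) = 2 * lam + 1 := by ring
  have g4 : (0 : ℝ) < 2 ^ (2 * lam) := Real.rpow_pos_of_pos two_pos _
  rw [e1, e2, e3, Real.rpow_neg two_pos.le] at h4
  rw [h4]
  field_simp

/-- The constant `√2 · √Γ(2λ + 1) / Γ(λ + 1)`. -/
def risingBound (lam : ℝ) : ℝ :=
  √2 * √(Real.Gamma (2 * lam + 1)) / Real.Gamma (lam + 1)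

/-- The duplication formula at `lam / 2` and at `lam` reduces the claim to `g q² ≤ 2 c s p²` in the
abbreviations below, a consequence of the half-step inequality `Gamma_add_half_sq_le`. -/
theorem Gamma_quotient_le_risingBound {lam : ℝ} (hl : 1 ≤ lam) :
    Real.Gamma (lam + 1) / Real.Gamma (lam / 2 + 1) ^ 2 ≤ risingBound lam := by
  have hg : 0 < Real.Gamma (lam + 1) := Real.Gamma_pos_of_pos (by linarith)
  have hp : 0 < Real.Gamma (lam / 2 + 1) := Real.Gamma_pos_of_pos (by linarith)
  have hq : 0 < Real.Gamma (lam / 2 + 1 / 2) := Real.Gamma_pos_of_pos (by linarith)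
  have hs : 0 < Real.Gamma (lam + 1 / 2) := Real.Gamma_pos_of_pos (by linarith)
  have hG : 0 < Real.Gamma (2 * lam + 1) := Real.Gamma_pos_of_pos (by linarith)
  have d1 := Gamma_two_mul_add_one (lam / 2)
  have d2 := Gamma_two_mul_add_one lam
  have b1 := Gamma_add_half_sq_le (x := lam / 2) (by linarith)
  have b2 := Gamma_add_half_sq_le (x := lam + 1 / 2) (by linarith)
  rw [show lam + 1 / 2 + 1 / 2 = lam + 1 by ring,
    Real.Gamma_add_one (s := lam + 1 / 2) (by linarith), mul_pow] at b2
  rw [show 2 * (lam / 2) = lam by ring] at d1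
  have hpow : (2 : ℝ) ^ (2 * lam) = (2 ^ lam) ^ 2 := by
    rw [← Real.rpow_natCast, ← Real.rpow_mul two_pos.le, mul_comm]; norm_num
  rw [hpow] at d2
  have ht : (0 : ℝ) < 2 ^ lam := Real.rpow_pos_of_pos two_pos _
  have hc : 0 < √Real.pi := Real.sqrt_pos.2 Real.pi_pos
  have hc3 : 3 < √Real.pi ^ 2 := by rw [Real.sq_sqrt Real.pi_pos.le]; exact Real.pi_gt_three
  rw [risingBound, ← Real.sqrt_mul two_pos.le, le_div_iff₀ hg]
  refine Real.le_sqrt_of_sq_le ?_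
  generalize Real.Gamma (lam + 1) = g at *
  generalize Real.Gamma (lam / 2 + 1) = p at *
  generalize Real.Gamma (lam / 2 + 1 / 2) = q at *
  generalize Real.Gamma (lam + 1 / 2) = s at *
  generalize Real.Gamma (2 * lam + 1) = G at *
  generalize (2 : ℝ) ^ lam = t at *
  generalize √Real.pi = c at *
  have hlam : 0 < lam := by linarith
  -- Needs `lam + 1/2 ≤ π lam²`, true for `lam ≥ 1`.
  have hgs : g ≤ c * lam * s := by
    refine le_of_sq_le_sq ?_ (by positivity)
    have : g ^ 2 ≤ (lam + 1 / 2) * s ^ 2 := by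
      have h : (lam + 1 / 2) * g ^ 2 ≤ (lam + 1 / 2) * ((lam + 1 / 2) * s ^ 2) := by linarith
      exact le_of_mul_le_mul_left h (by linarith)
    refine this.trans ?_
    rw [mul_pow]
    refine mul_le_mul_of_nonneg_right ?_ (by positivity)
    rw [mul_pow]
    nlinarith
  have h1 : g * q ^ 2 ≤ 2 * c * s * p ^ 2 := by
    calc g * q ^ 2 ≤ c * lam * s * q ^ 2 := by gcongr
      _ = 2 * c * s * (lam / 2 * q ^ 2) := by ring
      _ ≤ 2 * c * s * p ^ 2 := by gcongr
  rw [div_mul_eq_mul_div, div_pow, div_le_iff₀ (by positivity)]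
  have h2 : (g * c) ^ 2 * g ^ 2 ≤ (2 * (G * c)) * c * (p ^ 2) ^ 2 := by
    rw [← d1, ← d2]
    calc (q * p * t) ^ 2 * g ^ 2 = (g * q ^ 2) * (p ^ 2 * t ^ 2 * g) := by ring
      _ ≤ (2 * c * s * p ^ 2) * (p ^ 2 * t ^ 2 * g) := by gcongr
      _ = _ := by ring
  have h3 : c ^ 2 * ((g * g) ^ 2) ≤ c ^ 2 * (2 * G * (p ^ 2) ^ 2) := by linarith
  exact le_of_mul_le_mul_left h3 (by positivity)

theorem sqrt_two_le_risingBound {lam : ℝ} (hl : -1 / 2 < lam) : √2 ≤ risingBound lam := by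
  have hg : 0 < Real.Gamma (lam + 1) := Real.Gamma_pos_of_pos (by linarith)
  rw [risingBound, le_div_iff₀ hg]
  refine mul_le_mul_of_nonneg_left (Real.le_sqrt_of_sq_le ?_) (Real.sqrt_nonneg _)
  rw [sq]
  rcases le_total 0 lam with h | h
  · have := Gamma_mul_Gamma_le (u := 1) (v := 2 * lam + 1) (x := lam + 1) (y := lam + 1)
      one_pos (by linarith) (by linarith) (by ring)
    rwa [Real.Gamma_one, one_mul] at this
  · have := Gamma_mul_Gamma_le (u := 2 * lam + 1) (v := 1) (x := lam + 1) (y := lam + 1)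
      (by linarith) (by linarith) (by linarith) (by ring)
    rwa [Real.Gamma_one, mul_one] at this

/-- For `lam ≤ 1` the coefficients are at most `|lam| ≤ 1`, and the constant is at least `√2`; only
`lam ≥ 1` needs the central binomial bound. -/
theorem abs_rising_neg_succ_le_risingBound {lam : ℝ} (hl : -1 / 2 < lam) (l : ℕ) :
    |rising (-lam) (l + 1)| ≤ risingBound lam := by
  rcases le_total 1 lam with h | h
  · exact (abs_rising_neg_le (by linarith) _).trans (Gamma_quotient_le_risingBound h)
  · refine ((abs_rising_neg_succ_le_abs (by linarith) h l).trans ?_).trans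
      (sqrt_two_le_risingBound hl)
    exact (abs_le.2 ⟨by linarith, h⟩).trans (Real.one_le_sqrt.2 one_le_two)

/-! ### The error bound uniform in `n` and `ρ`, and its constants -/

/-- Three regimes in `r = ρ⁻²`: for `r ≥ r₀` Bessel's bound suffices for every `n`; for `r ≤ r₀` and
`n ≥ N` the generating function is used; for `r ≤ r₀` and `n < N` Bessel's bound is absorbed into `K
/ n`. -/
theorem exists_norm_gaussRemainder_le {lam : ℝ} (hl : -1 / 2 < lam) (h0 : lam ≠ 0) {A : ℝ}
    (hA0 : 0 < A) (hA : ∀ l, |rising (-lam) (l + 1)| ≤ A) :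
    ∃ K : ℝ, 0 ≤ K ∧ ∀ n : ℕ, 1 ≤ n → ∀ ρ : ℝ, 1 < ρ → ∀ u : ℂ → ℂ, AnalyticOnEllipse ρ u →
      ‖gaussRemainder n (lam - 1 / 2) (lam - 1 / 2) u‖ ≤
        (1 + K / n) * maxOnEllipse ρ u / ρ ^ (2 * n) * (2 * (Real.pi / 2 ^ (2 * lam))) *
          (1 + A * (ρ⁻¹ ^ 2 / (1 - ρ⁻¹ ^ 2))) * ellipseFactor lam (ρ⁻¹ ^ 2) := by
  set c : ℝ := 2 * (Real.pi / 2 ^ (2 * lam)) with hc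
  have hc0 : 0 < c := by positivity
  set m : ℝ := 4 * wInt lam 1 with hm
  have hm0 : 0 < m := by
    rw [hm, wInt_one hl]
    have g1 : 0 < Real.Gamma (lam + 1 / 2) := Real.Gamma_pos_of_pos (by linarith)
    have g2 : 0 < Real.Gamma (lam + 1) := Real.Gamma_pos_of_pos (by linarith)
    positivity
  -- As `r → 1` the Bessel bound grows like `(1 - r)^(-1/2)`, the permitted one like `(1 - r)⁻¹`;
  -- positivity of `A` is essential.
  obtain ⟨r₀, hr0, hr1, hr⟩ : ∃ r₀ : ℝ, 0 < r₀ ∧ r₀ < 1 ∧ ∀ r, r₀ ≤ r → r < 1 →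
      m / √(1 - r ^ 2) ≤ c * (A * (r / (1 - r))) := by
    have ht : Tendsto (fun r : ℝ => c * A * r - m * √(1 - r)) (nhds 1)
        (nhds (c * A * 1 - m * √(1 - 1))) := by
      apply Continuous.tendsto; fun_prop
    have hpos : 0 < c * A * 1 - m * √(1 - 1) := by simp; positivity
    have hev := ht.eventually_const_lt hpos
    obtain ⟨ε, hε, h⟩ := Metric.eventually_nhds_iff.1 hev
    refine ⟨max (1 / 2) (1 - ε / 2), by positivity, by simp; exact ⟨by norm_num, hε⟩, ?_⟩
    intro r hr hr1
    have hr2 := (le_max_left _ _).trans hr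
    have hr3 := (le_max_right _ _).trans hr
    have h4 := @h r (by rw [Real.dist_eq, abs_lt]; constructor <;> linarith)
    have h5 : 0 < √(1 - r) := Real.sqrt_pos.2 (by linarith)
    have h6 : √(1 - r) ≤ √(1 - r ^ 2) := Real.sqrt_le_sqrt (by nlinarith)
    have h7 : √(1 - r) * √(1 - r) = 1 - r := Real.mul_self_sqrt (by linarith)
    calc m / √(1 - r ^ 2) ≤ m / √(1 - r) := by gcongr
      _ = m * √(1 - r) / (1 - r) := by
        rw [div_eq_div_iff h5.ne' (by linarith)]
        linear_combination -m * h7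
      _ ≤ c * A * r / (1 - r) :=
        div_le_div_of_nonneg_right (by linarith) (by linarith)
      _ = _ := by ring
  obtain ⟨K₁, hK₁, N, hN⟩ := exists_norm_tsum_polyRem_le hl h0 hr0 hr1 hA
  obtain ⟨K₂, hK₂, hP⟩ := exists_polyRem_T_two_mul_le hl h0
  set s : ℝ := m / √(1 - r₀ ^ 2) with hs
  have hs0 : 0 ≤ s := by positivity
  -- For `n < N` this gives `K₃ / n ≥ s / c`, so `c K₃ / n` alone dominates the Bessel bound `s`.
  set K₃ : ℝ := N * (s / c) with hK₃
  have hK₃0 : 0 ≤ K₃ := by positivity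
  refine ⟨K₂ + K₁ + K₂ * K₁ + K₃, by positivity, ?_⟩
  intro n hn ρ hρ u hu
  set K := K₂ + K₁ + K₂ * K₁ + K₃ with hK
  have hK0 : 0 ≤ K := by positivity
  have hn0 : (0 : ℝ) < n := by exact_mod_cast hn
  set M := maxOnEllipse ρ u with hM
  have hM0 : 0 ≤ M := maxOnEllipse_nonneg hρ hu
  have hρ0 : 0 < ρ := by linarith
  set r : ℝ := ρ⁻¹ ^ 2 with hrdef
  have hrp : 0 < r := by positivity
  have hrl : r < 1 := by
    rw [hrdef]; exact pow_lt_one₀ (by positivity) (inv_lt_one_of_one_lt₀ hρ) two_ne_zero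
  set w := ellipseFactor lam r with hw
  have hw1 : 1 ≤ w := one_le_ellipseFactor lam hrp.le hrl
  have hq : 0 < r / (1 - r) := div_pos hrp (by linarith)
  set Q := r / (1 - r) with hQ
  have hD : 0 ≤ M / ρ ^ (2 * n) := by positivity
  have hgoal : (1 + K / n) * M / ρ ^ (2 * n) * c * (1 + A * Q) * w =
      M / ρ ^ (2 * n) * ((1 + K / n) * c * (1 + A * Q) * w) := by ring
  rw [hgoal]
  have hKn : 0 ≤ K / n := by positivity
  have hAQ : 0 < A * Q := by positivity
  have hbes : ‖gaussRemainder n (lam - 1 / 2) (lam - 1 / 2) u‖ ≤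
      M / ρ ^ (2 * n) * (m / √(1 - r ^ 2)) := by
    refine (norm_gaussRemainder_le_bessel hρ hu hl h0 hn).trans_eq ?_
    rw [hm, hM, hrdef]; ring
  rcases le_total r₀ r with hrr | hrr
  · refine hbes.trans (mul_le_mul_of_nonneg_left ((hr r hrr hrl).trans ?_) hD)
    calc c * (A * Q) = 1 * c * (A * Q) * 1 := by ring
      _ ≤ (1 + K / n) * c * (1 + A * Q) * w := by
        gcongr <;> linarith
  rcases le_or_gt N n with hNn | hNn
  · have hf := norm_gaussRemainder_le_of_forall hρ hu hl h0 hn (B := Real.pi / 2 ^ (2 * lam) *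
      ((1 + K₂ / n) * (1 + K₁ / n)) * (1 + A * Q) * w) (fun y hy => by
        have h1 := hN n hn hNn y (by rw [hy]; exact hrr)
        rw [hy] at h1
        refine h1.trans ?_
        calc polyRem lam n (Chebyshev.T ℝ (2 * n)) * (1 + K₁ / n) * (1 + A * Q) * w
            ≤ (Real.pi / 2 ^ (2 * lam) * (1 + K₂ / n)) * (1 + K₁ / n) * (1 + A * Q) * w := by
              have := (hP n hn).2
              gcongr
          _ = _ := by ring)
    refine hf.trans ?_
    have h2 := one_add_div_mul_le hK₂ hK₁ hn
    have h3 : (1 + K₂ / n) * (1 + K₁ / n) ≤ 1 + K / n := by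
      refine h2.trans ?_
      gcongr
      linarith
    calc 2 * M / ρ ^ (2 * n) * (Real.pi / 2 ^ (2 * lam) *
          ((1 + K₂ / n) * (1 + K₁ / n)) * (1 + A * Q) * w)
        = M / ρ ^ (2 * n) * (((1 + K₂ / n) * (1 + K₁ / n)) * c * (1 + A * Q) * w) := by
          rw [hc]; ring
      _ ≤ _ := by gcongr
  · refine hbes.trans (mul_le_mul_of_nonneg_left ?_ hD)
    have h4 : m / √(1 - r ^ 2) ≤ s := by
      have : 0 < √(1 - r₀ ^ 2) := Real.sqrt_pos.2 (by nlinarith)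
      rw [hs]
      gcongr
    have h5 : s ≤ K / n * c := by
      have h6 : K₃ ≤ K := by rw [hK]; nlinarith [mul_nonneg hK₂ hK₁]
      have h7 : s / c ≤ K₃ / n := by
        rw [hK₃, le_div_iff₀ hn0, mul_comm]
        gcongr
      calc s = s / c * c := by field_simp
        _ ≤ K / n * c :=
          mul_le_mul_of_nonneg_right (h7.trans (div_le_div_of_nonneg_right h6 hn0.le)) hc0.le
    calc m / √(1 - r ^ 2) ≤ K / n * c := h4.trans h5
      _ ≤ (1 + K / n) * c := mul_le_mul_of_nonneg_right (by linarith) hc0.le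
      _ ≤ (1 + K / n) * c * (1 + A * Q) := le_mul_of_one_le_right (by positivity) (by linarith)
      _ ≤ (1 + K / n) * c * (1 + A * Q) * w := le_mul_of_one_le_right (by positivity) hw1

theorem isBigO_one_add_div_sub_one (K : ℝ) :
    (fun n : ℕ => (1 + K / n) - 1) =O[atTop] (fun n : ℕ => (n : ℝ)⁻¹) := by
  have : (fun n : ℕ => (1 + K / n) - 1) = fun n : ℕ => K * (n : ℝ)⁻¹ := by
    ext n; rw [add_sub_cancel_left, div_eq_mul_inv]
  rw [this]
  exact isBigO_const_mul_self _ _ _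

theorem inv_sq_div_one_sub {ρ : ℝ} (hρ : 1 < ρ) :
    ρ⁻¹ ^ 2 / (1 - ρ⁻¹ ^ 2) = 1 / (ρ ^ 2 - 1) := by
  have h1 : ρ ^ 2 - 1 ≠ 0 := by nlinarith
  have h2 : ρ ≠ 0 := by linarith
  have h3 : 1 - ρ⁻¹ ^ 2 = (ρ ^ 2 - 1) / ρ ^ 2 := by field_simp
  rw [h3]
  field_simp

/-- The duplication formula turns `Γ(α + 3/2)` into `Γ(α + 1)` and `Γ(2α + 2)`, matching the
constant of the theorem. -/
theorem two_pi_mul_risingBound {α : ℝ} (hα : -1 < α) :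
    √Real.pi / 2 ^ (2 * α) * risingBound (α + 1 / 2) =
      Real.Gamma (α + 1) / √(Real.Gamma (2 * α + 2)) * (2 * √2) := by
  have h := Gamma_two_mul_add_one (α + 1 / 2)
  rw [show α + 1 / 2 + 1 / 2 = α + 1 by ring, show 2 * (α + 1 / 2) + 1 = 2 * α + 2 by ring,
    show 2 * (α + 1 / 2) = 2 * α + 1 by ring, Real.rpow_add_one two_ne_zero] at h
  rw [risingBound, show 2 * (α + 1 / 2) + 1 = 2 * α + 2 by ring]
  have g1 : 0 < Real.Gamma (α + 1 / 2 + 1) := Real.Gamma_pos_of_pos (by linarith)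
  have g2 : 0 < Real.Gamma (2 * α + 2) := Real.Gamma_pos_of_pos (by linarith)
  have g3 : (0 : ℝ) < 2 ^ (2 * α) := Real.rpow_pos_of_pos two_pos _
  have g4 := Real.sq_sqrt g2.le
  have g5 := Real.sqrt_pos.2 g2
  generalize Real.Gamma (α + 1 / 2 + 1) = p at *
  generalize √(Real.Gamma (2 * α + 2)) = q at *
  rw [← g4] at h
  generalize (2 : ℝ) ^ (2 * α) = t at *
  field_simp
  linear_combination -h

end GaussQuad

end

theorem mainTheorem4 :
    (∀ α : ℝ, -1 < α → α ≠ -1 / 2 →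
      ∃ C : ℕ → ℝ, (fun n => C n - 1) =O[atTop] (fun n => (n : ℝ)⁻¹) ∧
        ∀ n : ℕ, 1 ≤ n → ∀ ρ : ℝ, 1 < ρ → ∀ u : ℂ → ℂ, GaussQuad.AnalyticOnEllipse ρ u →
          ‖GaussQuad.gegenbauerGaussRemainder n α u‖ ≤
            C n * GaussQuad.maxOnEllipse ρ u * √Real.pi / ρ ^ (2 * n) *
              (√Real.pi / (2 : ℝ) ^ (2 * α) +
                Real.Gamma (α + 1) / √(Real.Gamma (2 * α + 2)) * (2 * √2 / (ρ ^ 2 - 1))) *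
              (if -1 / 2 < α then (1 + (ρ ^ 2)⁻¹) ^ (α + 1 / 2)
                else (1 - (ρ ^ 2)⁻¹) ^ (α + 1 / 2))) ∧
    (∃ C : ℕ → ℝ, (fun n => C n - 1) =O[atTop] (fun n => (n : ℝ)⁻¹) ∧
      ∀ n : ℕ, 1 ≤ n → ∀ ρ : ℝ, 1 < ρ → ∀ u : ℂ → ℂ, GaussQuad.AnalyticOnEllipse ρ u →
        ‖GaussQuad.legendreGaussRemainder n u‖ ≤
          C n * GaussQuad.maxOnEllipse ρ u * Real.pi * √(1 + (ρ ^ 2)⁻¹) / ρ ^ (2 * n) *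
            (1 + 1 / (2 * (ρ ^ 2 - 1)))) := by
  refine ⟨fun α hα hα' => ?_, ?_⟩
  · have hl : -1 / 2 < α + 1 / 2 := by linarith
    have h0 : α + 1 / 2 ≠ 0 := fun h => hα' (by linarith)
    obtain ⟨K, -, h⟩ := GaussQuad.exists_norm_gaussRemainder_le hl h0
      ((Real.sqrt_pos.2 two_pos).trans_le (GaussQuad.sqrt_two_le_risingBound hl))
      (GaussQuad.abs_rising_neg_succ_le_risingBound hl)
    refine ⟨fun n => 1 + K / n, GaussQuad.isBigO_one_add_div_sub_one K, ?_⟩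
    intro n hn ρ hρ u hu
    refine (le_of_eq ?_).trans ((h n hn ρ hρ u hu).trans_eq ?_)
    · rw [add_sub_cancel_right, GaussQuad.gegenbauerGaussRemainder]
    · have e1 : GaussQuad.ellipseFactor (α + 1 / 2) (ρ⁻¹ ^ 2) =
          (if -1 / 2 < α then (1 + (ρ ^ 2)⁻¹) ^ (α + 1 / 2)
                else (1 - (ρ ^ 2)⁻¹) ^ (α + 1 / 2)) := by
        rw [GaussQuad.ellipseFactor, inv_pow]
        exact if_congr ⟨fun h => by linarith, fun h => by linarith⟩ rfl rfl
      have e2 := GaussQuad.two_pi_mul_risingBound hα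
      have e3 : 2 * (Real.pi / 2 ^ (2 * (α + 1 / 2))) =
          √Real.pi * (√Real.pi / (2 : ℝ) ^ (2 * α)) := by
        rw [show 2 * (α + 1 / 2) = 2 * α + 1 by ring, Real.rpow_add_one two_ne_zero,
          ← mul_div_assoc √Real.pi, Real.mul_self_sqrt Real.pi_pos.le]
        field_simp
      rw [e1, e3, GaussQuad.inv_sq_div_one_sub hρ]
      linear_combination (1 + K / n) * GaussQuad.maxOnEllipse ρ u * √Real.pi / ρ ^ (2 * n) *
        (1 / (ρ ^ 2 - 1)) * (if -1 / 2 < α then (1 + (ρ ^ 2)⁻¹) ^ (α + 1 / 2)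
                else (1 - (ρ ^ 2)⁻¹) ^ (α + 1 / 2)) * e2
  · have hl : (-1 / 2 : ℝ) < 1 / 2 := by norm_num
    -- For `lam = 1/2` the sharper `A = |lam| = 1/2` is available, which produces the term `1 / (2
    -- (ρ² - 1))`.
    obtain ⟨K, -, h⟩ := GaussQuad.exists_norm_gaussRemainder_le hl (by norm_num)
      (A := 1 / 2) (by norm_num) (fun l => (GaussQuad.abs_rising_neg_succ_le_abs (by norm_num)
        (by norm_num) l).trans_eq (by norm_num))
    refine ⟨fun n => 1 + K / n, GaussQuad.isBigO_one_add_div_sub_one K, ?_⟩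
    intro n hn ρ hρ u hu
    refine (le_of_eq ?_).trans ((h n hn ρ hρ u hu).trans_eq ?_)
    · rw [sub_self, GaussQuad.legendreGaussRemainder]
    · have e1 : GaussQuad.ellipseFactor (1 / 2) (ρ⁻¹ ^ 2) = √(1 + (ρ ^ 2)⁻¹) := by
        rw [GaussQuad.ellipseFactor, inv_pow, if_pos (by norm_num), Real.sqrt_eq_rpow]
      have e2 : 1 / (2 * (ρ ^ 2 - 1)) = 1 / 2 * (1 / (ρ ^ 2 - 1)) := by
        rw [one_div_mul_one_div]
      rw [e1, e2, GaussQuad.inv_sq_div_one_sub hρ, mul_one_div_cancel two_ne_zero, Real.rpow_one]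
      ring
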